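/- Let $D^2\subset\mathbb R^2$ be the closed unit disk with its standard area form $\omega=dx\wedge dy$, and let $\{\phi_t\}_{0\le t\le 1}$ be a smooth isotopy of $D^2$ through area preserving diffeomorphisms with $\phi_0=\mathrm{id}$, all equal to the identity on a fixed neighborhood of $\partial D^2$. Let $X(x,t)=X_t(x)$, where $\frac{d}{dt}\phi_t=X_t\circ\phi_t$, be regarded for $0\le t<1$ as a vector field on the solid torus $D^2\times\mathbb R/\mathbb Z$; the vector field $X+\frac{\partial}{\partial t}$ is the suspension of $\{\phi_t\}$. Let $\tau\colon D^2\times\mathbb R/\mathbb Z\to\mathbb R^3$ be a smooth embedding with $\tau^*dV=\omega\wedge dt$ that can be deformed, through smooth embeddings depending smoothly on the parameter, to a standard embedding $$((r,\theta),t)\mapsto\big((A+Br\cos\theta)\cos 2\pi t,\;Br\sin\theta,\;(A+Br\cos\theta)\sin 2\pi t\big),\qquad A>B>0.$$ For a vector field $V$ on the solid torus let $\tau_*V$ be its push-forward, extended by $0$ to $\mathbb R^3$. A primitive of a bounded, compactly supported vector field $Y$ on $\mathbb R^3$ is a locally integrable one-form $\beta_Y$ on $\mathbb R^3$ with $d\beta_Y=\iota_YdV$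 in the sense of distributions; $Y$ is called exact if it has a primitive. For exact $Y,Z$ put $\mathcal R(Y,Z)=\int_{\mathbb R^3}\beta_Y\wedge\iota_ZdV=\int_{\mathbb R^3}\beta_Z\wedge\iota_YdV$ (relative helicity), and $\mathcal H(Y)=\mathcal R(Y,Y)$ (helicity). Write $\mathcal H(V)$ and $\mathcal R(V,W)$ for $\mathcal H(\tau_*V)$ and $\mathcal R(\tau_*V,\tau_*W)$. Then every isotopy as above is generated by a smooth function $F\colon[0,1]\times D^2\to\mathbb R$, $\iota_{X_t}\omega=dF_t$, that vanishes near $\partial D^2$, and the Calabi invariant $\mathrm{Cal}(\phi)=\int_0^1\int_{D^2}F_t\,\omega\,dt$ depends only on the time-one map $\phi=\phi_1$. The vector fields $\tau_*X$, $\tau_*\frac{\partial}{\partial t}$ and $\tau_*(X+\frac{\partial}{\partial t})$ are exact, their helicities and relative helicities do not depend on the choice of the primitives, and the helicity of the suspension is $$\mathcal H\Big(X+\frac{\partial}{\partial t}\Big)=2\,\mathrm{Cal}(\phi).$$ In fact $$\mathcal H\Big(X+\frac{\partial}{\partial t}\Big)=\mathcal H(X)+2\,\mathcal R\Big(X,\frac{\partial}{\partial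 t}\Big)+\mathcal H\Big(\frac{\partial}{\partial t}\Big),\qquad \mathcal H(X)=0,\quad \mathcal H\Big(\frac{\partial}{\partial t}\Big)=0,\quad \mathcal R\Big(X,\frac{\partial}{\partial t}\Big)=\mathrm{Cal}(\phi).$$ -/

import Mathlib

open MeasureTheory Set
open scoped ContDiff

noncomputable section

namespace DiskSuspension

/-- The Euclidean plane. -/
abbrev E2 : Type := EuclideanSpace ℝ (Fin 2)

/-- Euclidean three-space. -/
abbrev E3 : Type := EuclideanSpace ℝ (Fin 3)

/-- The closed unit disk `D²`. -/
def disk : Set E2 := Metric.closedBall 0 1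

/-- The standard area form `ω = dx ∧ dy = r dr ∧ dθ` on the plane. -/
def areaForm (u v : E2) : ℝ := u 0 * v 1 - u 1 * v 0

/-- A smooth area preserving isotopy `{φ_t}`, `0 ≤ t ≤ 1`, of the closed unit disk, starting at the
identity, and equal to the identity on a collar of the boundary circle. Only the values `φ t x` with
`t ∈ [0,1]` and `x ∈ D²` matter. (Each `φ_t` is a bijection whose differential is invertible, so it
is a diffeomorphism.) -/
structure IsAreaPreservingIsotopy (φ : ℝ → E2 → E2) : Prop where
  smooth : ContDiffOn ℝ ∞ (fun p : ℝ × E2 => φ p.1 p.2) (Icc (0 : ℝ) 1 ×ˢ disk)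
  bijOn : ∀ t ∈ Icc (0 : ℝ) 1, BijOn (φ t) disk disk
  area : ∀ t ∈ Icc (0 : ℝ) 1, ∀ x ∈ disk, ∀ u v : E2,
    areaForm (fderivWithin ℝ (φ t) disk x u) (fderivWithin ℝ (φ t) disk x v) = areaForm u v
  start : ∀ x ∈ disk, φ 0 x = x
  near_boundary : ∃ δ : ℝ, 0 < δ ∧
    ∀ t ∈ Icc (0 : ℝ) 1, ∀ x ∈ disk, 1 - δ ≤ ‖x‖ → φ t x = x

/-- `F` is a normalized smooth Hamiltonian function generating the isotopy `φ`: it is smooth on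
`[0,1] × D²`, it vanishes on a collar of the boundary circle, and `d/dt φ_t = X_t ∘ φ_t`
with `ι_{X_t} ω = dF_t`. -/
structure IsNormalizedHamiltonian (F : ℝ → E2 → ℝ) (φ : ℝ → E2 → E2) : Prop where
  smooth : ContDiffOn ℝ ∞ (fun p : ℝ × E2 => F p.1 p.2) (Icc (0 : ℝ) 1 ×ˢ disk)
  near_boundary : ∃ δ : ℝ, 0 < δ ∧
    ∀ t ∈ Icc (0 : ℝ) 1, ∀ x ∈ disk, 1 - δ ≤ ‖x‖ → F t x = 0
  generates : ∀ t ∈ Icc (0 : ℝ) 1, ∀ x ∈ disk, ∀ v : E2,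
    areaForm (derivWithin (fun s => φ s x) (Icc (0 : ℝ) 1) t) v
      = fderivWithin ℝ (F t) disk (φ t x) v

/-- `c` is the Calabi invariant of the disk map `g`: `g` is the time-one map of some isotopy, and
every isotopy with time-one map `g` has a normalized generating Hamiltonian `F`, for which
`∫₀¹ ∫_{D²} F_t ω dt = c`. Thus `c` depends on `g` only. -/
def IsCalabiInvariant (g : E2 → E2) (c : ℝ) : Prop :=
  (∃ φ, IsAreaPreservingIsotopy φ ∧ EqOn (φ 1) g disk) ∧
  ∀ φ, IsAreaPreservingIsotopy φ → EqOn (φ 1) g disk →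
    (∃ F, IsNormalizedHamiltonian F φ) ∧
    ∀ F, IsNormalizedHamiltonian F φ → ∫ t in (0 : ℝ)..1, ∫ x in disk, F t x = c

/-- `D² × ℝ`, the universal cover of the solid torus `D² × ℝ/ℤ`. -/
def cylinder : Set (E2 × ℝ) := disk ×ˢ univ

/-- The fundamental domain `D² × [0,1)` of the solid torus. A vector field on the solid torus is
given by its values there. -/
def fundamentalDomain : Set (E2 × ℝ) := disk ×ˢ Ico 0 1

/-- The time-dependent vector field `X_t = (d/dt φ_t) ∘ φ_t⁻¹` that generates the isotopy, regarded
as a vector field `X` on the solid torus, tangent to the disks `t = const`. -/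
def horizontalField (φ : ℝ → E2 → E2) (p : E2 × ℝ) : E2 × ℝ :=
  (derivWithin (fun s => φ s (Function.invFunOn (φ p.2) disk p.1)) (Icc (0 : ℝ) 1) p.2, 0)

/-- The vector field `∂/∂t` on the solid torus. -/
def verticalField (_p : E2 × ℝ) : E2 × ℝ := (0, 1)

/-- The suspension `X + ∂/∂t` of the isotopy `φ`. -/
def suspensionField (φ : ℝ → E2 → E2) (p : E2 × ℝ) : E2 × ℝ :=
  horizontalField φ p + verticalField p

/-- The volume form `ω ∧ dt` on the solid torus. -/
def torusVolumeForm (u v w : E2 × ℝ) : ℝ :=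
  areaForm u.1 v.1 * w.2 + areaForm v.1 w.1 * u.2 + areaForm w.1 u.1 * v.2

/-- The standard volume form `dV` on three-space. -/
def volumeForm (u v w : E3) : ℝ := Matrix.det !![u 0, u 1, u 2; v 0, v 1, v 2; w 0, w 1, w 2]

/-- A smooth embedding of the solid torus `D² × ℝ/ℤ` into three-space, given as a map on `D² × ℝ`
that is one-periodic in the second variable. (Smoothness is up to the boundary.) -/
structure IsTorusEmbedding (τ : E2 × ℝ → E3) : Prop where
  smooth : ContDiffOn ℝ ∞ τ cylinder
  periodic : ∀ x ∈ disk, ∀ t : ℝ, τ (x, t + 1) = τ (x, t)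
  injOn : InjOn τ fundamentalDomain
  immersion : ∀ p ∈ cylinder, Function.Injective (fderivWithin ℝ τ cylinder p)

/-- `τ^* dV = ω ∧ dt`. -/
def IsVolumePreserving (τ : E2 × ℝ → E3) : Prop :=
  ∀ p ∈ cylinder, ∀ u v w : E2 × ℝ,
    volumeForm (fderivWithin ℝ τ cylinder p u) (fderivWithin ℝ τ cylinder p v)
      (fderivWithin ℝ τ cylinder p w) = torusVolumeForm u v w

/-- The solid torus of revolution, `(x, t) ↦ ((A + B x₀) cos 2πt, B x₁, (A + B x₀) sin 2πt)`. -/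
def standardTorus (A B : ℝ) (p : E2 × ℝ) : E3 :=
  !₂[(A + B * p.1 0) * Real.cos (2 * Real.pi * p.2), B * p.1 1,
    (A + B * p.1 0) * Real.sin (2 * Real.pi * p.2)]

/-- `τ` is a deformation, through smooth embeddings, of a standard embedding with `A > B > 0`. -/
def IsDeformationOfStandard (τ : E2 × ℝ → E3) : Prop :=
  ∃ A B : ℝ, 0 < B ∧ B < A ∧ ∃ σ : ℝ → E2 × ℝ → E3,
    ContDiffOn ℝ ∞ (fun q : ℝ × (E2 × ℝ) => σ q.1 q.2) (Icc (0 : ℝ) 1 ×ˢ cylinder) ∧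
    (∀ s ∈ Icc (0 : ℝ) 1, IsTorusEmbedding (σ s)) ∧
    EqOn (σ 0) (standardTorus A B) cylinder ∧ EqOn (σ 1) τ cylinder

open Classical in
/-- The push-forward `τ_* V` of a vector field `V` on the solid torus, extended by zero outside the
image of `τ` to a (possibly discontinuous) vector field on three-space. -/
def pushforward (τ : E2 × ℝ → E3) (V : E2 × ℝ → E2 × ℝ) (q : E3) : E3 :=
  if q ∈ τ '' fundamentalDomain then
    fderivWithin ℝ τ cylinder (Function.invFunOn τ fundamentalDomain q)
      (V (Function.invFunOn τ fundamentalDomain q))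
  else 0

/-- The standard basis of three-space. -/
def e (i : Fin 3) : E3 := EuclideanSpace.single i 1

/-- The coefficient of `β ∧ σ` with respect to `dV`, for a one-form `β` and a two-form `σ` at a
point of three-space. -/
def wedge (β : E3 →L[ℝ] ℝ) (σ : E3 → E3 → ℝ) : ℝ :=
  β (e 0) * σ (e 1) (e 2) + β (e 1) * σ (e 2) (e 0) + β (e 2) * σ (e 0) (e 1)

/-- The exterior derivative of a smooth one-form on three-space, at the point `q`. -/
def extD (η : E3 → E3 →L[ℝ] ℝ) (q : E3) (u v : E3) : ℝ :=
  fderiv ℝ η q u v - fderiv ℝ η q v u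

/-- The two-form `ι_Y dV`, at the point `q`. -/
def contraction (Y : E3 → E3) (q : E3) (u v : E3) : ℝ := volumeForm (Y q) u v

/-- The one-form `β` on all of three-space is a primitive of `ι_Y dV`, that is, `dβ = ι_Y dV`, in
the sense of distributions: `∫ β ∧ dη = ∫ η ∧ ι_Y dV` for all smooth compactly supported one-forms
`η`. (The weak sense is needed since the extension of a vector field by zero may jump.) -/
structure IsPrimitive (β : E3 → E3 →L[ℝ] ℝ) (Y : E3 → E3) : Prop where
  locallyIntegrable_field : LocallyIntegrable Y volume
  locallyIntegrable : LocallyIntegrable β volume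
  weak_eq : ∀ η : E3 → E3 →L[ℝ] ℝ, ContDiff ℝ ∞ η → HasCompactSupport η →
    ∫ q, wedge (β q) (extD η q) = ∫ q, wedge (η q) (contraction Y q)

/-- The vector field `Y` is exact, i.e. `ι_Y dV` has a primitive on three-space. -/
def IsExactField (Y : E3 → E3) : Prop := ∃ β, IsPrimitive β Y

/-- `r` is the relative helicity `R(Y, Z) = ∫ β_Y ∧ dβ_Z = ∫ β_Z ∧ dβ_Y` of the exact vector fields
`Y` and `Z`, for every choice of the primitives. -/
structure IsRelativeHelicity (Y Z : E3 → E3) (r : ℝ) : Prop where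
  exact_left : IsExactField Y
  exact_right : IsExactField Z
  left : ∀ β, IsPrimitive β Y →
    Integrable (fun q => wedge (β q) (contraction Z q)) volume ∧
      ∫ q, wedge (β q) (contraction Z q) = r
  right : ∀ γ, IsPrimitive γ Z →
    Integrable (fun q => wedge (γ q) (contraction Y q)) volume ∧
      ∫ q, wedge (γ q) (contraction Y q) = r

/-- `h` is the helicity `H(Y) = ∫ β_Y ∧ dβ_Y` of the exact vector field `Y`. -/
def IsHelicity (Y : E3 → E3) (h : ℝ) : Prop := IsRelativeHelicity Y Y h

end DiskSuspension

end

/-! Pulled back to the solid torus, `dV` becomes `ω ∧ dt`, and `ι_X (ω ∧ dt) = dF_t ∧ dt = d(F dt)`.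
So the push-forward of `F dt`, extended by zero, is an explicit primitive of `τ_* X`; it has bounded
support because `F` vanishes near the boundary circle (`isPrimitive_horizontalPrimitive`). Pairing
it with `X` gives `F dt(X) = 0`, hence `H(X) = 0`; pairing it with `∂/∂t` gives `F`, hence `R(X,
∂/∂t) = Cal`. No periodicity of `F` in `t` is needed, since the integration by parts takes place
inside each disk `t = const`.

For `H(∂/∂t)` no such primitive is at hand. The Biot-Savart primitive turns this helicity into a
double integral over pairs of points of the solid torus, which Fubini regroups as an integral over
pairs `(x, y)` of points of the disk of the Gauss integrals of the closed orbits through `x` and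
`y`. For `x ≠ y` these orbits stay disjoint during the deformation of `τ`, so the Gauss integral
keeps its value (`integral_solidAngle_eq`: the solid angle form is closed). For two parallels of the
standard torus a reflection shows that the value is zero. The diagonal is a null set.

Independence of primitives rests on two facts about bounded, weakly divergence-free fields of
bounded support (`IsAdmissible`): the Biot-Savart integral is a primitive
(`IsAdmissible.isPrimitive_biotSavart`), and a locally integrable, weakly closed form integrates to
zero against such a field (`IsWeaklyClosed.integral_eq_zero`). The second is proved by mollifying
the form to an exact one, moving the mollifier to the field and passing to the limit. Symmetry and
bilinearity of the pairing then give the expansion of `H(X + ∂/∂t)`.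

On the disk, a Hamiltonian exists because the pulled-back form `φ_t^* ι_{X_t} ω` is closed, and its
radial primitive can be normalized on the connected collar. The Calabi integral depends only on
`φ_1` because it is half the integral over the disk of the action function, whose differential is
`φ_1^* λ - λ` with `λ_x(v) = ω(x, v)/2` and which vanishes at a boundary point (`calabi_unique`). -/

noncomputable section

namespace DiskSuspension

open Filter Topology

set_option maxSynthPendingDepth 3

/-! ### Calculus on convex sets that need not be open. -/

section Calculus

variable {A B G : Type} [NormedAddCommGroup A] [NormedSpace ℝ A] [NormedAddCommGroup B]
  [NormedSpace ℝ B] [NormedAddCommGroup G] [NormedSpace ℝ G]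

theorem hasFDerivWithinAt_slice_right {f : A × B → G} {s : Set A} {t : Set B} {a : A} {b : B}
    (hf : DifferentiableWithinAt ℝ f (s ×ˢ t) (a, b)) (ha : a ∈ s) :
    HasFDerivWithinAt (fun y => f (a, y))
      ((fderivWithin ℝ f (s ×ˢ t) (a, b)).comp (ContinuousLinearMap.inr ℝ A B)) t b :=
  HasFDerivWithinAt.comp b (t := s ×ˢ t) hf.hasFDerivWithinAt
    (hasFDerivAt_prodMk_right a b).hasFDerivWithinAt (fun _ hy => ⟨ha, hy⟩)

theorem hasFDerivWithinAt_slice_left {f : A × B → G} {s : Set A} {t : Set B} {a : A} {b : B}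
    (hf : DifferentiableWithinAt ℝ f (s ×ˢ t) (a, b)) (hb : b ∈ t) :
    HasFDerivWithinAt (fun x => f (x, b))
      ((fderivWithin ℝ f (s ×ˢ t) (a, b)).comp (ContinuousLinearMap.inl ℝ A B)) s a :=
  HasFDerivWithinAt.comp a (t := s ×ˢ t) hf.hasFDerivWithinAt
    (hasFDerivAt_prodMk_left a b).hasFDerivWithinAt (fun _ hy => ⟨hy, hb⟩)

theorem fderivWithin_slice_right {f : A × B → G} {s : Set A} {t : Set B} {a : A} {b : B}
    (hf : DifferentiableWithinAt ℝ f (s ×ˢ t) (a, b)) (ha : a ∈ s)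
    (ht : UniqueDiffWithinAt ℝ t b) (v : B) :
    fderivWithin ℝ (fun y => f (a, y)) t b v = fderivWithin ℝ f (s ×ˢ t) (a, b) (0, v) := by
  rw [(hasFDerivWithinAt_slice_right hf ha).fderivWithin ht]; simp

theorem hasDerivWithinAt_slice_left {f : ℝ × B → G} {s : Set ℝ} {t : Set B} {a : ℝ} {b : B}
    (hf : DifferentiableWithinAt ℝ f (s ×ˢ t) (a, b)) (hb : b ∈ t) :
    HasDerivWithinAt (fun x => f (x, b)) (fderivWithin ℝ f (s ×ˢ t) (a, b) (1, 0)) s a := by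
  simpa using (hasFDerivWithinAt_slice_left hf hb).hasDerivWithinAt

/-- Mixed second derivatives of a smooth map on a convex set with interior points commute. -/
theorem fderivWithin_fderivWithin_comm {f : A → G} {s : Set A} (hs : Convex ℝ s)
    (hs' : (interior s).Nonempty) (hf : ContDiffOn ℝ ∞ f s) {x : A} (hx : x ∈ s) (u v : A) :
    fderivWithin ℝ (fun y => fderivWithin ℝ f s y u) s x v
      = fderivWithin ℝ (fun y => fderivWithin ℝ f s y v) s x u := by
  have hud : UniqueDiffOn ℝ s := uniqueDiffOn_convex hs hs'
  have hd : DifferentiableWithinAt ℝ (fderivWithin ℝ f s) s x :=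
    (hf.fderivWithin hud (m := 1) (by norm_cast)).differentiableOn (by simp) x hx
  have key : ∀ w : A, fderivWithin ℝ (fun y => fderivWithin ℝ f s y w) s x
      = (fderivWithin ℝ (fderivWithin ℝ f s) s x).flip w := fun w => by
    have h := hd.hasFDerivWithinAt.clm_apply (hasFDerivWithinAt_const w x s)
    rw [h.fderivWithin (hud x hx)]; ext; simp
  rw [key, key]
  have hsym := (hf x hx).isSymmSndFDerivWithinAt
    (by simpa using (ENat.LEInfty.out : (2 : WithTop ℕ∞) ≤ ∞)) hud
    (by rw [hs.closure_interior_eq_closure_of_nonempty_interior hs']; exact subset_closure hx) hx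
  exact hsym v u

theorem contDiffOn_fderivWithin_apply {f : A → G} {s : Set A} (hs : UniqueDiffOn ℝ s)
    (hf : ContDiffOn ℝ ∞ f s) (u : A) :
    ContDiffOn ℝ ∞ (fun y => fderivWithin ℝ f s y u) s :=
  (hf.fderivWithin hs (m := ∞) (by simp)).clm_apply contDiffOn_const

/-- Differentiation under the integral up to the boundary of `s`: compactness of the interval makes
the partial derivative continuous at `p` uniformly in `u`, and the mean value inequality on the
convex set `s ∩ ball p δ` turns this into a uniform bound on the remainder. -/
theorem hasFDerivWithinAt_intervalIntegral [CompleteSpace G] {s : Set A} (hs : Convex ℝ s)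
    (hs' : (interior s).Nonempty) {g : A × ℝ → G}
    (hg : ContDiffOn ℝ ∞ g (s ×ˢ Icc (0 : ℝ) 1)) {p : A} (hp : p ∈ s) :
    HasFDerivWithinAt (fun p => ∫ u in (0 : ℝ)..1, g (p, u))
      (∫ u in (0 : ℝ)..1, (fderivWithin ℝ g (s ×ˢ Icc (0 : ℝ) 1) (p, u)).comp
        (ContinuousLinearMap.inl ℝ A ℝ)) s p := by
  have hud : UniqueDiffOn ℝ (s ×ˢ Icc (0 : ℝ) 1) :=
    (uniqueDiffOn_convex hs hs').prod (uniqueDiffOn_Icc zero_lt_one)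
  set D : A → ℝ → A →L[ℝ] G := fun x u => (fderivWithin ℝ g (s ×ˢ Icc (0 : ℝ) 1) (x, u)).comp
    (ContinuousLinearMap.inl ℝ A ℝ) with hD
  have hDc : ContinuousOn D.uncurry (s ×ˢ Icc (0 : ℝ) 1) :=
    ((hg.fderivWithin hud (m := 0) (by simp)).continuousOn).clm_comp continuousOn_const
  have slice : ∀ x ∈ s, ContinuousOn (fun u => g (x, u)) (uIcc (0 : ℝ) 1) := fun x hx => by
    rw [uIcc_of_le zero_le_one]
    exact hg.continuousOn.comp (by fun_prop) (fun u hu => ⟨hx, hu⟩)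
  have sliceD : ∀ x ∈ s, ContinuousOn (D x) (uIcc (0 : ℝ) 1) := fun x hx => by
    rw [uIcc_of_le zero_le_one]
    exact hDc.comp (f := fun u => (x, u)) (by fun_prop) (fun u hu => ⟨hx, hu⟩)
  rw [hasFDerivWithinAt_iff_isLittleO, Asymptotics.isLittleO_iff]
  intro ε hε
  obtain ⟨v, hv, hvD⟩ := isCompact_Icc.mem_uniformity_of_prod hDc hp (Metric.dist_mem_uniformity hε)
  obtain ⟨δ, hδ, hball⟩ := Metric.mem_nhdsWithin_iff.1 hv
  filter_upwards [inter_mem_nhdsWithin s (Metric.ball_mem_nhds p hδ)] with x hx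
  have hpt : ∀ u ∈ Icc (0 : ℝ) 1, ‖g (x, u) - g (p, u) - D p u (x - p)‖ ≤ ε * ‖x - p‖ := by
    intro u hu
    refine ((hs.inter (convex_ball p δ))).norm_image_sub_le_of_norm_hasFDerivWithin_le'
      (f := fun x => g (x, u)) (f' := fun x => D x u) ?_ ?_ ⟨hp, Metric.mem_ball_self hδ⟩ hx
    · intro y hy
      exact (hasFDerivWithinAt_slice_left (hg.differentiableOn (by simp) (y, u) ⟨hy.1, hu⟩) hu).mono
        inter_subset_left
    · intro y hy
      have := hvD y (hball ⟨hy.2, hy.1⟩) u hu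
      rw [← dist_eq_norm]; exact le_of_lt this
  have i1 : IntervalIntegrable (fun u => g (x, u)) volume 0 1 := (slice x hx.1).intervalIntegrable
  have i2 : IntervalIntegrable (fun u => g (p, u)) volume 0 1 := (slice p hp).intervalIntegrable
  have i3 : IntervalIntegrable (D p) volume 0 1 := (sliceD p hp).intervalIntegrable
  have i4 : IntervalIntegrable (fun u => D p u (x - p)) volume 0 1 :=
    ((sliceD p hp).clm_apply continuousOn_const).intervalIntegrable
  have e : (∫ u in (0 : ℝ)..1, D p u) (x - p) = ∫ u in (0 : ℝ)..1, D p u (x - p) :=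
    ContinuousLinearMap.intervalIntegral_apply i3 _
  rw [e, ← intervalIntegral.integral_sub i1 i2, ← intervalIntegral.integral_sub (i1.sub i2) i4]
  simpa using intervalIntegral.norm_integral_le_of_norm_le_const (a := (0 : ℝ)) (b := 1)
    (C := ε * ‖x - p‖) (f := fun u => g (x, u) - g (p, u) - D p u (x - p))
    (fun u hu => hpt u (by rw [uIoc_of_le zero_le_one] at hu; exact ⟨hu.1.le, hu.2⟩))

theorem contDiffOn_intervalIntegral [CompleteSpace G] {s : Set A} (hs : Convex ℝ s)
    (hs' : (interior s).Nonempty) {g : A × ℝ → G}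
    (hg : ContDiffOn ℝ ∞ g (s ×ˢ Icc (0 : ℝ) 1)) :
    ContDiffOn ℝ ∞ (fun p => ∫ u in (0 : ℝ)..1, g (p, u)) s := by
  have hud : UniqueDiffOn ℝ (s ×ˢ Icc (0 : ℝ) 1) :=
    (uniqueDiffOn_convex hs hs').prod (uniqueDiffOn_Icc zero_lt_one)
  rw [contDiffOn_infty]
  intro n
  -- The derivative is an integral of the same kind with values in `A →L[ℝ] G`, so the target space
  -- has to vary in the induction.
  induction n generalizing G with
  | zero =>
    rw [Nat.cast_zero, contDiffOn_zero]
    exact fun p hp => (hasFDerivWithinAt_intervalIntegral hs hs' hg hp).continuousWithinAt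
  | succ n ih =>
    rw [Nat.cast_succ, contDiffOn_succ_iff_fderivWithin (uniqueDiffOn_convex hs hs')]
    refine ⟨fun p hp => (hasFDerivWithinAt_intervalIntegral hs hs' hg hp).differentiableWithinAt,
      by simp, ?_⟩
    refine (ih (g := fun q => (fderivWithin ℝ g (s ×ˢ Icc (0 : ℝ) 1) q).comp
      (ContinuousLinearMap.inl ℝ A ℝ)) ?_).congr fun p hp =>
        (hasFDerivWithinAt_intervalIntegral hs hs' hg hp).fderivWithin
          (uniqueDiffOn_convex hs hs' p hp)
    exact (hg.fderivWithin hud (m := ∞) (by simp)).clm_comp contDiffOn_const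

/-- A continuous right inverse of a smooth map with invertible differential is smooth. The sets are
not required to be open. -/
theorem contDiffOn_of_right_inverse [CompleteSpace A] {f : A → B} {s : Set A} {t : Set B}
    {g : B → A} (hf : ContDiffOn ℝ ∞ f s) (hs : UniqueDiffOn ℝ s) (ht : UniqueDiffOn ℝ t)
    (hinv : ∀ x ∈ s, ∃ e : A ≃L[ℝ] B, (e : A →L[ℝ] B) = fderivWithin ℝ f s x)
    (hg : ContinuousOn g t) (hgt : MapsTo g t s) (hfg : ∀ y ∈ t, f (g y) = y) :
    ContDiffOn ℝ ∞ g t := by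
  have hder : ∀ y ∈ t, HasFDerivWithinAt g
      (ContinuousLinearMap.inverse (fderivWithin ℝ f s (g y))) t y := by
    intro y hy
    obtain ⟨e, he⟩ := hinv (g y) (hgt hy)
    rw [← he, ContinuousLinearMap.inverse_equiv]
    refine HasFDerivWithinAt.of_local_left_inverse (f := f) (t := s)
      (tendsto_nhdsWithin_iff.2 ⟨hg y hy, ?_⟩) ?_ hy ?_
    · filter_upwards [self_mem_nhdsWithin] with z hz using hgt hz
    · rw [he]; exact (hf.differentiableOn (by simp) _ (hgt hy)).hasFDerivWithinAt
    · filter_upwards [self_mem_nhdsWithin] with z hz using hfg z hz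
  rw [contDiffOn_infty]
  intro n
  induction n with
  | zero => rw [Nat.cast_zero, contDiffOn_zero]; exact hg
  | succ n ih =>
    rw [Nat.cast_succ, contDiffOn_succ_iff_fderivWithin ht]
    refine ⟨fun y hy => (hder y hy).differentiableWithinAt, by simp, ?_⟩
    -- Bootstrapping: the derivative of `g` is inversion applied to `Df ∘ g`, which is as regular as
    -- `g` is already known to be.
    refine ContDiffOn.congr (f := fun y => ContinuousLinearMap.inverse (fderivWithin ℝ f s (g y)))
      ?_ fun y hy => (hder y hy).fderivWithin (ht y hy)
    have h1 : ContDiffOn ℝ n (fun y => fderivWithin ℝ f s (g y)) t :=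
      (hf.fderivWithin hs (m := n) (by exact_mod_cast le_top)).comp ih hgt
    intro y hy
    obtain ⟨e, he⟩ := hinv (g y) (hgt hy)
    refine ContDiffAt.comp_contDiffWithinAt y (g := ContinuousLinearMap.inverse) ?_ (h1 y hy)
    rw [← he]
    exact contDiffAt_map_inverse e

/-- The preimage of a closed set under the inverse is the image of a compact set, hence closed. -/
theorem continuousOn_invFunOn_of_isCompact {X Y : Type} [TopologicalSpace X] [TopologicalSpace Y]
    [T2Space Y] [Nonempty X] {f : X → Y} {s : Set X} {t : Set Y} (hs : IsCompact s)
    (hf : ContinuousOn f s) (hb : BijOn f s t) : ContinuousOn (Function.invFunOn f s) t := by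
  rw [continuousOn_iff_isClosed]
  intro C hC
  refine ⟨f '' (s ∩ C), ((hs.inter_right hC).image_of_continuousOn
    (hf.mono inter_subset_left)).isClosed, ?_⟩
  ext y
  constructor
  · rintro ⟨h1, h2⟩
    have h3 : y ∈ f '' s := hb.surjOn h2
    exact ⟨⟨_, ⟨Function.invFunOn_mem h3, h1⟩, Function.invFunOn_eq h3⟩, h2⟩
  · rintro ⟨⟨x, ⟨hx, hxC⟩, rfl⟩, h2⟩
    refine ⟨?_, h2⟩
    have : Function.invFunOn f s (f x) = x := hb.injOn.leftInvOn_invFunOn hx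
    simpa [this] using hxC

end Calculus

/-! ### The area form, the disk and time-dependent maps on it. -/

/-- The area form as a continuous bilinear map. -/
def areaFormL : E2 →L[ℝ] E2 →L[ℝ] ℝ :=
  (EuclideanSpace.proj 0 : E2 →L[ℝ] ℝ).smulRight (EuclideanSpace.proj 1 : E2 →L[ℝ] ℝ)
    - (EuclideanSpace.proj 1 : E2 →L[ℝ] ℝ).smulRight (EuclideanSpace.proj 0 : E2 →L[ℝ] ℝ)

@[simp] theorem areaFormL_apply (u v : E2) : areaFormL u v = areaForm u v := by
  simp [areaFormL, areaForm]

theorem areaForm_swap (u v : E2) : areaForm u v = -areaForm v u := by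
  simp only [areaForm]; ring

theorem eq_zero_of_areaForm {u : E2} (h : ∀ v, areaForm u v = 0) : u = 0 := by
  have h0 := h (EuclideanSpace.single 1 1)
  have h1 := h (EuclideanSpace.single 0 1)
  simp [areaForm] at h0 h1
  ext i; fin_cases i <;> simp [h0, h1]

theorem fderivWithin_areaForm {A : Type} [NormedAddCommGroup A] [NormedSpace ℝ A] {s : Set A}
    {f g : A → E2} {x : A} (hf : DifferentiableWithinAt ℝ f s x)
    (hg : DifferentiableWithinAt ℝ g s x) (hs : UniqueDiffWithinAt ℝ s x) (w : A) :
    fderivWithin ℝ (fun y => areaForm (f y) (g y)) s x w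
      = areaForm (fderivWithin ℝ f s x w) (g x) + areaForm (f x) (fderivWithin ℝ g s x w) := by
  have h := areaFormL.hasFDerivWithinAt_of_bilinear hf.hasFDerivWithinAt hg.hasFDerivWithinAt
  simp only [areaFormL_apply] at h
  rw [h.fderivWithin hs]
  simp [add_comm]

/-- The product of the time interval and the disk. -/
abbrev timeDisk : Set (ℝ × E2) := Icc (0 : ℝ) 1 ×ˢ disk

theorem convex_disk : Convex ℝ disk := convex_closedBall 0 1

theorem isCompact_disk : IsCompact disk := isCompact_closedBall 0 1

theorem nonempty_interior_disk : (interior disk).Nonempty := by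
  rw [disk, interior_closedBall _ one_ne_zero]
  exact Metric.nonempty_ball.2 one_pos

theorem uniqueDiffOn_disk : UniqueDiffOn ℝ disk :=
  uniqueDiffOn_convex convex_disk nonempty_interior_disk

theorem convex_timeDisk : Convex ℝ timeDisk := (convex_Icc 0 1).prod convex_disk

theorem nonempty_interior_timeDisk : (interior timeDisk).Nonempty := by
  rw [interior_prod_eq]
  exact (by rw [interior_Icc]; exact nonempty_Ioo.2 zero_lt_one : (interior _).Nonempty).prod
    nonempty_interior_disk

theorem uniqueDiffOn_timeDisk : UniqueDiffOn ℝ timeDisk :=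
  uniqueDiffOn_convex convex_timeDisk nonempty_interior_timeDisk

theorem isCompact_timeDisk : IsCompact timeDisk := isCompact_Icc.prod isCompact_disk

theorem uniqueDiffWithinAt_unitInterval {t : ℝ} (ht : t ∈ Icc (0 : ℝ) 1) :
    UniqueDiffWithinAt ℝ (Icc (0 : ℝ) 1) t := uniqueDiffOn_Icc zero_lt_one t ht

/-- The directional derivative of a time-dependent disk map with respect to time and position. -/
def dirDeriv {G : Type} [NormedAddCommGroup G] [NormedSpace ℝ G] (f : ℝ → E2 → G) (w : ℝ × E2)
    (p : ℝ × E2) : G := fderivWithin ℝ (fun p : ℝ × E2 => f p.1 p.2) timeDisk p w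

section Slices

variable {G : Type} [NormedAddCommGroup G] [NormedSpace ℝ G] {f : ℝ → E2 → G}
  (hf : ContDiffOn ℝ ∞ (fun p : ℝ × E2 => f p.1 p.2) timeDisk)
include hf

theorem contDiffOn_dirDeriv (w : ℝ × E2) : ContDiffOn ℝ ∞ (dirDeriv f w) timeDisk :=
  contDiffOn_fderivWithin_apply uniqueDiffOn_timeDisk hf w

theorem hasDerivWithinAt_time {t : ℝ} (ht : t ∈ Icc (0 : ℝ) 1) {x : E2} (hx : x ∈ disk) :
    HasDerivWithinAt (fun s => f s x) (dirDeriv f (1, 0) (t, x)) (Icc (0 : ℝ) 1) t :=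
  hasDerivWithinAt_slice_left (f := fun p : ℝ × E2 => f p.1 p.2)
    (hf.differentiableOn (by simp) (t, x) ⟨ht, hx⟩) hx

theorem derivWithin_time {t : ℝ} (ht : t ∈ Icc (0 : ℝ) 1) {x : E2} (hx : x ∈ disk) :
    derivWithin (fun s => f s x) (Icc (0 : ℝ) 1) t = dirDeriv f (1, 0) (t, x) :=
  (hasDerivWithinAt_time hf ht hx).derivWithin (uniqueDiffWithinAt_unitInterval ht)

theorem contDiffOn_space {t : ℝ} (ht : t ∈ Icc (0 : ℝ) 1) : ContDiffOn ℝ ∞ (f t) disk :=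
  hf.comp (f := fun x => (t, x)) (by fun_prop) fun _ hx => ⟨ht, hx⟩

theorem fderivWithin_space {t : ℝ} (ht : t ∈ Icc (0 : ℝ) 1) {x : E2} (hx : x ∈ disk) (v : E2) :
    fderivWithin ℝ (f t) disk x v = dirDeriv f (0, v) (t, x) :=
  fderivWithin_slice_right (f := fun p : ℝ × E2 => f p.1 p.2)
    (hf.differentiableOn (by simp) (t, x) ⟨ht, hx⟩) ht (uniqueDiffOn_disk x hx) v

theorem dirDeriv_comm {p : ℝ × E2} (hp : p ∈ timeDisk) (u v : ℝ × E2) :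
    fderivWithin ℝ (dirDeriv f u) timeDisk p v = fderivWithin ℝ (dirDeriv f v) timeDisk p u :=
  fderivWithin_fderivWithin_comm convex_timeDisk nonempty_interior_timeDisk hf hp u v

end Slices

/-! ### Existence of the normalized Hamiltonian. -/

/-- A point of the plane in polar coordinates. -/
theorem exists_polar (x : E2) : ∃ θ : ℝ, x = ‖x‖ • (Real.cos θ • EuclideanSpace.single 0 1
    + Real.sin θ • EuclideanSpace.single 1 1 : E2) := by
  refine ⟨Complex.arg ⟨x 0, x 1⟩, ?_⟩
  have hn : ‖x‖ = ‖(⟨x 0, x 1⟩ : ℂ)‖ := by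
    rw [EuclideanSpace.norm_eq, Complex.norm_eq_sqrt_sq_add_sq]; simp
  rw [hn]
  ext i
  fin_cases i <;> simp

theorem norm_cos_sin (θ : ℝ) : ‖(Real.cos θ • EuclideanSpace.single 0 1
    + Real.sin θ • EuclideanSpace.single 1 1 : E2)‖ = 1 := by
  rw [EuclideanSpace.norm_eq]; simp

/-- A function with vanishing derivative on a collar of the circle is constant there. -/
theorem eq_of_fderiv_eq_zero_on_collar {f : E2 → ℝ} {f' : E2 → E2 →L[ℝ] ℝ} {δ : ℝ}
    (hf : ∀ x ∈ disk, HasFDerivWithinAt f (f' x) disk x)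
    (h0 : ∀ x ∈ disk, 1 - δ ≤ ‖x‖ → f' x = 0) {x : E2} (hx : x ∈ disk) (hxδ : 1 - δ ≤ ‖x‖) :
    f x = f (EuclideanSpace.single 0 1) := by
  obtain ⟨θ, hθ⟩ := exists_polar x
  have hx1 : ‖x‖ ≤ 1 := by simpa [disk] using hx
  -- The collar is not convex, so `x` is joined to `(1, 0)` by interpolating the polar coordinates;
  -- the norm only increases along this path.
  set c : ℝ → E2 := fun l => (l + (1 - l) * ‖x‖) • (Real.cos ((1 - l) * θ) •
    EuclideanSpace.single 0 1 + Real.sin ((1 - l) * θ) • EuclideanSpace.single 1 1) with hc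
  have hcd : Differentiable ℝ c := by fun_prop
  have hcn : ∀ l ∈ Icc (0 : ℝ) 1, ‖c l‖ = l + (1 - l) * ‖x‖ := by
    intro l hl
    have : 0 ≤ l + (1 - l) * ‖x‖ :=
      add_nonneg hl.1 (mul_nonneg (by linarith [hl.2]) (norm_nonneg x))
    rw [hc]; simp only [norm_smul, norm_cos_sin, mul_one, Real.norm_eq_abs, abs_of_nonneg this]
  have hcm : ∀ l ∈ Icc (0 : ℝ) 1, c l ∈ disk ∧ 1 - δ ≤ ‖c l‖ := by
    intro l hl
    have h2 := hcn l hl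
    refine ⟨by rw [disk, mem_closedBall_zero_iff, h2]; nlinarith [hl.1, hl.2], ?_⟩
    rw [h2]; nlinarith [hl.1, hl.2]
  have hder : ∀ l ∈ Icc (0 : ℝ) 1, HasDerivWithinAt (fun l => f (c l)) 0 (Icc 0 1) l := by
    intro l hl
    have h1 := hf (c l) (hcm l hl).1
    rw [h0 _ (hcm l hl).1 (hcm l hl).2] at h1
    exact h1.comp_hasDerivWithinAt l (hcd l).hasDerivAt.hasDerivWithinAt
      (fun m hm => (hcm m hm).1)
  have := constant_of_derivWithin_zero (f := fun l => f (c l)) (a := 0) (b := 1)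
    (fun l hl => (hder l hl).differentiableWithinAt)
    (fun l hl => (hder l (Ico_subset_Icc_self hl)).derivWithin
      (uniqueDiffWithinAt_unitInterval (Ico_subset_Icc_self hl))) 1 (by simp)
  have e0 : c 0 = x := by simpa [hc] using hθ.symm
  have e1 : c 1 = EuclideanSpace.single 0 1 := by simp [hc]
  rw [e0, e1] at this
  exact this.symm

/-- The Poincaré lemma on the disk, with time as a parameter: the primitive is the integral along
the segment from the origin. -/
theorem hasFDerivWithinAt_radial_of_closed {α : ℝ × E2 → E2 →L[ℝ] ℝ}
    (hα : ContDiffOn ℝ ∞ α timeDisk)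
    (hcl : ∀ p ∈ timeDisk, ∀ u v : E2,
      fderivWithin ℝ α timeDisk p (0, u) v = fderivWithin ℝ α timeDisk p (0, v) u)
    {t : ℝ} (ht : t ∈ Icc (0 : ℝ) 1) {x : E2} (hx : x ∈ disk) :
    HasFDerivWithinAt (fun x => ∫ s in (0 : ℝ)..1, α (t, s • x) x) (α (t, x)) disk x := by
  have h : HasFDerivWithinAt
      (fun z => curveIntegral (fun y => α (t, y)) (Path.segment (0 : E2) z)) (α (t, x)) disk x :=
    convex_disk.hasFDerivWithinAt_curveIntegral_segment_of_hasFDerivWithinAt_symmetric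
      (fun y hy => hasFDerivWithinAt_slice_right
        (hα.differentiableOn (by simp) (t, y) ⟨ht, hy⟩) ht)
      (fun y hy u _ v _ => hcl (t, y) ⟨ht, hy⟩ u v) (by simp [disk]) hx
  simpa [curveIntegral_segment, AffineMap.lineMap_apply] using h

theorem contDiffOn_radial_of_contDiffOn {α : ℝ × E2 → E2 →L[ℝ] ℝ}
    (hα : ContDiffOn ℝ ∞ α timeDisk) : ContDiffOn ℝ ∞
    (fun p : ℝ × E2 => ∫ s in (0 : ℝ)..1, α (p.1, s • p.2) p.2) timeDisk := by
  refine contDiffOn_intervalIntegral convex_timeDisk nonempty_interior_timeDisk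
    (g := fun q : (ℝ × E2) × ℝ => α (q.1.1, q.2 • q.1.2) q.1.2) ?_
  refine ContDiffOn.clm_apply (hα.comp
    (f := fun q : (ℝ × E2) × ℝ => (q.1.1, q.2 • q.1.2)) (by fun_prop) ?_) (by fun_prop)
  rintro ⟨⟨t, x⟩, s⟩ ⟨⟨ht, hx⟩, hs⟩
  refine ⟨ht, ?_⟩
  have hx1 : ‖x‖ ≤ 1 := by simpa [disk] using hx
  simp only [disk, mem_closedBall_zero_iff, norm_smul, Real.norm_eq_abs, abs_of_nonneg hs.1]
  nlinarith [hs.1, hs.2, norm_nonneg x]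

section Isotopy

variable {φ : ℝ → E2 → E2} (hφ : IsAreaPreservingIsotopy φ)
include hφ

namespace IsAreaPreservingIsotopy

theorem area_dirDeriv {p : ℝ × E2} (hp : p ∈ timeDisk) (u v : E2) :
    areaForm (dirDeriv φ (0, u) p) (dirDeriv φ (0, v) p) = areaForm u v := by
  obtain ⟨t, x⟩ := p
  rw [← fderivWithin_space hφ.smooth hp.1 hp.2, ← fderivWithin_space hφ.smooth hp.1 hp.2]
  exact hφ.area t hp.1 x hp.2 u v

theorem dirDeriv_injective {p : ℝ × E2} (hp : p ∈ timeDisk) {u : E2}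
    (h : dirDeriv φ (0, u) p = 0) : u = 0 :=
  eq_zero_of_areaForm fun v => by rw [← hφ.area_dirDeriv hp u v, h]; simp [areaForm]

theorem dirDeriv_surjective {p : ℝ × E2} (hp : p ∈ timeDisk) (v : E2) :
    ∃ u, dirDeriv φ (0, u) p = v := by
  let l : E2 →ₗ[ℝ] E2 := ((fderivWithin ℝ (fun p : ℝ × E2 => φ p.1 p.2) timeDisk p).comp
    (ContinuousLinearMap.inr ℝ ℝ E2)).toLinearMap
  have hl : Function.Injective l := by
    rw [injective_iff_map_eq_zero]
    intro u hu
    exact hφ.dirDeriv_injective hp (by simpa [l, dirDeriv] using hu)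
  obtain ⟨u, hu⟩ := (LinearMap.injective_iff_surjective.1 hl) v
  exact ⟨u, by simpa [l, dirDeriv] using hu⟩

theorem mapsTo {p : ℝ × E2} (hp : p ∈ timeDisk) : φ p.1 p.2 ∈ disk := (hφ.bijOn _ hp.1).mapsTo hp.2

theorem velocity_eq_zero : ∃ δ : ℝ, 0 < δ ∧ ∀ p ∈ timeDisk, 1 - δ ≤ ‖p.2‖ →
    φ p.1 p.2 = p.2 ∧ dirDeriv φ (1, 0) p = 0 := by
  obtain ⟨δ, hδ, h⟩ := hφ.near_boundary
  refine ⟨δ, hδ, fun p hp hn => ⟨h p.1 hp.1 p.2 hp.2 hn, ?_⟩⟩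
  obtain ⟨t, x⟩ := p
  rw [← derivWithin_time hφ.smooth hp.1 hp.2]
  have : EqOn (fun s => φ s x) (fun _ => x) (Icc 0 1) := fun s hs => h s hs x hp.2 hn
  rw [derivWithin_congr this (this hp.1)]
  simp

/-- The derivative of `areaForm (φ̇) (D_v φ)` in the direction `u` is symmetric in `u` and `v`. -/
theorem velocity_form_closed {p : ℝ × E2} (hp : p ∈ timeDisk) (u v : E2) :
    fderivWithin ℝ (fun q => areaForm (dirDeriv φ (1, 0) q) (dirDeriv φ (0, v) q)) timeDisk p (0, u)
      = fderivWithin ℝ (fun q => areaForm (dirDeriv φ (1, 0) q) (dirDeriv φ (0, u) q)) timeDisk p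
        (0, v) := by
  have hud := uniqueDiffOn_timeDisk p hp
  have hd : ∀ w, DifferentiableWithinAt ℝ (dirDeriv φ w) timeDisk p := fun w =>
    (contDiffOn_dirDeriv hφ.smooth w).differentiableOn (by simp) p hp
  -- This is where area preservation enters: `φ_t^* ω` does not change with time. Once mixed
  -- derivatives are exchanged, its vanishing time derivative is the asserted symmetry.
  have hconst : fderivWithin ℝ (fun q => areaForm (dirDeriv φ (0, u) q) (dirDeriv φ (0, v) q))
      timeDisk p (1, 0) = 0 := by
    have : EqOn (fun q => areaForm (dirDeriv φ (0, u) q) (dirDeriv φ (0, v) q))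
        (fun _ => areaForm u v) timeDisk := fun q hq => hφ.area_dirDeriv hq u v
    rw [fderivWithin_congr this (this hp)]; simp
  rw [fderivWithin_areaForm (hd _) (hd _) hud] at hconst ⊢
  rw [fderivWithin_areaForm (hd _) (hd _) hud]
  rw [dirDeriv_comm hφ.smooth hp (0, u) (1, 0), dirDeriv_comm hφ.smooth hp (0, v) (1, 0)] at hconst
  rw [dirDeriv_comm hφ.smooth hp (0, v) (0, u)]
  have := areaForm_swap (dirDeriv φ (0, u) p) (fderivWithin ℝ (dirDeriv φ (1, 0)) timeDisk p (0, v))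
  linarith

end IsAreaPreservingIsotopy

/-- The pull-back `φ_t^* (ι_{X_t} ω)`. -/
def velocityForm (φ : ℝ → E2 → E2) (p : ℝ × E2) : E2 →L[ℝ] ℝ :=
  (areaFormL (dirDeriv φ (1, 0) p)).comp
    ((fderivWithin ℝ (fun p : ℝ × E2 => φ p.1 p.2) timeDisk p).comp
      (ContinuousLinearMap.inr ℝ ℝ E2))

omit hφ in
theorem velocityForm_apply (p : ℝ × E2) (v : E2) :
    velocityForm φ p v = areaForm (dirDeriv φ (1, 0) p) (dirDeriv φ (0, v) p) := by
  simp [velocityForm, dirDeriv]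

namespace IsAreaPreservingIsotopy

theorem contDiffOn_velocityForm : ContDiffOn ℝ ∞ (velocityForm φ) timeDisk := by
  refine ContDiffOn.clm_comp ?_ (ContDiffOn.clm_comp ?_ contDiffOn_const)
  · exact areaFormL.contDiff.comp_contDiffOn (contDiffOn_dirDeriv hφ.smooth _)
  · exact hφ.smooth.fderivWithin uniqueDiffOn_timeDisk (by simp)

theorem fderivWithin_velocityForm {p : ℝ × E2} (hp : p ∈ timeDisk) (w : ℝ × E2) (v : E2) :
    fderivWithin ℝ (velocityForm φ) timeDisk p w v
      = fderivWithin ℝ (fun q => areaForm (dirDeriv φ (1, 0) q) (dirDeriv φ (0, v) q))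
        timeDisk p w := by
  have h := (hφ.contDiffOn_velocityForm.differentiableOn (by simp) p hp).hasFDerivWithinAt.clm_apply
    (hasFDerivWithinAt_const v _ _)
  simp only [velocityForm_apply] at h
  rw [h.fderivWithin (uniqueDiffOn_timeDisk _ hp)]
  simp

theorem hasFDerivWithinAt_radial {t : ℝ} (ht : t ∈ Icc (0 : ℝ) 1) {x : E2} (hx : x ∈ disk) :
    HasFDerivWithinAt (fun x => ∫ s in (0 : ℝ)..1, velocityForm φ (t, s • x) x)
      (velocityForm φ (t, x)) disk x := by
  refine hasFDerivWithinAt_radial_of_closed hφ.contDiffOn_velocityForm (fun p hp u v => ?_) ht hx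
  rw [hφ.fderivWithin_velocityForm hp, hφ.fderivWithin_velocityForm hp]
  exact hφ.velocity_form_closed hp u v

/-- The map `(t, x) ↦ (t, φ_t x)` has a smooth inverse. -/
theorem exists_smooth_inverse : ∃ ψ : ℝ → E2 → E2,
    ContDiffOn ℝ ∞ (fun p : ℝ × E2 => ψ p.1 p.2) timeDisk ∧
    (∀ t ∈ Icc (0 : ℝ) 1, ∀ x ∈ disk, ψ t x ∈ disk ∧ φ t (ψ t x) = x ∧ ψ t (φ t x) = x) := by
  -- Keeping time as a coordinate gives smoothness of the inverse jointly in time and position.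
  set f : ℝ × E2 → ℝ × E2 := fun p => (p.1, φ p.1 p.2) with hf
  have hfs : ContDiffOn ℝ ∞ f timeDisk := contDiff_fst.contDiffOn.prodMk hφ.smooth
  have hb : BijOn f timeDisk timeDisk := by
    refine ⟨fun p hp => ⟨hp.1, hφ.mapsTo hp⟩, ?_, ?_⟩
    · rintro ⟨t, x⟩ ⟨ht, hx⟩ ⟨s, y⟩ ⟨hs, hy⟩ h
      simp only [hf, Prod.mk.injEq] at h
      obtain ⟨rfl, h⟩ := h
      exact congrArg (Prod.mk t) ((hφ.bijOn t ht).injOn hx hy h)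
    · rintro ⟨t, y⟩ ⟨ht, hy⟩
      obtain ⟨x, hx, rfl⟩ := (hφ.bijOn t ht).surjOn hy
      exact ⟨(t, x), ⟨ht, hx⟩, rfl⟩
  have hder : ∀ p ∈ timeDisk, ∀ w, fderivWithin ℝ f timeDisk p w = (w.1, dirDeriv φ w p) := by
    intro p hp w
    have h := (hasFDerivWithinAt_fst (𝕜 := ℝ) (s := timeDisk) (p := p)).prodMk
      (hφ.smooth.differentiableOn (by simp) p hp).hasFDerivWithinAt
    rw [h.fderivWithin (uniqueDiffOn_timeDisk p hp)]
    simp [dirDeriv]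
  have hinv : ∀ p ∈ timeDisk, ∃ e : (ℝ × E2) ≃L[ℝ] (ℝ × E2),
      (e : (ℝ × E2) →L[ℝ] (ℝ × E2)) = fderivWithin ℝ f timeDisk p := by
    intro p hp
    have hinj : Function.Injective (fderivWithin ℝ f timeDisk p).toLinearMap := by
      rw [injective_iff_map_eq_zero]
      rintro ⟨s, v⟩ h
      rw [ContinuousLinearMap.coe_coe, hder p hp] at h
      simp only [Prod.mk_eq_zero] at h
      obtain ⟨rfl, h⟩ := h
      rw [hφ.dirDeriv_injective hp h]; rfl
    exact ⟨(LinearEquiv.ofInjectiveEndo _ hinj).toContinuousLinearEquiv, by ext <;> simp⟩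
  set g := Function.invFunOn f timeDisk with hg
  have hgm : ∀ p ∈ timeDisk, g p ∈ timeDisk := fun p hp =>
    Function.invFunOn_mem (hb.surjOn hp)
  have hfg : ∀ p ∈ timeDisk, f (g p) = p := fun p hp => Function.invFunOn_eq (hb.surjOn hp)
  have hgf : ∀ p ∈ timeDisk, g (f p) = p := fun p hp => hb.injOn.leftInvOn_invFunOn hp
  have hgs : ContDiffOn ℝ ∞ g timeDisk :=
    contDiffOn_of_right_inverse hfs uniqueDiffOn_timeDisk uniqueDiffOn_timeDisk hinv
      (continuousOn_invFunOn_of_isCompact isCompact_timeDisk hfs.continuousOn hb) hgm hfg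
  refine ⟨fun t x => (g (t, x)).2, contDiff_snd.comp_contDiffOn hgs, fun t ht x hx => ?_⟩
  have h1 := hfg (t, x) ⟨ht, hx⟩
  have h2 : (g (t, x)).1 = t := congrArg Prod.fst h1
  refine ⟨(hgm (t, x) ⟨ht, hx⟩).2, ?_, congrArg Prod.snd (hgf (t, x) ⟨ht, hx⟩)⟩
  have h3 := congrArg Prod.snd h1
  simp only [hf] at h3
  rwa [h2] at h3

/-- The potential is first built in the pulled-back picture, where the form is expressed by
derivatives of `φ` alone and no inverse occurs. On the collar the velocity vanishes, so the radial
primitive is constant there, and its value at `(1, 0)` is subtracted. -/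
theorem exists_pullback_hamiltonian : ∃ G : ℝ → E2 → ℝ,
    ContDiffOn ℝ ∞ (fun p : ℝ × E2 => G p.1 p.2) timeDisk ∧
    (∀ t ∈ Icc (0 : ℝ) 1, ∀ x ∈ disk,
      HasFDerivWithinAt (G t) (velocityForm φ (t, x)) disk x) ∧
    ∃ δ : ℝ, 0 < δ ∧ ∀ t ∈ Icc (0 : ℝ) 1, ∀ x ∈ disk, 1 - δ ≤ ‖x‖ → φ t x = x ∧ G t x = 0 := by
  obtain ⟨δ, hδ, hcollar⟩ := hφ.velocity_eq_zero
  have hbd : (EuclideanSpace.single 0 1 : E2) ∈ disk := by simp [disk]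
  obtain ⟨H, hH⟩ : ∃ H : ℝ × E2 → ℝ,
    H = fun p => ∫ s in (0 : ℝ)..1, velocityForm φ (p.1, s • p.2) p.2 := ⟨_, rfl⟩
  have hHs : ContDiffOn ℝ ∞ H timeDisk := hH ▸ contDiffOn_radial_of_contDiffOn hφ.contDiffOn_velocityForm
  have hHd : ∀ t ∈ Icc (0 : ℝ) 1, ∀ x ∈ disk,
      HasFDerivWithinAt (fun x => H (t, x)) (velocityForm φ (t, x)) disk x := fun t ht x hx =>
    hH ▸ hφ.hasFDerivWithinAt_radial ht hx
  refine ⟨fun t x => H (t, x) - H (t, EuclideanSpace.single 0 1), ?_, ?_, δ, hδ, ?_⟩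
  · exact hHs.sub (hHs.comp (f := fun p : ℝ × E2 => (p.1, (EuclideanSpace.single 0 1 : E2)))
      (by fun_prop) fun p hp => ⟨hp.1, hbd⟩)
  · exact fun t ht x hx => (hHd t ht x hx).sub_const _
  · intro t ht x hx hn
    refine ⟨(hcollar (t, x) ⟨ht, hx⟩ hn).1, sub_eq_zero.2 ?_⟩
    refine eq_of_fderiv_eq_zero_on_collar (hHd t ht) (fun y hy hyn => ?_) hx hn
    ext v
    rw [velocityForm_apply, (hcollar (t, y) ⟨ht, hy⟩ hyn).2]
    simp [areaForm]

theorem exists_hamiltonian : ∃ F, IsNormalizedHamiltonian F φ := by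
  obtain ⟨ψ, hψ, hψ'⟩ := hφ.exists_smooth_inverse
  obtain ⟨G, hGs, hGd, δ, hδ, hG0⟩ := hφ.exists_pullback_hamiltonian
  obtain ⟨F, hF⟩ : ∃ F : ℝ → E2 → ℝ, F = fun t x => G t (ψ t x) := ⟨_, rfl⟩
  have hFs : ContDiffOn ℝ ∞ (fun p : ℝ × E2 => F p.1 p.2) timeDisk := by
    rw [hF]
    exact hGs.comp (contDiff_fst.contDiffOn.prodMk hψ)
      fun p hp => ⟨hp.1, (hψ' p.1 hp.1 p.2 hp.2).1⟩
  refine ⟨F, hFs, ⟨δ, hδ, fun t ht x hx hn => ?_⟩, fun t ht x hx v => ?_⟩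
  · have h1 : ψ t x = x := by
      conv_lhs => rw [← (hG0 t ht x hx hn).1]
      exact (hψ' t ht x hx).2.2
    rw [hF]
    simp only [h1]
    exact (hG0 t ht x hx hn).2
  · obtain ⟨u, rfl⟩ := hφ.dirDeriv_surjective (p := (t, x)) ⟨ht, hx⟩ v
    rw [derivWithin_time hφ.smooth ht hx, ← velocityForm_apply]
    have hm := (hφ.bijOn t ht).mapsTo
    have h1 : HasFDerivWithinAt (F t ∘ φ t)
        ((fderivWithin ℝ (F t) disk (φ t x)).comp (fderivWithin ℝ (φ t) disk x)) disk x :=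
      HasFDerivWithinAt.comp x
        ((contDiffOn_space hFs ht).differentiableOn (by simp) _ (hm hx)).hasFDerivWithinAt
        ((contDiffOn_space hφ.smooth ht).differentiableOn (by simp) x hx).hasFDerivWithinAt hm
    have h2 : EqOn (G t) (F t ∘ φ t) disk := fun y hy => by
      simp [hF, (hψ' t ht y hy).2.2]
    -- Both `velocityForm φ (t, x)` and `dF_t ∘ Dφ_t` are derivatives of `G t = F t ∘ φ t` within
    -- the disk, hence they are equal; every tangent vector at `φ t x` is in the image of `Dφ_t`.
    rw [(uniqueDiffOn_disk x hx).eq (hGd t ht x hx) (h1.congr h2 (h2 hx))]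
    simp [fderivWithin_space hφ.smooth ht hx]

end IsAreaPreservingIsotopy

end Isotopy

/-! ### Integration over the disk. -/

theorem integral_unitInterval_eq_sub {f f' : ℝ → ℝ}
    (h : ∀ t ∈ Icc (0 : ℝ) 1, HasDerivWithinAt f (f' t) (Icc 0 1) t)
    (hc : ContinuousOn f' (Icc 0 1)) : ∫ t in (0 : ℝ)..1, f' t = f 1 - f 0 := by
  refine intervalIntegral.integral_eq_sub_of_hasDerivAt_of_le zero_le_one
    (fun t ht => (h t ht).continuousWithinAt) (fun t ht => ?_) ?_
  · exact (h t (Ioo_subset_Icc_self ht)).hasDerivAt (Icc_mem_nhds ht.1 ht.2)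
  · exact ContinuousOn.intervalIntegrable (by rwa [uIcc_of_le zero_le_one])

theorem measurableSet_disk : MeasurableSet disk := isCompact_disk.measurableSet

/-- The integral over the disk of a directional derivative of a function that vanishes near the
boundary circle is zero. -/
theorem setIntegral_disk_fderivWithin_eq_zero {f : E2 → ℝ} (hf : ContDiffOn ℝ ∞ f disk) {δ : ℝ}
    (hδ : 0 < δ) (h0 : ∀ x ∈ disk, 1 - δ ≤ ‖x‖ → f x = 0) (v : E2) :
    ∫ x in disk, fderivWithin ℝ f disk x v = 0 := by
  have hout : ∀ x : E2, 1 - δ < ‖x‖ → disk.indicator f =ᶠ[𝓝 x] fun _ => 0 := by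
    intro x hx
    filter_upwards [continuous_norm.continuousAt.eventually_const_lt hx] with y hy
    by_cases hyd : y ∈ disk
    · rw [indicator_of_mem hyd, h0 y hyd hy.le]
    · rw [indicator_of_notMem hyd]
  -- The extension by zero is differentiable on the whole plane: near a point with `‖x‖ ≥ 1` it
  -- vanishes identically.
  have hder : ∀ x, HasFDerivAt (disk.indicator f)
      (disk.indicator (fderivWithin ℝ f disk) x) x := by
    intro x
    rcases lt_or_ge ‖x‖ 1 with hx | hx
    · have hn : disk ∈ 𝓝 x := by
        filter_upwards [continuous_norm.continuousAt.eventually_lt_const hx] with y hy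
        simpa [disk] using hy.le
      have hxd : x ∈ disk := mem_of_mem_nhds hn
      rw [indicator_of_mem hxd]
      refine (((hf.differentiableOn (by simp) x hxd).hasFDerivWithinAt).hasFDerivAt
        hn).congr_of_eventuallyEq ?_
      filter_upwards [hn] with y hy using indicator_of_mem hy f
    · have hx' : 1 - δ < ‖x‖ := by linarith
      have h1 : HasFDerivAt (disk.indicator f) (0 : E2 →L[ℝ] ℝ) x :=
        (hasFDerivAt_const (0 : ℝ) x).congr_of_eventuallyEq (hout x hx')
      convert h1 using 1
      by_cases hxd : x ∈ disk
      · rw [indicator_of_mem hxd]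
        refine (uniqueDiffOn_disk x hxd).eq
          (hf.differentiableOn (by simp) x hxd).hasFDerivWithinAt ?_
        exact h1.hasFDerivWithinAt.congr (fun y hy => (indicator_of_mem hy f).symm)
          (indicator_of_mem hxd f).symm
      · rw [indicator_of_notMem hxd]
  have hfd : ∀ x, fderiv ℝ (disk.indicator f) x v
      = disk.indicator (fun x => fderivWithin ℝ f disk x v) x := fun x => by
    rw [(hder x).fderiv]; by_cases hx : x ∈ disk <;> simp [hx]
  have hi1 : Integrable (disk.indicator fun x => fderivWithin ℝ f disk x v) := by
    rw [integrable_indicator_iff measurableSet_disk]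
    exact (contDiffOn_fderivWithin_apply uniqueDiffOn_disk hf v).continuousOn.integrableOn_compact
      isCompact_disk
  have hi2 : Integrable (disk.indicator f) := by
    rw [integrable_indicator_iff measurableSet_disk]
    exact hf.continuousOn.integrableOn_compact isCompact_disk
  -- Integration by parts against the constant function `1`.
  have := integral_mul_fderiv_eq_neg_fderiv_mul_of_integrable (μ := (volume : Measure E2))
    (f := fun _ => (1 : ℝ)) (g := disk.indicator f) (v := v) (by simp)
    (by simpa [hfd] using hi1) (by simpa using hi2) (fun _ _ => by fun_prop)
    (fun x _ => (hder x).differentiableAt)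
  simp only [hfd, one_mul, fderiv_fun_const, Pi.zero_apply, zero_mul, integral_zero, neg_zero,
    zero_apply] at this
  rwa [integral_indicator measurableSet_disk] at this

theorem det_eq_areaForm (A : E2 →L[ℝ] E2) :
    A.det = areaForm (A (EuclideanSpace.single 0 1)) (A (EuclideanSpace.single 1 1)) := by
  rw [ContinuousLinearMap.det, ← LinearMap.det_toMatrix (EuclideanSpace.basisFun (Fin 2) ℝ).toBasis,
    Matrix.det_fin_two]
  simp [LinearMap.toMatrix_apply, areaForm]
  ring

namespace IsAreaPreservingIsotopy

variable {φ : ℝ → E2 → E2} (hφ : IsAreaPreservingIsotopy φ)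
include hφ

/-- Change of variables with Jacobian determinant `ω(Dφ_t e₀, Dφ_t e₁) = ω(e₀, e₁) = 1`. -/
theorem setIntegral_comp {t : ℝ} (ht : t ∈ Icc (0 : ℝ) 1) (h : E2 → ℝ) :
    ∫ x in disk, h (φ t x) = ∫ x in disk, h x := by
  have hd := (contDiffOn_space hφ.smooth ht).differentiableOn (by simp)
  conv_rhs => rw [← (hφ.bijOn t ht).image_eq]
  rw [integral_image_eq_integral_abs_det_fderiv_smul volume measurableSet_disk
    (fun x hx => (hd x hx).hasFDerivWithinAt) (hφ.bijOn t ht).injOn]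
  refine setIntegral_congr_fun measurableSet_disk fun x hx => ?_
  simp only [det_eq_areaForm, hφ.area t ht x hx]
  simp [areaForm]

end IsAreaPreservingIsotopy

theorem fderivWithin_apply_eq_sum (A : E2 →L[ℝ] ℝ) (y : E2) :
    A y = y 0 * A (EuclideanSpace.single 0 1) + y 1 * A (EuclideanSpace.single 1 1) := by
  have : y = y 0 • EuclideanSpace.single 0 1 + y 1 • EuclideanSpace.single 1 1 := by
    ext i; fin_cases i <;> simp
  conv_lhs => rw [this]
  simp

/-- Euler's formula: integrating by parts, `∫ (f - ½ y · ∇f) = 2 ∫ f` over the disk. -/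
theorem setIntegral_euler {f : E2 → ℝ} (hf : ContDiffOn ℝ ∞ f disk) {δ : ℝ}
    (hδ : 0 < δ) (h0 : ∀ x ∈ disk, 1 - δ ≤ ‖x‖ → f x = 0) :
    ∫ y in disk, (f y - (1 / 2) * fderivWithin ℝ f disk y y) = 2 * ∫ y in disk, f y := by
  -- The integrand is `∂_i (y_i f)`. Summing over both coordinates gives `∫ y · ∇f = -2 ∫ f`.
  have hpart : ∀ i : Fin 2,
      ∫ y in disk, (f y + y i * fderivWithin ℝ f disk y (EuclideanSpace.single i 1)) = 0 := by
    intro i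
    have hs : ContDiffOn ℝ ∞ (fun y : E2 => y i * f y) disk :=
      (contDiff_piLp_apply (p := 2) (i := i)).contDiffOn.mul hf
    rw [← setIntegral_disk_fderivWithin_eq_zero hs hδ (fun x hx hn => by simp [h0 x hx hn])
      (EuclideanSpace.single i 1)]
    refine setIntegral_congr_fun measurableSet_disk fun y hy => ?_
    have h1 : HasFDerivWithinAt (fun y : E2 => y i) (EuclideanSpace.proj i : E2 →L[ℝ] ℝ) disk y :=
      (EuclideanSpace.proj i : E2 →L[ℝ] ℝ).hasFDerivWithinAt
    have h2 := h1.fun_mul (hf.differentiableOn (by simp) y hy).hasFDerivWithinAt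
    simp only
    rw [h2.fderivWithin (uniqueDiffOn_disk y hy)]
    simp [add_comm]
  have hi : ∀ i : Fin 2, IntegrableOn
      (fun y => f y + y i * fderivWithin ℝ f disk y (EuclideanSpace.single i 1)) disk := by
    intro i
    refine ContinuousOn.integrableOn_compact isCompact_disk (hf.continuousOn.add ?_)
    exact (contDiff_piLp_apply (p := 2) (i := i) (𝕜 := ℝ) (n := 0)).continuous.continuousOn.mul
      (contDiffOn_fderivWithin_apply uniqueDiffOn_disk hf _).continuousOn
  have hif : IntegrableOn f disk := hf.continuousOn.integrableOn_compact isCompact_disk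
  have e : ∀ y, f y - (1 / 2) * fderivWithin ℝ f disk y y = 2 * f y
      - (1 / 2) * (f y + y 0 * fderivWithin ℝ f disk y (EuclideanSpace.single 0 1))
      - (1 / 2) * (f y + y 1 * fderivWithin ℝ f disk y (EuclideanSpace.single 1 1)) := by
    intro y
    rw [fderivWithin_apply_eq_sum (fderivWithin ℝ f disk y) y]; ring
  simp_rw [e]
  have i0 : IntegrableOn (fun y => 2 * f y
      - (1 / 2) * (f y + y 0 * fderivWithin ℝ f disk y (EuclideanSpace.single 0 1))) disk :=
    (hif.const_mul 2).sub ((hi 0).const_mul _)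
  rw [integral_sub i0 ((hi 1).const_mul _),
    integral_sub (hif.const_mul 2) ((hi 0).const_mul _), integral_const_mul, integral_const_mul,
    integral_const_mul, hpart, hpart]
  ring

theorem hasFDerivWithinAt_timeIntegral {g : ℝ → E2 → ℝ}
    (hs : ContDiffOn ℝ ∞ (fun p : ℝ × E2 => g p.1 p.2) timeDisk) {x : E2} (hx : x ∈ disk) :
    ∃ L : E2 →L[ℝ] ℝ, HasFDerivWithinAt (fun x => ∫ t in (0 : ℝ)..1, g t x) L disk x
      ∧ ∀ v, L v = ∫ t in (0 : ℝ)..1, dirDeriv g (0, v) (t, x) := by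
  obtain ⟨f, hf⟩ : ∃ f : E2 × ℝ → ℝ, f = fun q => g q.2 q.1 := ⟨_, rfl⟩
  have hg : ContDiffOn ℝ ∞ f (disk ×ˢ Icc (0 : ℝ) 1) := hf ▸
    hs.comp (f := fun q : E2 × ℝ => (q.2, q.1)) (by fun_prop) fun q hq => ⟨hq.2, hq.1⟩
  have hder := hasFDerivWithinAt_intervalIntegral convex_disk nonempty_interior_disk hg hx
  refine ⟨_, by simpa only [hf] using hder, fun v => ?_⟩
  have hcont : ContinuousOn (fun u => (fderivWithin ℝ f (disk ×ˢ Icc (0 : ℝ) 1) (x, u)).comp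
      (ContinuousLinearMap.inl ℝ E2 ℝ)) (Icc (0 : ℝ) 1) :=
    (((hg.fderivWithin (uniqueDiffOn_disk.prod (uniqueDiffOn_Icc zero_lt_one)) (m := 0)
      (by simp)).continuousOn).comp (f := fun u => (x, u)) (by fun_prop)
        fun u hu => ⟨hx, hu⟩).clm_comp continuousOn_const
  have hint : IntervalIntegrable (fun u => (fderivWithin ℝ f (disk ×ˢ Icc (0 : ℝ) 1) (x, u)).comp
      (ContinuousLinearMap.inl ℝ E2 ℝ)) volume 0 1 :=
    ContinuousOn.intervalIntegrable (by rwa [uIcc_of_le zero_le_one])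
  rw [← hf, ContinuousLinearMap.intervalIntegral_apply hint]
  refine intervalIntegral.integral_congr fun u hu => ?_
  rw [uIcc_of_le zero_le_one] at hu
  rw [← fderivWithin_space hs hu hx,
    ← (hasFDerivWithinAt_slice_left (hg.differentiableOn (by simp) (x, u) ⟨hx, hu⟩)
      hu).fderivWithin (uniqueDiffOn_disk x hx), hf]

/-! ### The Calabi integral depends only on the time-one map. -/

section Calabi

variable {φ : ℝ → E2 → E2} (hφ : IsAreaPreservingIsotopy φ)
  {F : ℝ → E2 → ℝ} (hF : IsNormalizedHamiltonian F φ)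

/-- The function `F_t + ½ λ(X_t)`, pulled back by `φ_t`, where `λ` is the radial primitive of the
area form. -/
def actionDensity (φ : ℝ → E2 → E2) (F : ℝ → E2 → ℝ) (t : ℝ) (x : E2) : ℝ :=
  F t (φ t x) - (1 / 2) * areaForm (dirDeriv φ (1, 0) (t, x)) (φ t x)

include hφ hF

theorem contDiffOn_hamiltonian_comp :
    ContDiffOn ℝ ∞ (fun p : ℝ × E2 => F p.1 (φ p.1 p.2)) timeDisk :=
  hF.smooth.comp (contDiff_fst.contDiffOn.prodMk hφ.smooth) fun _ hp => ⟨hp.1, hφ.mapsTo hp⟩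

theorem contDiffOn_actionDensity :
    ContDiffOn ℝ ∞ (fun p : ℝ × E2 => actionDensity φ F p.1 p.2) timeDisk := by
  refine (contDiffOn_hamiltonian_comp hφ hF).sub (contDiffOn_const.mul ?_)
  have h1 : ContDiffOn ℝ ∞ (fun p => areaFormL (dirDeriv φ (1, 0) p)) timeDisk :=
    areaFormL.contDiff.comp_contDiffOn (contDiffOn_dirDeriv hφ.smooth (1, 0))
  simpa using h1.clm_apply hφ.smooth

theorem dirDeriv_hamiltonian_comp {p : ℝ × E2} (hp : p ∈ timeDisk) (v : E2) :
    dirDeriv (fun t x => F t (φ t x)) (0, v) p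
      = areaForm (dirDeriv φ (1, 0) p) (dirDeriv φ (0, v) p) := by
  obtain ⟨t, x⟩ := p
  have hm := (hφ.bijOn t hp.1).mapsTo
  rw [← fderivWithin_space (contDiffOn_hamiltonian_comp hφ hF) hp.1 hp.2,
    ← derivWithin_time hφ.smooth hp.1 hp.2, hF.generates t hp.1 x hp.2,
    ← fderivWithin_space hφ.smooth hp.1 hp.2]
  have h1 := HasFDerivWithinAt.comp x
        ((contDiffOn_space hF.smooth hp.1).differentiableOn (by simp) _ (hm hp.2)).hasFDerivWithinAt
        ((contDiffOn_space hφ.smooth hp.1).differentiableOn (by simp) x hp.2).hasFDerivWithinAt hm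
  change fderivWithin ℝ (F t ∘ φ t) disk x v = _
  rw [h1.fderivWithin (uniqueDiffOn_disk x hp.2)]
  rfl

/-- The spatial derivative of the action density is a time derivative. -/
theorem dirDeriv_actionDensity {p : ℝ × E2} (hp : p ∈ timeDisk) (v : E2) :
    dirDeriv (actionDensity φ F) (0, v) p = (1 / 2) *
      fderivWithin ℝ (fun q => areaForm (φ q.1 q.2) (dirDeriv φ (0, v) q)) timeDisk p (1, 0) := by
  have hud := uniqueDiffOn_timeDisk p hp
  have hd : ∀ w, DifferentiableWithinAt ℝ (dirDeriv φ w) timeDisk p := fun w =>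
    (contDiffOn_dirDeriv hφ.smooth w).differentiableOn (by simp) p hp
  have hd0 : DifferentiableWithinAt ℝ (fun p : ℝ × E2 => φ p.1 p.2) timeDisk p :=
    hφ.smooth.differentiableOn (by simp) p hp
  have hdA : DifferentiableWithinAt ℝ
      (fun q : ℝ × E2 => areaForm (dirDeriv φ (1, 0) q) (φ q.1 q.2)) timeDisk p := by
    simpa using (areaFormL.hasFDerivWithinAt_of_bilinear (hd (1, 0)).hasFDerivWithinAt
      hd0.hasFDerivWithinAt).differentiableWithinAt
  have h1 : dirDeriv (actionDensity φ F) (0, v) p = dirDeriv (fun t x => F t (φ t x)) (0, v) p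
      - (1 / 2) * fderivWithin ℝ (fun q : ℝ × E2 => areaForm (dirDeriv φ (1, 0) q) (φ q.1 q.2))
        timeDisk p (0, v) := by
    have := ((contDiffOn_hamiltonian_comp hφ hF).differentiableOn (by simp) p
      hp).hasFDerivWithinAt.fun_sub (hdA.hasFDerivWithinAt.const_mul (1 / 2))
    rw [dirDeriv]
    simp only [actionDensity]
    rw [HasFDerivWithinAt.fderivWithin this hud]
    simp [dirDeriv]
  -- Cartan's formula written out, for `λ_x(v) = ω(x, v)/2`: `d/dt φ_t^* λ = φ_t^* d(λ(X_t) + F_t)`.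
  -- The Hamiltonian contributes `ω(φ̇, D_v φ)`, half of which is cancelled by the derivative of the
  -- quadratic term.
  rw [h1, dirDeriv_hamiltonian_comp hφ hF hp, fderivWithin_areaForm (hd _) hd0 hud,
    fderivWithin_areaForm hd0 (hd _) hud, dirDeriv_comm hφ.smooth hp (0, v) (1, 0),
    areaForm_swap (φ p.1 p.2), show fderivWithin ℝ (fun p : ℝ × E2 => φ p.1 p.2) timeDisk p (0, v)
      = dirDeriv φ (0, v) p from rfl, show fderivWithin ℝ (fun p : ℝ × E2 => φ p.1 p.2) timeDisk p
      (1, 0) = dirDeriv φ (1, 0) p from rfl]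
  ring

theorem integral_dirDeriv_actionDensity {x : E2} (hx : x ∈ disk) (v : E2) :
    ∫ t in (0 : ℝ)..1, dirDeriv (actionDensity φ F) (0, v) (t, x)
      = (1 / 2) * areaForm (φ 1 x) (dirDeriv φ (0, v) (1, x))
        - (1 / 2) * areaForm (φ 0 x) (dirDeriv φ (0, v) (0, x)) := by
  have hk : ContDiffOn ℝ ∞ (fun q : ℝ × E2 => areaForm (φ q.1 q.2) (dirDeriv φ (0, v) q))
      timeDisk := by
    have h1 : ContDiffOn ℝ ∞ (fun p : ℝ × E2 => areaFormL (φ p.1 p.2)) timeDisk :=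
      areaFormL.contDiff.comp_contDiffOn hφ.smooth
    simpa using h1.clm_apply (contDiffOn_dirDeriv hφ.smooth (0, v))
  obtain ⟨k, hk'⟩ : ∃ k : ℝ × E2 → ℝ,
    k = fun q : ℝ × E2 => areaForm (φ q.1 q.2) (dirDeriv φ (0, v) q) := ⟨_, rfl⟩
  have e1 : ∀ p ∈ timeDisk, dirDeriv (actionDensity φ F) (0, v) p
      = (1 / 2) * fderivWithin ℝ k timeDisk p (1, 0) := fun p hp => by
    rw [dirDeriv_actionDensity hφ hF hp, hk']
  have e2 : ∫ t in (0 : ℝ)..1, fderivWithin ℝ k timeDisk (t, x) (1, 0) = k (1, x) - k (0, x) := by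
    rw [← hk'] at hk
    refine integral_unitInterval_eq_sub (f := fun t => k (t, x)) (fun t ht => ?_) ?_
    · exact hasDerivWithinAt_slice_left (hk.differentiableOn (by simp) (t, x) ⟨ht, hx⟩) hx
    · exact (contDiffOn_fderivWithin_apply uniqueDiffOn_timeDisk hk _).continuousOn.comp
        (f := fun u => (u, x)) (by fun_prop) fun u hu => ⟨hu, hx⟩
  have e3 : ∫ t in (0 : ℝ)..1, dirDeriv (actionDensity φ F) (0, v) (t, x)
      = ∫ t in (0 : ℝ)..1, (1 / 2) * fderivWithin ℝ k timeDisk (t, x) (1, 0) := by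
    refine intervalIntegral.integral_congr fun t ht => e1 (t, x) ⟨?_, hx⟩
    rwa [uIcc_of_le zero_le_one] at ht
  rw [e3, intervalIntegral.integral_const_mul, e2, hk', mul_sub]

/-- Integrating Cartan's formula over time leaves `φ_1^* λ - λ`, in which the isotopy occurs only
through its endpoint. -/
theorem hasFDerivWithinAt_action {x : E2} (hx : x ∈ disk) :
    ∃ L : E2 →L[ℝ] ℝ, HasFDerivWithinAt (fun x => ∫ t in (0 : ℝ)..1, actionDensity φ F t x) L disk x
      ∧ ∀ v, L v = (1 / 2) * areaForm (φ 1 x) (fderivWithin ℝ (φ 1) disk x v)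
        - (1 / 2) * areaForm x v := by
  obtain ⟨L, hL, hLv⟩ := hasFDerivWithinAt_timeIntegral (contDiffOn_actionDensity hφ hF) hx
  refine ⟨L, hL, fun v => ?_⟩
  have h1 : (1 : ℝ) ∈ Icc (0 : ℝ) 1 := by simp
  have h0 : (0 : ℝ) ∈ Icc (0 : ℝ) 1 := by simp
  have h2 : dirDeriv φ (0, v) (0, x) = v := by
    rw [← fderivWithin_space hφ.smooth h0 hx,
      fderivWithin_congr (fun y hy => hφ.start y hy) (hφ.start x hx),
      fderivWithin_fun_id (uniqueDiffOn_disk x hx), ContinuousLinearMap.id_apply]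
  rw [hLv, integral_dirDeriv_actionDensity hφ hF hx, fderivWithin_space hφ.smooth h1 hx, h2,
    hφ.start x hx]

/-- Fixes the constant of integration in the action: at a boundary point both the velocity and the
Hamiltonian vanish. -/
theorem action_boundary :
    ∫ t in (0 : ℝ)..1, actionDensity φ F t (EuclideanSpace.single 0 1) = 0 := by
  obtain ⟨δ, hδ, h⟩ := hφ.velocity_eq_zero
  obtain ⟨δ', hδ', h'⟩ := hF.near_boundary
  have hb : (EuclideanSpace.single 0 1 : E2) ∈ disk := by simp [disk]
  rw [intervalIntegral.integral_congr (g := fun _ => (0 : ℝ)), intervalIntegral.integral_zero]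
  intro t ht
  rw [uIcc_of_le zero_le_one] at ht
  have h1 := h (t, EuclideanSpace.single 0 1) ⟨ht, hb⟩ (by simp [hδ.le])
  have h2 := h' t ht (EuclideanSpace.single 0 1) hb (by simp [hδ'.le])
  change F t (φ t _) - _ = (0 : ℝ)
  rw [h1.1, h1.2, h2]
  simp [areaForm]

/-- At each time the substitution `y = φ_t x` turns the density into `F_t(y) - dF_t(y)(y)/2`,
because `ω(X_t, y) = dF_t(y)`; Euler's formula then produces the factor 2. -/
theorem setIntegral_action : ∫ x in disk, ∫ t in (0 : ℝ)..1, actionDensity φ F t x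
    = 2 * ∫ t in (0 : ℝ)..1, ∫ x in disk, F t x := by
  have hs := contDiffOn_actionDensity hφ hF
  obtain ⟨δ, hδ, h⟩ := hF.near_boundary
  simp_rw [intervalIntegral.integral_of_le zero_le_one]
  rw [integral_integral_swap]
  · rw [← integral_const_mul]
    refine setIntegral_congr_fun measurableSet_Ioc fun t ht => ?_
    have ht' : t ∈ Icc (0 : ℝ) 1 := Ioc_subset_Icc_self ht
    rw [← setIntegral_euler (contDiffOn_space hF.smooth ht') hδ (h t ht'),
      ← hφ.setIntegral_comp ht' (fun y => F t y - (1 / 2) * fderivWithin ℝ (F t) disk y y)]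
    refine setIntegral_congr_fun measurableSet_disk fun x hx => ?_
    simp only [actionDensity]
    rw [← derivWithin_time hφ.smooth ht' hx, hF.generates t ht' x hx]
  · rw [Measure.prod_restrict]
    refine IntegrableOn.mono_set (t := disk ×ˢ Icc 0 1) ?_ (prod_mono_right Ioc_subset_Icc_self)
    refine ContinuousOn.integrableOn_compact (isCompact_disk.prod isCompact_Icc) ?_
    exact hs.continuousOn.comp (f := fun q : E2 × ℝ => (q.2, q.1)) (by fun_prop)
      fun q hq => ⟨hq.2, hq.1⟩

omit hφ hF in
/-- The Calabi integral depends only on the time-one map. -/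
theorem calabi_unique {φ φ' : ℝ → E2 → E2} (hφ : IsAreaPreservingIsotopy φ)
    (hφ' : IsAreaPreservingIsotopy φ') (heq : EqOn (φ 1) (φ' 1) disk) {F F' : ℝ → E2 → ℝ}
    (hF : IsNormalizedHamiltonian F φ) (hF' : IsNormalizedHamiltonian F' φ') :
    ∫ t in (0 : ℝ)..1, ∫ x in disk, F t x = ∫ t in (0 : ℝ)..1, ∫ x in disk, F' t x := by
  have hb : (EuclideanSpace.single 0 1 : E2) ∈ disk := by simp [disk]
  have key : ∀ x ∈ disk, ∫ t in (0 : ℝ)..1, actionDensity φ F t x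
      = ∫ t in (0 : ℝ)..1, actionDensity φ' F' t x := by
    intro x hx
    have hder : ∀ y ∈ disk, HasFDerivWithinAt (fun x => (∫ t in (0 : ℝ)..1, actionDensity φ F t x)
        - ∫ t in (0 : ℝ)..1, actionDensity φ' F' t x) (0 : E2 →L[ℝ] ℝ) disk y := by
      intro y hy
      obtain ⟨L, hL, hLv⟩ := hasFDerivWithinAt_action hφ hF hy
      obtain ⟨L', hL', hLv'⟩ := hasFDerivWithinAt_action hφ' hF' hy
      have : L = L' := by
        ext v
        rw [hLv, hLv', fderivWithin_congr heq (heq hy), heq hy]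
      have h := hL.sub hL'
      rw [this, sub_self] at h
      exact h
    have := convex_disk.is_const_of_fderivWithin_eq_zero (𝕜 := ℝ)
      (fun y hy => (hder y hy).differentiableWithinAt)
      (fun y hy => (hder y hy).fderivWithin (uniqueDiffOn_disk y hy)) hx hb
    rw [action_boundary hφ hF, action_boundary hφ' hF', sub_self] at this
    exact sub_eq_zero.1 this
  have h := setIntegral_action hφ hF
  rw [setIntegral_congr_fun measurableSet_disk key, setIntegral_action hφ' hF'] at h
  linarith

omit hF in
theorem isCalabiInvariant_of_hamiltonian (hF : IsNormalizedHamiltonian F φ) :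
    IsCalabiInvariant (φ 1) (∫ t in (0 : ℝ)..1, ∫ x in disk, F t x) :=
  ⟨⟨φ, hφ, fun _ _ => rfl⟩, fun _ hφ' h =>
    ⟨hφ'.exists_hamiltonian, fun _ hF' => calabi_unique hφ' hφ h hF' hF⟩⟩

end Calabi

/-! ### Exterior algebra in three-space. -/

section Algebra

/-- The volume form as a continuous trilinear map. -/
def volL : E3 →L[ℝ] E3 →L[ℝ] E3 →L[ℝ] ℝ :=
  let p : Fin 3 → E3 →L[ℝ] ℝ := fun i => EuclideanSpace.proj i
  (p 0).smulRight ((p 1).smulRight (p 2) - (p 2).smulRight (p 1))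
    + (p 1).smulRight ((p 2).smulRight (p 0) - (p 0).smulRight (p 2))
    + (p 2).smulRight ((p 0).smulRight (p 1) - (p 1).smulRight (p 0))

theorem volumeForm_eq (u v w : E3) : volumeForm u v w = u 0 * (v 1 * w 2 - v 2 * w 1)
    + u 1 * (v 2 * w 0 - v 0 * w 2) + u 2 * (v 0 * w 1 - v 1 * w 0) := by
  simp [volumeForm, Matrix.det_fin_three]; ring

@[simp] theorem volL_apply (u v w : E3) : volL u v w = volumeForm u v w := by
  simp [volL, volumeForm_eq]

theorem eq_sum_e (v : E3) : v = v 0 • e 0 + v 1 • e 1 + v 2 • e 2 := by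
  ext i; fin_cases i <;> simp [e]

theorem apply_eq_sum_e (β : E3 →L[ℝ] ℝ) (v : E3) :
    β v = v 0 * β (e 0) + v 1 * β (e 1) + v 2 * β (e 2) := by
  conv_lhs => rw [eq_sum_e v]
  simp

/-- Reduces all helicity integrals to pairings of a one-form with a vector field, as `wedge_extD`
does for the weak equation. -/
theorem wedge_contraction (β : E3 →L[ℝ] ℝ) (Y : E3 → E3) (q : E3) :
    wedge β (contraction Y q) = β (Y q) := by
  rw [apply_eq_sum_e β (Y q)]
  simp [wedge, contraction, volumeForm_eq, e]
  ring

/-- The antisymmetrization of a bilinear map. -/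
def antisymm (A : E3 →L[ℝ] E3 →L[ℝ] ℝ) (u v : E3) : ℝ := A u v - A v u

theorem extD_eq (η : E3 → E3 →L[ℝ] ℝ) (q : E3) : extD η q = antisymm (fderiv ℝ η q) := rfl

theorem wedge_volL (a b : E3) (A : E3 →L[ℝ] E3 →L[ℝ] ℝ) :
    wedge (volL a b) (antisymm A) = A a b - A b a := by
  have h : ∀ a b : E3, A a b = ∑ i : Fin 3, ∑ j : Fin 3, a i * b j * A (e i) (e j) := by
    intro a b
    conv_lhs => rw [eq_sum_e a, eq_sum_e b]
    simp [Fin.sum_univ_three]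
    ring
  rw [h a b, h b a]
  simp [wedge, antisymm, volumeForm_eq, Fin.sum_univ_three, e]
  ring

/-- The vector dual to the antisymmetrization of a bilinear map. -/
def curlVec : (E3 →L[ℝ] E3 →L[ℝ] ℝ) →L[ℝ] E3 :=
  let c : E3 → E3 → (E3 →L[ℝ] E3 →L[ℝ] ℝ) →L[ℝ] ℝ := fun u v =>
    (ContinuousLinearMap.apply ℝ ℝ v).comp (ContinuousLinearMap.apply ℝ (E3 →L[ℝ] ℝ) u)
  (c (e 1) (e 2) - c (e 2) (e 1)).smulRight (e 0)
    + (c (e 2) (e 0) - c (e 0) (e 2)).smulRight (e 1)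
    + (c (e 0) (e 1) - c (e 1) (e 0)).smulRight (e 2)

theorem wedge_antisymm (β : E3 →L[ℝ] ℝ) (A : E3 →L[ℝ] E3 →L[ℝ] ℝ) :
    wedge β (antisymm A) = β (curlVec A) := by
  simp [wedge, antisymm, curlVec]; ring

theorem wedge_extD (β : E3 →L[ℝ] ℝ) (η : E3 → E3 →L[ℝ] ℝ) (q : E3) :
    wedge β (extD η q) = β (curlVec (fderiv ℝ η q)) := by
  rw [extD_eq, wedge_antisymm]

theorem volL_curlVec (a b : E3) (A : E3 →L[ℝ] E3 →L[ℝ] ℝ) :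
    volL a b (curlVec A) = A a b - A b a := by
  rw [← wedge_antisymm, wedge_volL]

/-- The left side is `β` paired with the curl of a test form `ρ · dV(u, v, ·)` when `a = dρ`; such
test forms isolate the `(u, v)` component of the exterior derivative of `β`. -/
theorem apply_curlVec_smulRight (β a : E3 →L[ℝ] ℝ) (u v : E3) :
    β (curlVec (a.smulRight (volL u v))) = β u * a v - β v * a u := by
  rw [apply_eq_sum_e β u, apply_eq_sum_e β v, apply_eq_sum_e a u, apply_eq_sum_e a v]
  simp [curlVec, volumeForm_eq, e]
  ring

end Algebra

/-! ### The Biot-Savart kernel and its divergence. -/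

/-- The kernel of the law of Biot and Savart. -/
def newtonKernel (z : E3) : E3 := (4 * Real.pi * ‖z‖ ^ 3)⁻¹ • z

theorem measurable_newtonKernel : Measurable newtonKernel := by
  unfold newtonKernel
  fun_prop

@[simp] theorem newtonKernel_neg (z : E3) : newtonKernel (-z) = -newtonKernel z := by
  simp [newtonKernel]

theorem norm_newtonKernel (z : E3) : ‖newtonKernel z‖ = (4 * Real.pi)⁻¹ * (‖z‖ ^ 2)⁻¹ := by
  have hp := Real.pi_pos
  rcases eq_or_ne z 0 with rfl | hz
  · simp [newtonKernel]
  · have : 0 < ‖z‖ := norm_pos_iff.2 hz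
    rw [newtonKernel, norm_smul, norm_inv, Real.norm_of_nonneg (by positivity)]
    field_simp

theorem integrableOn_newtonKernel (R : ℝ) : IntegrableOn newtonKernel (Metric.ball 0 R) := by
  refine (integrable_norm_iff measurable_newtonKernel.aestronglyMeasurable).1 ?_
  simp only [norm_newtonKernel]
  refine Integrable.const_mul ?_ _
  refine (integrableOn_fun_norm_addHaar (μ := (volume : Measure E3))
    (f := fun r : ℝ => (r ^ 2)⁻¹)).2 ?_
  -- The weight `r ^ 2` of polar coordinates cancels the singularity `r ^ (-2)`.
  refine IntegrableOn.congr_fun (f := fun _ => (1 : ℝ)) (by simp) (fun r hr => ?_)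
    measurableSet_Ioo
  have : r ≠ 0 := hr.1.ne'
  simp only [finrank_euclideanSpace, Fintype.card_fin, smul_eq_mul]
  norm_num
  field_simp

theorem locallyIntegrable_newtonKernel : LocallyIntegrable newtonKernel volume := by
  intro x
  refine ⟨Metric.ball 0 (‖x‖ + 1), Metric.isOpen_ball.mem_nhds (by simp), ?_⟩
  exact integrableOn_newtonKernel _

/-- Integration in polar coordinates. -/
theorem integral_polar_coordinates {g : E3 → ℝ} (hg : Integrable g) :
    ∫ z, g z = ∫ θ : Metric.sphere (0 : E3) 1,
      (∫ r in Ioi (0 : ℝ), r ^ 2 * g (r • (θ : E3))) ∂(volume : Measure E3).toSphere := by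
  have hmp := (volume : Measure E3).measurePreserving_homeomorphUnitSphereProd
  have hd : Module.finrank ℝ E3 - 1 = 2 := by simp
  rw [hd] at hmp
  have hfun : ∀ z : ({(0 : E3)}ᶜ : Set E3), g z
      = (fun p : Metric.sphere (0 : E3) 1 × Ioi (0 : ℝ) => g ((p.2 : ℝ) • (p.1 : E3)))
        (homeomorphUnitSphereProd E3 z) := by
    intro z
    have : (z : E3) ≠ 0 := z.2
    simp [smul_smul, norm_ne_zero_iff.2 this]
  have hint : Integrable (fun p : Metric.sphere (0 : E3) 1 × Ioi (0 : ℝ) =>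
      g ((p.2 : ℝ) • (p.1 : E3))) ((volume : Measure E3).toSphere.prod
        (Measure.volumeIoiPow 2)) := by
    rw [← hmp.integrable_comp_emb (Homeomorph.measurableEmbedding _)]
    refine Integrable.congr (f := fun z : ({(0 : E3)}ᶜ : Set E3) => g z) ?_
      (Eventually.of_forall hfun)
    have : IntegrableOn g {(0 : E3)}ᶜ := hg.integrableOn
    exact (integrableOn_iff_comap_subtypeVal (measurableSet_singleton _).compl).1 this
  calc ∫ z, g z = ∫ z : ({(0)}ᶜ : Set E3), g z ∂((volume : Measure E3).comap (↑)) := by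
        rw [integral_subtype_comap (measurableSet_singleton _).compl g,
          restrict_compl_singleton]
    _ = ∫ p : Metric.sphere (0 : E3) 1 × Ioi (0 : ℝ), g ((p.2 : ℝ) • (p.1 : E3))
          ∂(volume : Measure E3).toSphere.prod (Measure.volumeIoiPow 2) := by
        rw [integral_congr_ae (Eventually.of_forall hfun)]
        exact hmp.integral_comp (Homeomorph.measurableEmbedding _)
          (fun p : Metric.sphere (0 : E3) 1 × Ioi (0 : ℝ) => g ((p.2 : ℝ) • (p.1 : E3)))
    _ = _ := by
        rw [integral_prod _ hint]
        refine integral_congr_ae (Eventually.of_forall fun θ => ?_)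
        simp only [Measure.volumeIoiPow, ENNReal.ofReal]
        rw [integral_withDensity_eq_integral_smul,
          integral_subtype_comap measurableSet_Ioi
            fun a : ℝ => Real.toNNReal (a ^ 2) • g (a • (θ : E3))]
        · refine setIntegral_congr_fun measurableSet_Ioi fun x hx => ?_
          rw [NNReal.smul_def, Real.coe_toNNReal _ (by positivity), smul_eq_mul]
        · exact (measurable_subtype_coe.pow_const _).real_toNNReal

/-- The divergence of the kernel is the delta function at the origin. -/
theorem integral_fderiv_newtonKernel {f : E3 → ℝ} (hf : ContDiff ℝ 1 f) (hc : HasCompactSupport f) :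
    Integrable (fun z => fderiv ℝ f z (newtonKernel z)) ∧
      ∫ z, fderiv ℝ f z (newtonKernel z) = -f 0 := by
  have hcd := hf.continuous_fderiv one_ne_zero
  have hint : Integrable (fun z => fderiv ℝ f z (newtonKernel z)) := by
    obtain ⟨R, hR⟩ := (hc.fderiv ℝ).isCompact.isBounded.subset_ball (0 : E3)
    obtain ⟨C, hC⟩ := (hc.fderiv ℝ).exists_bound_of_continuous hcd
    have h1 : IntegrableOn (fun z => C * ‖newtonKernel z‖) (Metric.ball 0 R) :=
      (integrableOn_newtonKernel R).norm.const_mul _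
    have hm : AEStronglyMeasurable (fun z => fderiv ℝ f z (newtonKernel z)) volume := by
      exact (ContinuousLinearMap.apply ℝ ℝ).aestronglyMeasurable_comp₂
        measurable_newtonKernel.aestronglyMeasurable hcd.aestronglyMeasurable
    refine (integrableOn_iff_integrable_of_support_subset (s := Metric.ball 0 R) ?_).1
      (h1.mono' hm.restrict (Eventually.of_forall fun z => ?_))
    · intro z hz
      refine hR (subset_tsupport _ fun h => hz ?_)
      simp [h]
    · exact (ContinuousLinearMap.le_opNorm _ _).trans (by gcongr; exact hC z)
  refine ⟨hint, ?_⟩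
  rw [integral_polar_coordinates hint]
  -- On the ray through `θ` the integrand is `(4π)⁻¹` times the radial derivative of `f`, so only
  -- the value at the origin survives. The unit sphere has area `3 · (4π/3) = 4π`.
  have inner : ∀ θ : Metric.sphere (0 : E3) 1,
      ∫ r in Ioi (0 : ℝ), r ^ 2 * fderiv ℝ f (r • (θ : E3)) (newtonKernel (r • (θ : E3)))
        = -(4 * Real.pi)⁻¹ * f 0 := by
    intro θ
    have hθ : ‖(θ : E3)‖ = 1 := by simp
    have hline : ContDiff ℝ 1 fun r : ℝ => f (r • (θ : E3)) := hf.comp (by fun_prop)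
    have hder : ∀ r : ℝ, deriv (fun r : ℝ => f (r • (θ : E3))) r
        = fderiv ℝ f (r • (θ : E3)) θ := by
      intro r
      have h1 : HasDerivAt (fun r : ℝ => r • (θ : E3)) (θ : E3) r := by
        simpa using (hasDerivAt_id r).smul_const (θ : E3)
      exact ((hf.differentiable one_ne_zero _).hasFDerivAt.comp_hasDerivAt r h1).deriv
    have hcl : HasCompactSupport fun r : ℝ => f (r • (θ : E3)) := by
      refine hc.comp_isClosedEmbedding (g := fun r : ℝ => r • (θ : E3)) ?_
      refine (Isometry.of_dist_eq fun a b => ?_).isClosedEmbedding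
      rw [dist_eq_norm, ← sub_smul, norm_smul, hθ, mul_one, ← dist_eq_norm]
    have hftc := hcl.integral_Ioi_deriv_eq hline 0
    have e1 : ∫ r in Ioi (0 : ℝ), r ^ 2 * fderiv ℝ f (r • (θ : E3)) (newtonKernel (r • (θ : E3)))
        = ∫ r in Ioi (0 : ℝ), (4 * Real.pi)⁻¹ * deriv (fun r : ℝ => f (r • (θ : E3))) r := by
      refine setIntegral_congr_fun measurableSet_Ioi fun r hr => ?_
      have hr' : (0 : ℝ) < r := hr
      have hp := Real.pi_pos
      simp only [newtonKernel, hder, map_smul, smul_eq_mul, norm_smul, hθ,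
        Real.norm_of_nonneg hr'.le]
      field_simp
    rw [e1, integral_const_mul, hftc]
    simp
  simp_rw [inner]
  rw [integral_const, Measure.toSphere_real_apply_univ]
  have hv : (volume : Measure E3).real (Metric.ball 0 1) = Real.pi * 4 / 3 := by
    rw [Measure.real, EuclideanSpace.volume_ball_fin_three]
    have := Real.pi_pos
    simp
    positivity
  rw [hv]
  have hp := Real.pi_pos
  simp
  field_simp

/-! ### Bounded fields and the Biot-Savart primitive. -/

/-- A bounded measurable vector field with bounded support. -/
structure IsBoundedField (Y : E3 → E3) : Prop where
  aestronglyMeasurable : AEStronglyMeasurable Y volume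
  bounded : ∃ C : ℝ, 0 ≤ C ∧ ∀ x, ‖Y x‖ ≤ C
  support : ∃ R : ℝ, 0 < R ∧ ∀ x, Y x ≠ 0 → x ∈ Metric.ball 0 R

/-- A bounded measurable vector field with bounded support and weakly divergence-free. -/
structure IsAdmissible (Y : E3 → E3) : Prop extends IsBoundedField Y where
  div_free : ∀ h : E3 → ℝ, ContDiff ℝ ∞ h → ∫ q, fderiv ℝ h q (Y q) = 0

namespace IsBoundedField

variable {Y Z : E3 → E3}

theorem integrable (hY : IsBoundedField Y) : Integrable Y := by
  obtain ⟨C, -, hC⟩ := hY.bounded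
  obtain ⟨R, -, hR⟩ := hY.support
  refine (integrableOn_iff_integrable_of_support_subset (s := Metric.ball 0 R) hR).1 ?_
  exact Measure.integrableOn_of_bounded (M := C) measure_ball_lt_top.ne hY.aestronglyMeasurable
    (Eventually.of_forall hC)

theorem of_continuous (hc : Continuous Y) (hs : HasCompactSupport Y) : IsBoundedField Y := by
  obtain ⟨C, hC⟩ := hs.exists_bound_of_continuous hc
  obtain ⟨R, hR0, hR⟩ := hs.isCompact.isBounded.subset_ball_lt 0 (0 : E3)
  exact ⟨hc.aestronglyMeasurable, ⟨C, (norm_nonneg (Y 0)).trans (hC 0), hC⟩, R, hR0,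
    fun x hx => hR (subset_tsupport _ hx)⟩

theorem add (hY : IsBoundedField Y) (hZ : IsBoundedField Z) :
    IsBoundedField (fun x => Y x + Z x) := by
  obtain ⟨C, hC0, hC⟩ := hY.bounded
  obtain ⟨R, hR0, hR⟩ := hY.support
  obtain ⟨C', hC0', hC'⟩ := hZ.bounded
  obtain ⟨R', hR0', hR'⟩ := hZ.support
  refine ⟨hY.aestronglyMeasurable.add hZ.aestronglyMeasurable, ⟨C + C', by positivity, fun x =>
    (norm_add_le _ _).trans (add_le_add (hC x) (hC' x))⟩, max R R', lt_max_of_lt_left hR0,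
    fun x hx => ?_⟩
  by_cases h : Y x = 0
  · refine Metric.ball_subset_ball (le_max_right R R') (hR' x fun h' => hx ?_)
    rw [h, h', add_zero]
  · exact Metric.ball_subset_ball (le_max_left R R') (hR x h)

/-- A locally integrable one-form can be integrated against a bounded field. -/
theorem integrable_pairing (hZ : IsBoundedField Z) {β : E3 → E3 →L[ℝ] ℝ}
    (hβ : LocallyIntegrable β volume) : Integrable (fun x => β x (Z x)) := by
  obtain ⟨C, -, hC⟩ := hZ.bounded
  obtain ⟨R, -, hR⟩ := hZ.support
  have hm : AEStronglyMeasurable (fun x => β x (Z x)) volume :=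
    (ContinuousLinearMap.id ℝ (E3 →L[ℝ] ℝ)).aestronglyMeasurable_comp₂
      hβ.aestronglyMeasurable hZ.aestronglyMeasurable
  refine (integrableOn_iff_integrable_of_support_subset (s := Metric.ball 0 R) ?_).1 ?_
  · exact fun x hx => hR x fun h => hx (by simp [h])
  · have h1 : IntegrableOn (fun x => ‖β x‖ * C) (Metric.ball 0 R) :=
      ((hβ.integrableOn_isCompact (isCompact_closedBall 0 R)).mono_set
        Metric.ball_subset_closedBall).norm.mul_const _
    refine h1.mono' hm.restrict (Eventually.of_forall fun x => ?_)
    exact (ContinuousLinearMap.le_opNorm _ _).trans (by gcongr; exact hC x)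

/-- The integrand of the mutual helicity is integrable. -/
theorem integrable_kernel (hY : IsBoundedField Y) (hZ : IsBoundedField Z) :
    Integrable (fun p : E3 × E3 => volL (Y p.2) (newtonKernel (p.1 - p.2)) (Z p.1))
      (volume.prod volume) := by
  obtain ⟨C, -, hC⟩ := hZ.bounded
  obtain ⟨R, hR0, hR⟩ := hZ.support
  obtain ⟨R', hR0', hR'⟩ := hY.support
  -- Only differences of points of the two supports occur, so the kernel may be cut off at radius `R
  -- + R'`; it is then integrable, and so is the convolution integrand.
  have h1 : Integrable ((Metric.ball (0 : E3) (R + R')).indicator newtonKernel) := by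
    rw [integrable_indicator_iff Metric.isOpen_ball.measurableSet]
    exact integrableOn_newtonKernel _
  have h2 := (hY.integrable.convolution_integrand volL h1).norm.mul_const C
  have hm : AEStronglyMeasurable
      (fun p : E3 × E3 => volL (Y p.2) (newtonKernel (p.1 - p.2)) (Z p.1))
      (volume.prod volume) := by
    have h3 : AEStronglyMeasurable (fun p : E3 × E3 => volL (Y p.2) (newtonKernel (p.1 - p.2)))
        (volume.prod volume) := hY.aestronglyMeasurable.convolution_integrand volL
      measurable_newtonKernel.aestronglyMeasurable
    exact (ContinuousLinearMap.id ℝ (E3 →L[ℝ] ℝ)).aestronglyMeasurable_comp₂ h3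
      hZ.aestronglyMeasurable.comp_fst
  refine h2.mono' hm (Eventually.of_forall fun p => ?_)
  by_cases hy : Y p.2 = 0
  · simp [hy]
  by_cases hz : Z p.1 = 0
  · rw [hz, map_zero, norm_zero]
    exact mul_nonneg (norm_nonneg _) ((norm_nonneg _).trans (hC 0))
  have hmem : p.1 - p.2 ∈ Metric.ball (0 : E3) (R + R') := by
    have h4 := hR _ hz
    have h5 := hR' _ hy
    rw [mem_ball_zero_iff] at h4 h5 ⊢
    exact (norm_sub_le _ _).trans_lt (add_lt_add h4 h5)
  rw [indicator_of_mem hmem]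
  exact (ContinuousLinearMap.le_opNorm _ _).trans (by gcongr; exact hC _)

end IsBoundedField

/-- The Biot-Savart primitive of a vector field. -/
def biotSavart (Y : E3 → E3) (x : E3) : E3 →L[ℝ] ℝ :=
  ∫ y, volL (Y y) (newtonKernel (x - y))

namespace IsBoundedField

variable {Y Z : E3 → E3}

theorem integrable_biotSavart_integrand (hY : IsBoundedField Y) (x : E3) :
    Integrable (fun y => volL (Y y) (newtonKernel (x - y))) := by
  obtain ⟨C, -, hC⟩ := hY.bounded
  obtain ⟨R, hR0, hR⟩ := hY.support
  have hm : AEStronglyMeasurable (fun y => volL (Y y) (newtonKernel (x - y))) volume :=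
    volL.aestronglyMeasurable_comp₂ hY.aestronglyMeasurable
      (measurable_newtonKernel.comp (measurable_const.sub measurable_id)).aestronglyMeasurable
  have h1 : Integrable ((Metric.ball (0 : E3) (‖x‖ + R)).indicator newtonKernel) := by
    rw [integrable_indicator_iff Metric.isOpen_ball.measurableSet]
    exact integrableOn_newtonKernel _
  have h2 := ((h1.comp_sub_left x).norm.const_mul (‖volL‖ * C))
  refine h2.mono' hm (Eventually.of_forall fun y => ?_)
  by_cases hy : Y y = 0
  · simp only [hy, map_zero, zero_apply, norm_zero]
    exact mul_nonneg (mul_nonneg (norm_nonneg _) ((norm_nonneg _).trans (hC 0))) (norm_nonneg _)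
  have hmem : x - y ∈ Metric.ball (0 : E3) (‖x‖ + R) := by
    have h5 := hR _ hy
    rw [mem_ball_zero_iff] at h5 ⊢
    exact (norm_sub_le _ _).trans_lt (by gcongr)
  rw [indicator_of_mem hmem]
  exact (volL.le_opNorm₂ _ _).trans (by gcongr; exact hC _)

theorem biotSavart_apply (hY : IsBoundedField Y) (x v : E3) :
    biotSavart Y x v = ∫ y, volL (Y y) (newtonKernel (x - y)) v :=
  ContinuousLinearMap.integral_apply (hY.integrable_biotSavart_integrand x) v

/-- On a given ball the primitive agrees with the convolution of `Y` with a truncated, integrable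
kernel. -/
theorem locallyIntegrable_biotSavart (hY : IsBoundedField Y) :
    LocallyIntegrable (biotSavart Y) volume := by
  intro x₀
  set r := ‖x₀‖ + 1 with hr
  refine ⟨Metric.ball 0 r, Metric.isOpen_ball.mem_nhds (by simp [hr]), ?_⟩
  obtain ⟨R, hR0, hR⟩ := hY.support
  have h1 : Integrable ((Metric.ball (0 : E3) (r + R)).indicator newtonKernel) := by
    rw [integrable_indicator_iff Metric.isOpen_ball.measurableSet]
    exact integrableOn_newtonKernel _
  have h2 := (hY.integrable.convolution_integrand volL h1).integral_prod_left
  refine h2.integrableOn.congr_fun (fun x hx => ?_) Metric.isOpen_ball.measurableSet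
  refine integral_congr_ae (Eventually.of_forall fun y => ?_)
  by_cases hy : Y y = 0
  · simp [hy]
  have hmem : x - y ∈ Metric.ball (0 : E3) (r + R) := by
    have h5 := hR _ hy
    rw [mem_ball_zero_iff] at h5 hx ⊢
    exact (norm_sub_le _ _).trans_lt (add_lt_add hx h5)
  simp only
  rw [indicator_of_mem hmem]

/-- The integral of the Biot-Savart primitive against a field, as a double integral. -/
theorem integral_biotSavart (hY : IsBoundedField Y) (Z : E3 → E3) :
    ∫ x, biotSavart Y x (Z x) = ∫ x, ∫ y, volL (Y y) (newtonKernel (x - y)) (Z x) := by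
  simp_rw [hY.biotSavart_apply]

/-- Exchanging the two points gives one sign because the kernel is odd and another because `dV` is
alternating. -/
theorem integral_biotSavart_comm (hY : IsBoundedField Y) (hZ : IsBoundedField Z) :
    ∫ x, biotSavart Y x (Z x) = ∫ x, biotSavart Z x (Y x) := by
  rw [hY.integral_biotSavart, hZ.integral_biotSavart,
    integral_integral_swap (f := fun x y => volL (Y y) (newtonKernel (x - y)) (Z x))
      (hY.integrable_kernel hZ)]
  refine integral_congr_ae (Eventually.of_forall fun x => integral_congr_ae
    (Eventually.of_forall fun y => ?_))
  simp only [volL_apply]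
  rw [← neg_sub x y, newtonKernel_neg]
  simp only [volumeForm_eq, PiLp.neg_apply]
  ring

end IsBoundedField

section WeakEquation

variable {η : E3 → E3 →L[ℝ] ℝ}

theorem isBoundedField_curl (hη : ContDiff ℝ ∞ η) (hc : HasCompactSupport η) :
    IsBoundedField (fun x => curlVec (fderiv ℝ η x)) := by
  refine IsBoundedField.of_continuous (curlVec.continuous.comp (hη.continuous_fderiv (by simp))) ?_
  exact (hc.fderiv ℝ).comp_left (map_zero curlVec)

/-- The convolution of the kernel with a test form. -/
def kernelConv (η : E3 → E3 →L[ℝ] ℝ) : E3 → ℝ :=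
  convolution newtonKernel η (ContinuousLinearMap.apply ℝ ℝ) volume

theorem contDiff_kernelConv (hη : ContDiff ℝ ∞ η) (hc : HasCompactSupport η) :
    ContDiff ℝ ∞ (kernelConv η) :=
  hc.contDiff_convolution_right (n := ⊤) _ locallyIntegrable_newtonKernel hη

theorem precompR_apply_apply (k : E3) (A : E3 →L[ℝ] E3 →L[ℝ] ℝ) (v : E3) :
    (ContinuousLinearMap.apply ℝ ℝ).precompR E3 k A v = A v k := rfl

theorem integrable_fderiv_kernel (hη : ContDiff ℝ ∞ η) (hc : HasCompactSupport η) (y v : E3) :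
    Integrable (fun x => fderiv ℝ η x v (newtonKernel (x - y))) := by
  have hcd := hη.continuous_fderiv (by simp)
  have h : ConvolutionExistsAt newtonKernel (fderiv ℝ η) y
      ((ContinuousLinearMap.apply ℝ ℝ).precompR E3) volume :=
    (hc.fderiv ℝ).convolutionExists_right _ locallyIntegrable_newtonKernel hcd y
  refine ((h.integrable.comp_sub_left y).apply_continuousLinearMap v).neg.congr
    (Eventually.of_forall fun x => ?_)
  simp only [Pi.neg_apply, precompR_apply_apply, sub_sub_cancel]
  rw [← neg_sub x y, newtonKernel_neg, map_neg, neg_neg]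

theorem fderiv_kernelConv (hη : ContDiff ℝ ∞ η) (hc : HasCompactSupport η) (y v : E3) :
    ∫ x, fderiv ℝ η x v (newtonKernel (x - y)) = -fderiv ℝ (kernelConv η) y v := by
  have hcd := hη.continuous_fderiv (by simp)
  have h : ConvolutionExistsAt newtonKernel (fderiv ℝ η) y
      ((ContinuousLinearMap.apply ℝ ℝ).precompR E3) volume :=
    (hc.fderiv ℝ).convolutionExists_right _ locallyIntegrable_newtonKernel hcd y
  have h1 := (hc.hasFDerivAt_convolution_right (μ := volume) (ContinuousLinearMap.apply ℝ ℝ)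
    locallyIntegrable_newtonKernel (hη.of_le (by simp)) y).fderiv
  rw [kernelConv, h1, convolution, ContinuousLinearMap.integral_apply h.integrable,
    ← integral_sub_left_eq_self (fun x => fderiv ℝ η x v (newtonKernel (x - y))) volume y,
    ← integral_neg]
  refine integral_congr_ae (Eventually.of_forall fun x => ?_)
  simp only [precompR_apply_apply]
  rw [sub_sub_cancel_left, newtonKernel_neg, map_neg]

theorem integral_fderiv_kernel (hη : ContDiff ℝ ∞ η) (hc : HasCompactSupport η) (y v : E3) :
    Integrable (fun x => fderiv ℝ η x (newtonKernel (x - y)) v) ∧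
    ∫ x, fderiv ℝ η x (newtonKernel (x - y)) v = -η y v := by
  have hf : ContDiff ℝ 1 (fun x => η (x + y) v) :=
    ((hη.of_le (by simp)).comp (contDiff_id.add contDiff_const)).clm_apply contDiff_const
  have hfc : HasCompactSupport (fun x => η (x + y) v) := by
    have := hc.comp_homeomorph (Homeomorph.addRight y)
    exact this.comp_left (g := fun β : E3 →L[ℝ] ℝ => β v) rfl
  have hder : ∀ x w, fderiv ℝ (fun x => η (x + y) v) x w = fderiv ℝ η (x + y) w v := by
    intro x w
    have h1 : HasFDerivAt (fun x => η (x + y)) (fderiv ℝ η (x + y)) x :=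
      ((hη.differentiable (by simp) (x + y)).hasFDerivAt).comp x
        ((hasFDerivAt_id x).add_const y)
    rw [(h1.clm_apply (hasFDerivAt_const v x)).fderiv]
    simp
  obtain ⟨h1, h2⟩ := integral_fderiv_newtonKernel hf hfc
  simp only [hder, zero_add] at h1 h2
  constructor
  · simpa using h1.comp_sub_right y
  · rw [← h2]
    simpa using (integral_sub_right_eq_self (μ := volume)
      (fun z => fderiv ℝ η (z + y) (newtonKernel z) v) y)

/-- The kernel inverts the curl up to a gradient. Contraction with `v` and the kernel `K` leaves
`(∂_v η)(K) - (∂_K η)(v)`: the second integral is `-η y v` since `div K = δ`, the first is a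
derivative of the convolution of `K` with `η`. -/
theorem integral_kernel_curl (hη : ContDiff ℝ ∞ η) (hc : HasCompactSupport η) (y v : E3) :
    ∫ x, volL v (newtonKernel (x - y)) (curlVec (fderiv ℝ η x))
      = η y v - fderiv ℝ (kernelConv η) y v := by
  have h := integral_fderiv_kernel hη hc y v
  simp only [volL_curlVec]
  rw [integral_sub (integrable_fderiv_kernel hη hc y v) h.1, fderiv_kernelConv hη hc, h.2]
  ring

/-- After Fubini, the gradient term of `integral_kernel_curl` is integrated against `Y` and
disappears because `Y` is weakly divergence-free. -/
theorem IsAdmissible.integral_biotSavart_curl {Y : E3 → E3} (hY : IsAdmissible Y)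
    (hη : ContDiff ℝ ∞ η) (hc : HasCompactSupport η) :
    ∫ x, biotSavart Y x (curlVec (fderiv ℝ η x)) = ∫ x, η x (Y x) := by
  have hk := contDiff_kernelConv hη hc
  have hZ := isBoundedField_curl hη hc
  obtain ⟨Z, hZe⟩ : ∃ Z : E3 → E3, Z = fun x => curlVec (fderiv ℝ η x) := ⟨_, rfl⟩
  have h1 : ∫ x, biotSavart Y x (Z x) = ∫ y, ∫ x, volL (Y y) (newtonKernel (x - y)) (Z x) := by
    rw [hY.integral_biotSavart]
    exact integral_integral_swap (hY.integrable_kernel (hZe ▸ hZ))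
  have h2 : ∀ y, ∫ x, volL (Y y) (newtonKernel (x - y)) (Z x)
      = η y (Y y) - fderiv ℝ (kernelConv η) y (Y y) := fun y => by
    rw [hZe]; exact integral_kernel_curl hη hc y (Y y)
  simp_rw [h2] at h1
  rw [hZe] at h1
  rw [h1, integral_sub (hY.integrable_pairing hη.continuous.locallyIntegrable)
    (hY.integrable_pairing (hk.continuous_fderiv (by simp)).locallyIntegrable),
    hY.div_free _ hk, sub_zero]

/-- The Biot-Savart integral of an admissible field is a primitive. -/
theorem IsAdmissible.isPrimitive_biotSavart {Y : E3 → E3} (hY : IsAdmissible Y) :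
    IsPrimitive (biotSavart Y) Y := by
  refine ⟨hY.integrable.locallyIntegrable, hY.locallyIntegrable_biotSavart, fun η hη hc => ?_⟩
  simp only [wedge_extD, wedge_contraction]
  exact hY.integral_biotSavart_curl hη hc

end WeakEquation

/-! ### Independence of the choice of the primitive. -/

section Mollification

/-- The mollification of a field or a form by a scalar function. -/
def mollify {G : Type} [NormedAddCommGroup G] [NormedSpace ℝ G] (ρ : E3 → ℝ) (α : E3 → G) :
    E3 → G :=
  convolution ρ α (ContinuousLinearMap.lsmul ℝ ℝ) volume

variable {ρ : E3 → ℝ} {α : E3 → E3 →L[ℝ] ℝ}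

theorem mollify_eq {G : Type} [NormedAddCommGroup G] [NormedSpace ℝ G] (α : E3 → G) (x : E3) :
    mollify ρ α x = ∫ y, ρ (x - y) • α y := by
  simp only [mollify, convolution, ContinuousLinearMap.lsmul_apply]
  simpa using (integral_sub_left_eq_self (fun t => ρ t • α (x - t)) volume x).symm

theorem integrable_mollify_integrand {G : Type} [NormedAddCommGroup G] [NormedSpace ℝ G]
    {α : E3 → G} (hρ : Continuous ρ) (hc : HasCompactSupport ρ)
    (hα : LocallyIntegrable α volume) (x : E3) : Integrable (fun y => ρ (x - y) • α y) := by
  have h : ConvolutionExistsAt ρ α x (ContinuousLinearMap.lsmul ℝ ℝ) volume :=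
    hc.convolutionExists_left _ hρ hα x
  simpa using h.integrable.comp_sub_left x

theorem contDiff_mollify (hρ : ContDiff ℝ ∞ ρ) (hc : HasCompactSupport ρ)
    (hα : LocallyIntegrable α volume) : ContDiff ℝ ∞ (mollify ρ α) :=
  hc.contDiff_convolution_left (n := ⊤) _ hρ hα

theorem integrable_mollify_fderiv_integrand (hρ : ContDiff ℝ ∞ ρ) (hc : HasCompactSupport ρ)
    (hα : LocallyIntegrable α volume) (x u v : E3) :
    Integrable (fun y => fderiv ℝ ρ (x - y) u * α y v) := by
  have h := integrable_mollify_integrand (ρ := fun z => fderiv ℝ ρ z u)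
    ((hρ.continuous_fderiv (by simp)).clm_apply continuous_const) (hc.fderiv_apply ℝ u) hα x
  simpa using h.apply_continuousLinearMap v

theorem fderiv_mollify (hρ : ContDiff ℝ ∞ ρ) (hc : HasCompactSupport ρ)
    (hα : LocallyIntegrable α volume) (x u v : E3) :
    fderiv ℝ (mollify ρ α) x u v = ∫ y, fderiv ℝ ρ (x - y) u * α y v := by
  have hcd := hρ.continuous_fderiv (by simp)
  have h : ConvolutionExistsAt (fderiv ℝ ρ) α x
      ((ContinuousLinearMap.lsmul ℝ ℝ : ℝ →L[ℝ] (E3 →L[ℝ] ℝ) →L[ℝ] (E3 →L[ℝ] ℝ)).precompL E3)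
      volume := (hc.fderiv ℝ).convolutionExists_left _ hcd hα x
  have h1 := (hc.hasFDerivAt_convolution_left (μ := volume)
    (ContinuousLinearMap.lsmul ℝ ℝ : ℝ →L[ℝ] (E3 →L[ℝ] ℝ) →L[ℝ] (E3 →L[ℝ] ℝ))
    (hρ.of_le (by simp)) hα x).fderiv
  rw [mollify, h1, convolution, ContinuousLinearMap.integral_apply h.integrable,
    ContinuousLinearMap.integral_apply (h.integrable.apply_continuousLinearMap u),
    ← integral_sub_left_eq_self (fun t => fderiv ℝ ρ (x - t) u * α t v) volume x]
  refine integral_congr_ae (Eventually.of_forall fun t => ?_)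
  simp only [sub_sub_cancel]
  rfl

/-- A locally integrable one-form is closed in the sense of distributions. -/
def IsWeaklyClosed (α : E3 → E3 →L[ℝ] ℝ) : Prop :=
  ∀ η : E3 → E3 →L[ℝ] ℝ, ContDiff ℝ ∞ η → HasCompactSupport η →
    ∫ x, α x (curlVec (fderiv ℝ η x)) = 0

/-- Weak closedness tested on the form `y ↦ ρ(x - y) · dV(u, v, ·)`. -/
theorem IsWeaklyClosed.fderiv_mollify_symm (hcl : IsWeaklyClosed α)
    (hρ : ContDiff ℝ ∞ ρ) (hc : HasCompactSupport ρ)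
    (hα : LocallyIntegrable α volume) (x u v : E3) :
    fderiv ℝ (mollify ρ α) x u v = fderiv ℝ (mollify ρ α) x v u := by
  rw [← sub_eq_zero, fderiv_mollify hρ hc hα, fderiv_mollify hρ hc hα,
    ← integral_sub (integrable_mollify_fderiv_integrand hρ hc hα x u v)
      (integrable_mollify_fderiv_integrand hρ hc hα x v u)]
  have hs : ContDiff ℝ ∞ (fun y => ρ (x - y) • volL u v) :=
    (hρ.comp (contDiff_const.sub contDiff_id)).smul contDiff_const
  have hcs : HasCompactSupport (fun y => ρ (x - y) • volL u v) := by
    have := hc.comp_homeomorph (Homeomorph.subLeft x)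
    exact this.comp_left (g := fun r : ℝ => r • volL u v) (zero_smul ℝ _)
  rw [← hcl _ hs hcs]
  refine integral_congr_ae (Eventually.of_forall fun y => ?_)
  have hder : HasFDerivAt (fun y => ρ (x - y)) (-(fderiv ℝ ρ (x - y))) y := by
    have h1 := (hρ.differentiable (by simp) (x - y)).hasFDerivAt.comp y
      ((hasFDerivAt_id y).const_sub x)
    have h2 : -(fderiv ℝ ρ (x - y))
        = (fderiv ℝ ρ (x - y)).comp (-ContinuousLinearMap.id ℝ E3) := by ext; simp
    rw [h2]
    exact h1
  beta_reduce
  rw [(hder.smul_const (volL u v)).fderiv, apply_curlVec_smulRight]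
  simp
  ring

/-- The mollified form is smooth and closed on all of space, hence exact, and a divergence-free
field annihilates differentials. -/
theorem IsWeaklyClosed.integral_mollify_eq_zero (hcl : IsWeaklyClosed α)
    (hρ : ContDiff ℝ ∞ ρ) (hc : HasCompactSupport ρ)
    (hα : LocallyIntegrable α volume) {Z : E3 → E3} (hZ : IsAdmissible Z) :
    ∫ x, mollify ρ α x (Z x) = 0 := by
  have hs := contDiff_mollify hρ hc hα
  obtain ⟨f, hf⟩ := convex_univ.exists_forall_hasFDerivAt_of_fderiv_symmetric isOpen_univ
    (hs.differentiable (by simp)).differentiableOn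
    (fun a _ x y => hcl.fderiv_mollify_symm hρ hc hα a x y)
  have hfd : fderiv ℝ f = mollify ρ α := funext fun a => (hf a (mem_univ a)).fderiv
  have hfs : ContDiff ℝ ∞ f :=
    contDiff_infty_iff_fderiv.2 ⟨fun a => (hf a (mem_univ a)).differentiableAt, hfd ▸ hs⟩
  rw [← hfd]
  exact hZ.div_free f hfs

/-- Moves the mollifier from the form, which is only locally integrable, to the field, whose
mollifications are uniformly bounded and so allow dominated convergence. -/
theorem integral_mollify_pairing (hρ : Continuous ρ) (hc : HasCompactSupport ρ)
    (heven : ∀ x, ρ (-x) = ρ x) (hα : LocallyIntegrable α volume) {Z : E3 → E3}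
    (hZ : IsBoundedField Z) :
    ∫ x, mollify ρ α x (Z x) = ∫ y, α y (mollify ρ Z y) := by
  have h1 : ∀ x, mollify ρ α x (Z x) = ∫ y, ρ (x - y) * α y (Z x) := fun x => by
    rw [mollify_eq, ContinuousLinearMap.integral_apply (integrable_mollify_integrand hρ hc hα x)]
    simp
  have h2 : ∀ y, α y (mollify ρ Z y) = ∫ x, ρ (x - y) * α y (Z x) := fun y => by
    rw [mollify_eq, ← ContinuousLinearMap.integral_comp_comm _
      (integrable_mollify_integrand hρ hc hZ.integrable.locallyIntegrable y)]
    refine integral_congr_ae (Eventually.of_forall fun x => ?_)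
    simp only [map_smul, smul_eq_mul]
    rw [← neg_sub x y, heven]
  simp_rw [h1, h2]
  refine integral_integral_swap ?_
  obtain ⟨C, hC⟩ := hc.exists_bound_of_continuous hρ
  obtain ⟨r, hr0, hr⟩ := hc.isCompact.isBounded.subset_ball_lt 0 (0 : E3)
  obtain ⟨R, hR0, hR⟩ := hZ.support
  have hα1 : Integrable ((Metric.ball (0 : E3) (R + r)).indicator α) := by
    rw [integrable_indicator_iff Metric.isOpen_ball.measurableSet]
    exact (hα.integrableOn_isCompact (isCompact_closedBall 0 (R + r))).mono_set
      Metric.ball_subset_closedBall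
  have hbound := (hZ.integrable.norm.mul_prod hα1.norm).const_mul C
  have hm : AEStronglyMeasurable (fun p : E3 × E3 => ρ (p.1 - p.2) * α p.2 (Z p.1))
      (volume.prod volume) := by
    refine (hρ.comp (by fun_prop)).aestronglyMeasurable.mul ?_
    exact (ContinuousLinearMap.id ℝ (E3 →L[ℝ] ℝ)).aestronglyMeasurable_comp₂
      hα.aestronglyMeasurable.comp_snd hZ.aestronglyMeasurable.comp_fst
  refine hbound.mono' hm (Eventually.of_forall fun p => ?_)
  have hC0 : 0 ≤ C := (norm_nonneg _).trans (hC 0)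
  change ‖ρ (p.1 - p.2) * α p.2 (Z p.1)‖ ≤ _
  by_cases hρ0 : ρ (p.1 - p.2) = 0
  · simp only [hρ0, zero_mul, norm_zero]; positivity
  by_cases hz : Z p.1 = 0
  · simp only [hz, map_zero, mul_zero, norm_zero]; positivity
  have hmem : p.2 ∈ Metric.ball (0 : E3) (R + r) := by
    have h4 := hR _ hz
    have h5 := hr (subset_tsupport _ hρ0)
    rw [mem_ball_zero_iff] at h4 h5 ⊢
    calc ‖p.2‖ = ‖p.1 - (p.1 - p.2)‖ := by rw [sub_sub_cancel]
      _ < R + r := (norm_sub_le _ _).trans_lt (add_lt_add h4 h5)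
  rw [indicator_of_mem hmem, norm_mul]
  gcongr
  · exact hC _
  · rw [mul_comm]; exact ContinuousLinearMap.le_opNorm _ _

end Mollification

/-- A sequence of bump functions with supports shrinking to the origin. -/
def bumpSeq (n : ℕ) : ContDiffBump (0 : E3) where
  rIn := 1 / (2 * ((n : ℝ) + 1))
  rOut := 1 / ((n : ℝ) + 1)
  rIn_pos := by positivity
  rIn_lt_rOut := by
    have : (0 : ℝ) < (n : ℝ) + 1 := by positivity
    gcongr; linarith

theorem tendsto_bumpSeq : Tendsto (fun n => (bumpSeq n).rOut) atTop (𝓝 0) :=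
  tendsto_one_div_add_atTop_nhds_zero_nat

/-- A weakly closed form integrates to zero against an admissible field. -/
theorem IsWeaklyClosed.integral_eq_zero {α : E3 → E3 →L[ℝ] ℝ} (hcl : IsWeaklyClosed α)
    (hα : LocallyIntegrable α volume) {Z : E3 → E3} (hZ : IsAdmissible Z) :
    ∫ x, α x (Z x) = 0 := by
  set ρ : ℕ → E3 → ℝ := fun n => (bumpSeq n).normed volume with hρdef
  have hρ : ∀ n, ContDiff ℝ ∞ (ρ n) := fun n => (bumpSeq n).contDiff_normed (n := ⊤)
  have hc : ∀ n, HasCompactSupport (ρ n) := fun n => (bumpSeq n).hasCompactSupport_normed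
  have hzero : ∀ n, ∫ x, α x (mollify (ρ n) Z x) = 0 := fun n => by
    rw [← integral_mollify_pairing (hρ n).continuous (hc n) (bumpSeq n).normed_neg hα
      hZ.toIsBoundedField]
    exact hcl.integral_mollify_eq_zero (hρ n) (hc n) hα hZ
  have hlim : ∀ᵐ x, Tendsto (fun n => mollify (ρ n) Z x) atTop (𝓝 (Z x)) := by
    -- Since `Z` may jump, convergence holds only almost everywhere. It requires a bounded ratio of
    -- the radii, here `rOut = 2 * rIn`.
    refine ContDiffBump.ae_convolution_tendsto_right_of_locallyIntegrable (K := 2)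
      tendsto_bumpSeq (Eventually.of_forall fun n => ?_) hZ.integrable.locallyIntegrable
    have : (0 : ℝ) < (n : ℝ) + 1 := by positivity
    simp only [bumpSeq]
    apply le_of_eq
    field_simp
  obtain ⟨C, hC0, hC⟩ := hZ.bounded
  obtain ⟨R, hR0, hR⟩ := hZ.support
  have hbd : ∀ n x, ‖mollify (ρ n) Z x‖ ≤ C := fun n x => by
    rw [mollify_eq]
    refine (norm_integral_le_of_norm_le (g := fun y => ρ n (x - y) * C) ?_
      (Eventually.of_forall fun y => ?_)).trans ?_
    · exact ((bumpSeq n).integrable_normed.comp_sub_left x).mul_const C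
    · rw [norm_smul, Real.norm_of_nonneg ((bumpSeq n).nonneg_normed _)]
      exact mul_le_mul_of_nonneg_left (hC y) ((bumpSeq n).nonneg_normed _)
    · rw [integral_mul_const, integral_sub_left_eq_self (fun t => ρ n t) volume x,
        (bumpSeq n).integral_normed, one_mul]
  have hsupp : ∀ n x, mollify (ρ n) Z x ≠ 0 → x ∈ Metric.ball (0 : E3) (R + 1) := by
    intro n x hx
    by_contra hxb
    refine hx ?_
    rw [mollify_eq]
    refine integral_eq_zero_of_ae (Eventually.of_forall fun y => ?_)
    by_cases hy : Z y = 0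
    · simp [hy]
    have h0 : ρ n (x - y) = 0 := by
      by_contra h0
      have h1 : x - y ∈ Metric.ball (0 : E3) (bumpSeq n).rOut := by
        rw [← (bumpSeq n).support_normed_eq (μ := volume)]; exact h0
      have h2 := hR y hy
      have h3 : (bumpSeq n).rOut ≤ 1 := by
        simp only [bumpSeq]
        rw [div_le_one (by positivity)]
        have : (0 : ℝ) ≤ n := by positivity
        linarith
      rw [mem_ball_zero_iff] at h1 h2 hxb
      refine hxb ?_
      calc ‖x‖ = ‖y + (x - y)‖ := by rw [add_sub_cancel]
        _ < R + 1 := (norm_add_le _ _).trans_lt (add_lt_add h2 (h1.trans_le h3))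
    simp [h0]
  -- The mollified fields are bounded by `C` and live in the ball of radius `R + 1`, as `rOut ≤ 1`;
  -- so `C ‖α‖` on that ball dominates.
  have hconv : Tendsto (fun n => ∫ x, α x (mollify (ρ n) Z x)) atTop (𝓝 (∫ x, α x (Z x))) := by
    refine tendsto_integral_of_dominated_convergence
      ((Metric.ball (0 : E3) (R + 1)).indicator fun x => ‖α x‖ * C) (fun n => ?_) ?_
      (fun n => Eventually.of_forall fun x => ?_) ?_
    · refine (ContinuousLinearMap.id ℝ (E3 →L[ℝ] ℝ)).aestronglyMeasurable_comp₂
        hα.aestronglyMeasurable ?_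
      have : ContDiff ℝ ((⊤ : ℕ∞) : WithTop ℕ∞) (mollify (ρ n) Z) :=
        (hc n).contDiff_convolution_left _ (hρ n) hZ.integrable.locallyIntegrable
      exact this.continuous.aestronglyMeasurable
    · rw [integrable_indicator_iff Metric.isOpen_ball.measurableSet]
      exact ((hα.integrableOn_isCompact (isCompact_closedBall 0 (R + 1))).mono_set
        Metric.ball_subset_closedBall).norm.mul_const _
    · by_cases hx : mollify (ρ n) Z x = 0
      · rw [hx, map_zero, norm_zero]
        exact indicator_nonneg (fun y _ => by positivity) x
      · rw [indicator_of_mem (hsupp n x hx)]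
        exact (ContinuousLinearMap.le_opNorm _ _).trans (by gcongr; exact hbd n x)
    · filter_upwards [hlim] with x hx
      exact ((α x).continuous.tendsto _).comp hx
  simp_rw [hzero] at hconv
  exact tendsto_nhds_unique hconv tendsto_const_nhds

theorem IsPrimitive.integral_curl {β : E3 → E3 →L[ℝ] ℝ} {Y : E3 → E3} (hβ : IsPrimitive β Y)
    {η : E3 → E3 →L[ℝ] ℝ} (hη : ContDiff ℝ ∞ η) (hc : HasCompactSupport η) :
    ∫ x, β x (curlVec (fderiv ℝ η x)) = ∫ x, η x (Y x) := by
  have := hβ.weak_eq η hη hc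
  simpa only [wedge_extD, wedge_contraction] using this

/-- Two primitives of a field have the same integral against an admissible field. -/
theorem IsPrimitive.integral_pairing_eq {β γ : E3 → E3 →L[ℝ] ℝ} {Y Z : E3 → E3}
    (hβ : IsPrimitive β Y) (hγ : IsPrimitive γ Y) (hZ : IsAdmissible Z) :
    ∫ x, β x (Z x) = ∫ x, γ x (Z x) := by
  have hcl : IsWeaklyClosed (fun x => β x - γ x) := fun η hη hc => by
    have hb := isBoundedField_curl hη hc
    have h1 := hβ.integral_curl hη hc
    have h2 := hγ.integral_curl hη hc
    simp only [sub_apply]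
    rw [integral_sub (hb.integrable_pairing hβ.locallyIntegrable)
      (hb.integrable_pairing hγ.locallyIntegrable), h1, h2, sub_self]
  have h := hcl.integral_eq_zero (hβ.locallyIntegrable.sub hγ.locallyIntegrable) hZ
  simp only [sub_apply] at h
  rw [integral_sub (hZ.integrable_pairing hβ.locallyIntegrable)
    (hZ.integrable_pairing hγ.locallyIntegrable)] at h
  exact sub_eq_zero.1 h

/-! ### Symmetry and bilinearity of relative helicity. -/

/-- The relative helicity of admissible fields, computed with Biot-Savart primitives. -/
def relHelicity (Y Z : E3 → E3) : ℝ := ∫ x, biotSavart Y x (Z x)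

namespace IsAdmissible

variable {Y Z : E3 → E3}

theorem relHelicity_eq (hZ : IsAdmissible Z) (hY : IsAdmissible Y) {β : E3 → E3 →L[ℝ] ℝ}
    (hβ : IsPrimitive β Y) : ∫ x, β x (Z x) = relHelicity Y Z :=
  hβ.integral_pairing_eq hY.isPrimitive_biotSavart hZ

theorem relHelicity_comm (hY : IsAdmissible Y) (hZ : IsAdmissible Z) :
    relHelicity Y Z = relHelicity Z Y :=
  hY.integral_biotSavart_comm hZ.toIsBoundedField

theorem isRelativeHelicity (hY : IsAdmissible Y) (hZ : IsAdmissible Z) :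
    IsRelativeHelicity Y Z (relHelicity Y Z) := by
  refine ⟨⟨_, hY.isPrimitive_biotSavart⟩, ⟨_, hZ.isPrimitive_biotSavart⟩, fun β hβ => ?_,
    fun γ hγ => ?_⟩
  · simp only [wedge_contraction]
    exact ⟨hZ.integrable_pairing hβ.locallyIntegrable, hZ.relHelicity_eq hY hβ⟩
  · simp only [wedge_contraction]
    exact ⟨hY.integrable_pairing hγ.locallyIntegrable,
      (hY.relHelicity_eq hZ hγ).trans (hZ.relHelicity_comm hY)⟩

theorem add (hY : IsAdmissible Y) (hZ : IsAdmissible Z) : IsAdmissible (fun x => Y x + Z x) := by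
  refine ⟨hY.toIsBoundedField.add hZ.toIsBoundedField, fun h hh => ?_⟩
  have hl := (hh.continuous_fderiv (by simp)).locallyIntegrable (μ := volume)
  simp only [map_add]
  rw [integral_add (hY.integrable_pairing hl) (hZ.integrable_pairing hl), hY.div_free h hh,
    hZ.div_free h hh, add_zero]

theorem relHelicity_add_right {W : E3 → E3} (hW : IsAdmissible W) (hY : IsAdmissible Y)
    (hZ : IsAdmissible Z) :
    relHelicity W (fun x => Y x + Z x) = relHelicity W Y + relHelicity W Z := by
  simp only [relHelicity, map_add]
  exact integral_add (hY.integrable_pairing hW.locallyIntegrable_biotSavart)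
    (hZ.integrable_pairing hW.locallyIntegrable_biotSavart)

theorem relHelicity_add_self (hY : IsAdmissible Y) (hZ : IsAdmissible Z) :
    relHelicity (fun x => Y x + Z x) (fun x => Y x + Z x)
      = relHelicity Y Y + 2 * relHelicity Y Z + relHelicity Z Z := by
  have hS := hY.add hZ
  rw [hS.relHelicity_add_right hY hZ, hS.relHelicity_comm hY, hS.relHelicity_comm hZ,
    hY.relHelicity_add_right hY hZ, hZ.relHelicity_add_right hY hZ, hZ.relHelicity_comm hY]
  ring

end IsAdmissible

/-! ### Change of variables along the embedding. -/

/-- Three-space as the product of the plane and the line. -/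
def prodEquiv : E3 ≃L[ℝ] E2 × ℝ :=
  LinearEquiv.toContinuousLinearEquiv
    { toFun := fun v => (!₂[v 0, v 1], v 2)
      invFun := fun p => !₂[p.1 0, p.1 1, p.2]
      map_add' := fun u v => by
        ext i
        · fin_cases i <;> simp
        · simp
      map_smul' := fun c v => by
        ext i
        · fin_cases i <;> simp
        · simp
      left_inv := fun v => by ext i; fin_cases i <;> simp
      right_inv := fun p => by
        ext i
        · fin_cases i <;> simp
        · simp }

theorem prodEquiv_apply (v : E3) : prodEquiv v = (!₂[v 0, v 1], v 2) := rfl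

theorem measurePreserving_prodEquiv : MeasurePreserving prodEquiv volume volume := by
  have h := ((PiLp.volume_preserving_toLp (Fin 2)).prod
    (MeasurePreserving.id (volume : Measure ℝ))).comp (Measure.measurePreserving_swap.comp
      ((volume_preserving_piFinSuccAbove (fun _ : Fin 3 => ℝ) 2).comp
        (PiLp.volume_preserving_ofLp (Fin 3))))
  have e : (prodEquiv : E3 → E2 × ℝ) = Prod.map (WithLp.toLp 2) id ∘ Prod.swap ∘
      (MeasurableEquiv.piFinSuccAbove (fun _ : Fin 3 => ℝ) 2) ∘ WithLp.ofLp := by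
    funext v
    rw [prodEquiv_apply]
    refine Prod.ext ?_ rfl
    ext i
    fin_cases i <;> rfl
  rw [e]
  exact h

theorem det_eq_volumeForm (A : E3 →L[ℝ] E3) :
    A.det = volumeForm (A (e 0)) (A (e 1)) (A (e 2)) := by
  rw [ContinuousLinearMap.det, ← LinearMap.det_toMatrix (EuclideanSpace.basisFun (Fin 3) ℝ).toBasis,
    Matrix.det_fin_three]
  simp [LinearMap.toMatrix_apply, volumeForm_eq, e]
  ring

/-- The disk times a period. -/
abbrev closedDomain : Set (E2 × ℝ) := disk ×ˢ Icc (0 : ℝ) 1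

theorem isCompact_closedDomain : IsCompact closedDomain := isCompact_disk.prod isCompact_Icc

theorem fundamentalDomain_subset_closedDomain : fundamentalDomain ⊆ closedDomain :=
  prod_mono_right Ico_subset_Icc_self

theorem closedDomain_subset_cylinder : closedDomain ⊆ cylinder := prod_mono_right (subset_univ _)

theorem fundamentalDomain_subset_cylinder : fundamentalDomain ⊆ cylinder :=
  prod_mono_right (subset_univ _)

theorem measurableSet_fundamentalDomain : MeasurableSet fundamentalDomain :=
  measurableSet_disk.prod measurableSet_Ico

theorem convex_cylinder : Convex ℝ cylinder := convex_disk.prod convex_univ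

theorem nonempty_interior_cylinder : (interior cylinder).Nonempty := by
  rw [cylinder, interior_prod_eq, interior_univ]
  exact nonempty_interior_disk.prod univ_nonempty

theorem uniqueDiffOn_cylinder : UniqueDiffOn ℝ cylinder :=
  uniqueDiffOn_convex convex_cylinder nonempty_interior_cylinder

/-- The integral over the solid torus, by slices. -/
theorem setIntegral_fundamentalDomain {f : E2 × ℝ → ℝ} (hf : ContinuousOn f closedDomain) :
    ∫ p in fundamentalDomain, f p = ∫ t in (0 : ℝ)..1, ∫ x in disk, f (x, t) := by
  have hi : IntegrableOn f fundamentalDomain :=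
    (hf.integrableOn_compact isCompact_closedDomain).mono_set fundamentalDomain_subset_closedDomain
  rw [intervalIntegral.integral_of_le zero_le_one, ← setIntegral_congr_set Ico_ae_eq_Ioc]
  rw [fundamentalDomain, Measure.volume_eq_prod, IntegrableOn, ← Measure.prod_restrict] at *
  exact integral_prod_symm f hi

section Torus

variable {τ : E2 × ℝ → E3} (hτ : IsTorusEmbedding τ)

/-- The differential of `τ`, applied to a tangent vector. -/
def tangent (τ : E2 × ℝ → E3) (v : E2 × ℝ) (p : E2 × ℝ) : E3 := fderivWithin ℝ τ cylinder p v

include hτ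

theorem contDiffOn_tangent (v : E2 × ℝ) : ContDiffOn ℝ ∞ (tangent τ v) cylinder :=
  contDiffOn_fderivWithin_apply uniqueDiffOn_cylinder hτ.smooth v

theorem hasFDerivWithinAt_embedding {p : E2 × ℝ} (hp : p ∈ cylinder) :
    HasFDerivWithinAt τ (fderivWithin ℝ τ cylinder p) cylinder p :=
  (hτ.smooth.differentiableOn (by simp) p hp).hasFDerivWithinAt

section Pushforward

variable (V : E2 × ℝ → E2 × ℝ)

theorem pushforward_apply {p : E2 × ℝ} (hp : p ∈ fundamentalDomain) :
    pushforward τ V (τ p) = fderivWithin ℝ τ cylinder p (V p) := by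
  have h1 : τ p ∈ τ '' fundamentalDomain := mem_image_of_mem τ hp
  have h2 : Function.invFunOn τ fundamentalDomain (τ p) = p := hτ.injOn.leftInvOn_invFunOn hp
  rw [pushforward, if_pos h1, h2]

omit hτ in
theorem pushforward_of_notMem {q : E3} (hq : q ∉ τ '' fundamentalDomain) :
    pushforward τ V q = 0 := by
  rw [pushforward, if_neg hq]

end Pushforward

variable (hvol : IsVolumePreserving τ)
include hvol

/-- Composition with the volume preserving `prodEquiv` makes the differential an endomorphism of
three-space; its determinant is `τ^* dV = ω ∧ dt` evaluated on the standard basis. -/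
theorem changeOfVariables_aux : MeasurableSet (prodEquiv ⁻¹' fundamentalDomain) ∧
    (∀ x ∈ prodEquiv ⁻¹' fundamentalDomain, HasFDerivWithinAt (τ ∘ prodEquiv)
      ((fderivWithin ℝ τ cylinder (prodEquiv x)).comp (prodEquiv : E3 →L[ℝ] E2 × ℝ))
      (prodEquiv ⁻¹' fundamentalDomain) x) ∧
    InjOn (τ ∘ prodEquiv) (prodEquiv ⁻¹' fundamentalDomain) ∧
    (τ ∘ prodEquiv) '' (prodEquiv ⁻¹' fundamentalDomain) = τ '' fundamentalDomain ∧
    ∀ x ∈ prodEquiv ⁻¹' fundamentalDomain,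
      |((fderivWithin ℝ τ cylinder (prodEquiv x)).comp (prodEquiv : E3 →L[ℝ] E2 × ℝ)).det| = 1 := by
  refine ⟨prodEquiv.continuous.measurable measurableSet_fundamentalDomain, fun x hx => ?_, ?_, ?_,
    fun x hx => ?_⟩
  · exact ((hasFDerivWithinAt_embedding hτ (fundamentalDomain_subset_cylinder hx)).mono
      fundamentalDomain_subset_cylinder).comp x prodEquiv.hasFDerivWithinAt (mapsTo_preimage _ _)
  · exact hτ.injOn.comp prodEquiv.injective.injOn (mapsTo_preimage _ _)
  · rw [image_comp, image_preimage_eq _ prodEquiv.surjective]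
  · rw [det_eq_volumeForm]
    simp only [ContinuousLinearMap.comp_apply, ContinuousLinearEquiv.coe_coe]
    rw [hvol _ (fundamentalDomain_subset_cylinder hx)]
    simp [prodEquiv_apply, torusVolumeForm, areaForm, e]

variable {G : Type} [NormedAddCommGroup G] [NormedSpace ℝ G]

theorem integrableOn_image_iff (h : E3 → G) :
    IntegrableOn h (τ '' fundamentalDomain)
      ↔ IntegrableOn (fun p => h (τ p)) fundamentalDomain := by
  obtain ⟨h1, h2, h3, h4, h5⟩ := changeOfVariables_aux hτ hvol
  rw [← h4, integrableOn_image_iff_integrableOn_abs_det_fderiv_smul volume h1 h2 h3,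
    ← measurePreserving_prodEquiv.integrableOn_comp_preimage
      prodEquiv.toHomeomorph.measurableEmbedding]
  refine integrableOn_congr_fun (fun x hx => ?_) h1
  rw [h5 x hx, one_smul]; rfl

theorem setIntegral_image (h : E3 → G) :
    ∫ q in τ '' fundamentalDomain, h q = ∫ p in fundamentalDomain, h (τ p) := by
  obtain ⟨h1, h2, h3, h4, h5⟩ := changeOfVariables_aux hτ hvol
  rw [← h4, integral_image_eq_integral_abs_det_fderiv_smul volume h1 h2 h3,
    ← measurePreserving_prodEquiv.setIntegral_preimage_emb
      prodEquiv.toHomeomorph.measurableEmbedding]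
  refine setIntegral_congr_fun h1 (fun x hx => ?_)
  simp only
  rw [h5 x hx, one_smul]; rfl

theorem integrable_iff_of_support {h : E3 → G} (h0 : ∀ q, q ∉ τ '' fundamentalDomain → h q = 0) :
    Integrable h ↔ IntegrableOn (fun p => h (τ p)) fundamentalDomain := by
  rw [← integrableOn_image_iff hτ hvol]
  refine (integrableOn_iff_integrable_of_support_subset fun q hq => ?_).symm
  by_contra hq'
  exact hq (h0 q hq')

theorem integral_of_support {h : E3 → G} (h0 : ∀ q, q ∉ τ '' fundamentalDomain → h q = 0) :
    ∫ q, h q = ∫ p in fundamentalDomain, h (τ p) := by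
  rw [← setIntegral_image hτ hvol]
  exact (setIntegral_eq_integral_of_forall_compl_eq_zero h0).symm

/-- The push-forward of a continuous field is bounded. -/
theorem isBoundedField_pushforward {V W : E2 × ℝ → E2 × ℝ} (hVW : EqOn V W fundamentalDomain)
    (hW : ContinuousOn W closedDomain) : IsBoundedField (pushforward τ V) := by
  have hc : ContinuousOn (fun p => fderivWithin ℝ τ cylinder p (W p)) closedDomain :=
    ((hτ.smooth.fderivWithin uniqueDiffOn_cylinder (m := 0) (by simp)).continuousOn.mono
      closedDomain_subset_cylinder).clm_apply hW
  have he : ∀ p ∈ fundamentalDomain, pushforward τ V (τ p) = fderivWithin ℝ τ cylinder p (W p) :=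
    fun p hp => by rw [pushforward_apply hτ V hp, hVW hp]
  refine ⟨?_, ?_, ?_⟩
  -- Measurability is read off from integrability, which transfers from the solid torus, where the
  -- field has a continuous extension to the compact domain.
  · refine ((integrable_iff_of_support hτ hvol fun q hq =>
      pushforward_of_notMem V hq).2 ?_).aestronglyMeasurable
    refine IntegrableOn.congr_fun ?_ (fun p hp => (he p hp).symm) measurableSet_fundamentalDomain
    exact (hc.integrableOn_compact isCompact_closedDomain).mono_set
      fundamentalDomain_subset_closedDomain
  · obtain ⟨C, hC⟩ := isCompact_closedDomain.exists_bound_of_continuousOn hc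
    refine ⟨max C 0, le_max_right _ _, fun q => ?_⟩
    by_cases hq : q ∈ τ '' fundamentalDomain
    · obtain ⟨p, hp, rfl⟩ := hq
      rw [he p hp]
      exact (hC p (fundamentalDomain_subset_closedDomain hp)).trans (le_max_left _ _)
    · rw [pushforward_of_notMem V hq, norm_zero]; exact le_max_right _ _
  · have hK : IsCompact (τ '' closedDomain) := isCompact_closedDomain.image_of_continuousOn
      (hτ.smooth.continuousOn.mono closedDomain_subset_cylinder)
    obtain ⟨R, hR0, hR⟩ := hK.isBounded.subset_ball_lt 0 (0 : E3)
    refine ⟨R, hR0, fun q hq => hR ?_⟩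
    by_contra hq'
    exact hq (pushforward_of_notMem V fun h =>
      hq' (image_mono fundamentalDomain_subset_closedDomain h))

/-- Integration of a one-form against a push-forward. -/
theorem integral_pushforward (V : E2 × ℝ → E2 × ℝ) (β : E3 → E3 →L[ℝ] ℝ) :
    ∫ q, β q (pushforward τ V q)
      = ∫ p in fundamentalDomain, β (τ p) (fderivWithin ℝ τ cylinder p (V p)) := by
  rw [integral_of_support hτ hvol fun q hq => by rw [pushforward_of_notMem V hq, map_zero]]
  exact setIntegral_congr_fun measurableSet_fundamentalDomain fun p hp => by
    simp only [pushforward_apply hτ V hp]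

/-- The integrand is the derivative of `h ∘ τ` along the orbits of `∂/∂t`, which close up after one
period. -/
theorem isAdmissible_verticalField : IsAdmissible (pushforward τ verticalField) := by
  refine ⟨isBoundedField_pushforward hτ hvol (W := fun _ => (0, 1)) (fun _ _ => rfl)
    continuousOn_const, fun h hh => ?_⟩
  rw [integral_pushforward hτ hvol]
  have hs : ContDiffOn ℝ ∞ (fun p => h (τ p)) cylinder := hh.comp_contDiffOn hτ.smooth
  have hder : ∀ p ∈ cylinder, fderivWithin ℝ (fun p => h (τ p)) cylinder p (0, 1)
      = fderiv ℝ h (τ p) (fderivWithin ℝ τ cylinder p (0, 1)) := by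
    intro p hp
    have h1 := (hh.differentiable (by simp) (τ p)).hasFDerivAt.comp_hasFDerivWithinAt p
      (hasFDerivWithinAt_embedding hτ hp)
    have h2 := h1.fderivWithin (uniqueDiffOn_cylinder p hp)
    change fderivWithin ℝ (h ∘ τ) cylinder p (0, 1) = _
    rw [h2]; rfl
  have hc : ContinuousOn (fun p => fderivWithin ℝ (fun p => h (τ p)) cylinder p (0, 1))
      fundamentalDomain := (contDiffOn_fderivWithin_apply uniqueDiffOn_cylinder hs
        (0, 1)).continuousOn.mono fundamentalDomain_subset_cylinder
  have hc' := (contDiffOn_fderivWithin_apply uniqueDiffOn_cylinder hs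
        (0, 1)).continuousOn.mono closedDomain_subset_cylinder
  refine (setIntegral_congr_fun
    (g := fun p => fderivWithin ℝ (fun p => h (τ p)) cylinder p (0, 1))
    measurableSet_fundamentalDomain fun p hp =>
      (hder p (fundamentalDomain_subset_cylinder hp)).symm).trans ?_
  have hi : IntegrableOn (fun p => fderivWithin ℝ (fun p => h (τ p)) cylinder p (0, 1))
      (disk ×ˢ Ico (0 : ℝ) 1) (volume.prod volume) :=
    (hc'.integrableOn_compact isCompact_closedDomain).mono_set fundamentalDomain_subset_closedDomain
  rw [fundamentalDomain, Measure.volume_eq_prod, setIntegral_prod _ hi]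
  refine (setIntegral_congr_fun (g := fun _ => (0 : ℝ)) measurableSet_disk fun x hx => ?_).trans
    (by simp)
  simp only
  rw [setIntegral_congr_set Ico_ae_eq_Ioc, ← intervalIntegral.integral_of_le zero_le_one,
    integral_unitInterval_eq_sub (f := fun t => h (τ (x, t)))]
  · have := hτ.periodic x hx 0
    rw [zero_add] at this
    rw [this, sub_self]
  · intro t ht
    have h1 := (hs.differentiableOn (by simp) (x, t) ⟨hx, mem_univ t⟩).hasFDerivWithinAt
    have h2 : HasDerivWithinAt (fun t : ℝ => (x, t)) ((0 : E2), (1 : ℝ)) (Icc 0 1) t :=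
      (hasDerivWithinAt_const t _ x).prodMk (hasDerivWithinAt_id t _)
    exact h1.comp_hasDerivWithinAt t h2 fun s _ => ⟨hx, mem_univ s⟩
  · exact hc'.comp (f := fun t => (x, t)) (by fun_prop) fun t ht => ⟨hx, ht⟩

end Torus

/-! ### The primitive `F dt` of the horizontal field. -/

/-- The coordinate vector fields of the disk, on the solid torus. -/
def diskVector (i : Fin 2) : E2 × ℝ := (EuclideanSpace.single i 1, 0)

/-- Green's formula on the disk, with a weight that vanishes near the boundary. -/
theorem setIntegral_disk_green {f a b : E2 → ℝ} (hf : ContDiffOn ℝ ∞ f disk)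
    (ha : ContDiffOn ℝ ∞ a disk) (hb : ContDiffOn ℝ ∞ b disk) {δ : ℝ} (hδ : 0 < δ)
    (h0 : ∀ x ∈ disk, 1 - δ ≤ ‖x‖ → f x = 0) (v w : E2) :
    ∫ x in disk, f x * (fderivWithin ℝ b disk x v - fderivWithin ℝ a disk x w)
      = ∫ x in disk, (fderivWithin ℝ f disk x w * a x - fderivWithin ℝ f disk x v * b x) := by
  have hmul : ∀ {g : E2 → ℝ}, ContDiffOn ℝ ∞ g disk → ∀ u, ∀ x ∈ disk,
      fderivWithin ℝ (fun x => f x * g x) disk x u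
        = f x * fderivWithin ℝ g disk x u + g x * fderivWithin ℝ f disk x u := by
    intro g hg u x hx
    rw [fderivWithin_fun_mul (uniqueDiffOn_disk x hx) (hf.differentiableOn (by simp) x hx)
      (hg.differentiableOn (by simp) x hx)]
    simp
  have hz : ∀ {g : E2 → ℝ}, ContDiffOn ℝ ∞ g disk → ∀ u,
      ∫ x in disk, fderivWithin ℝ (fun x => f x * g x) disk x u = 0 := fun hg u =>
    setIntegral_disk_fderivWithin_eq_zero (hf.mul hg) hδ
      (fun x hx hn => by rw [h0 x hx hn, zero_mul]) u
  have hi : ∀ {g : E2 → ℝ}, ContDiffOn ℝ ∞ g disk → ∀ u,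
      IntegrableOn (fun x => fderivWithin ℝ (fun x => f x * g x) disk x u) disk := fun hg u =>
    (contDiffOn_fderivWithin_apply uniqueDiffOn_disk
      (hf.mul hg) u).continuousOn.integrableOn_compact isCompact_disk
  have hc : ∀ {g : E2 → ℝ}, ContDiffOn ℝ ∞ g disk → ∀ u,
      ContinuousOn (fun x => fderivWithin ℝ g disk x u) disk := fun hg u =>
    (contDiffOn_fderivWithin_apply uniqueDiffOn_disk hg u).continuousOn
  have key : ∫ x in disk, (f x * (fderivWithin ℝ b disk x v - fderivWithin ℝ a disk x w)
      - (fderivWithin ℝ f disk x w * a x - fderivWithin ℝ f disk x v * b x)) = 0 := by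
    refine Eq.trans ?_ ((integral_sub (hi hb v) (hi ha w)).trans (by rw [hz hb v, hz ha w, sub_zero]))
    refine setIntegral_congr_fun measurableSet_disk fun x hx => ?_
    rw [hmul hb v x hx, hmul ha w x hx]
    ring
  rw [integral_sub] at key
  · exact sub_eq_zero.1 key
  · exact (hf.continuousOn.mul ((hc hb v).sub (hc ha w))).integrableOn_compact isCompact_disk
  · exact (((hc hf w).mul ha.continuousOn).sub
      ((hc hf v).mul hb.continuousOn)).integrableOn_compact isCompact_disk

/-- The Hamiltonian vector field of a time-dependent function, on the solid torus. -/
def hamiltonianField (F : ℝ → E2 → ℝ) (p : E2 × ℝ) : E2 × ℝ :=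
  dirDeriv F (0, EuclideanSpace.single 1 1) (p.2, p.1) • diskVector 0
    - dirDeriv F (0, EuclideanSpace.single 0 1) (p.2, p.1) • diskVector 1

theorem hamiltonianField_snd (F : ℝ → E2 → ℝ) (p : E2 × ℝ) : (hamiltonianField F p).2 = 0 := by
  simp [hamiltonianField, diskVector]

section Field

variable {φ : ℝ → E2 → E2} {F : ℝ → E2 → ℝ} (hF : IsNormalizedHamiltonian F φ)
include hF

theorem contDiffOn_dirDeriv_comp_swap (w : ℝ × E2) :
    ContDiffOn ℝ ∞ (fun p : E2 × ℝ => dirDeriv F w (p.2, p.1)) closedDomain :=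
  (contDiffOn_dirDeriv hF.smooth w).comp (f := fun p : E2 × ℝ => (p.2, p.1)) (by fun_prop)
    fun _ hp => ⟨hp.2, hp.1⟩

theorem continuousOn_hamiltonian_swap :
    ContinuousOn (fun p : E2 × ℝ => F p.2 p.1) closedDomain :=
  hF.smooth.continuousOn.comp (f := fun p : E2 × ℝ => (p.2, p.1)) (by fun_prop)
    fun _ hp => ⟨hp.2, hp.1⟩

theorem continuousOn_hamiltonianField : ContinuousOn (hamiltonianField F) closedDomain :=
  ((contDiffOn_dirDeriv_comp_swap hF _).continuousOn.smul continuousOn_const).sub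
    ((contDiffOn_dirDeriv_comp_swap hF _).continuousOn.smul continuousOn_const)

/-- Solves `ι_X ω = dF_t` in coordinates. This removes the inverse of `φ_t` and shows that `X`
extends continuously to `t = 1`. -/
theorem horizontalField_eq (hφ : IsAreaPreservingIsotopy φ) :
    EqOn (horizontalField φ) (hamiltonianField F) closedDomain := by
  rintro ⟨x, t⟩ ⟨hx, ht⟩
  have hs : x ∈ φ t '' disk := (hφ.bijOn t ht).surjOn hx
  have h1 := Function.invFunOn_mem hs
  have h2 := Function.invFunOn_eq hs
  have h3 := hF.generates t ht _ h1
  rw [h2] at h3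
  simp only [fderivWithin_space hF.smooth ht hx] at h3
  have h4 := h3 (EuclideanSpace.single 0 1)
  have h5 := h3 (EuclideanSpace.single 1 1)
  simp [areaForm] at h4 h5
  refine Prod.ext ?_ (hamiltonianField_snd F _).symm
  ext i
  fin_cases i <;> simp [horizontalField, hamiltonianField, diskVector, ← h4, ← h5]

end Field

section Primitive

variable {τ : E2 × ℝ → E3}

open Classical in
/-- The push-forward of the one-form `F dt`. -/
def horizontalPrimitive (τ : E2 × ℝ → E3) (F : ℝ → E2 → ℝ) (q : E3) : E3 →L[ℝ] ℝ :=
  if q ∈ τ '' fundamentalDomain then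
    -- Because `τ^* dV = ω ∧ dt`, contracting `dV` with the images of the two coordinate fields of
    -- the disk gives the push-forward of `dt`.
    F (Function.invFunOn τ fundamentalDomain q).2 (Function.invFunOn τ fundamentalDomain q).1 •
      volL (tangent τ (diskVector 0) (Function.invFunOn τ fundamentalDomain q))
        (tangent τ (diskVector 1) (Function.invFunOn τ fundamentalDomain q))
  else 0

theorem horizontalPrimitive_of_notMem (F : ℝ → E2 → ℝ) {q : E3} (hq : q ∉ τ '' fundamentalDomain) :
    horizontalPrimitive τ F q = 0 := by
  rw [horizontalPrimitive, if_neg hq]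

variable (hτ : IsTorusEmbedding τ)
include hτ

theorem horizontalPrimitive_apply (F : ℝ → E2 → ℝ) {p : E2 × ℝ} (hp : p ∈ fundamentalDomain) :
    horizontalPrimitive τ F (τ p) = F p.2 p.1 •
      volL (tangent τ (diskVector 0) p) (tangent τ (diskVector 1) p) := by
  have h1 : τ p ∈ τ '' fundamentalDomain := mem_image_of_mem τ hp
  have h2 : Function.invFunOn τ fundamentalDomain (τ p) = p := hτ.injOn.leftInvOn_invFunOn hp
  rw [horizontalPrimitive, if_pos h1, h2]

section PullBack

variable {η : E3 → E3 →L[ℝ] ℝ} (hη : ContDiff ℝ ∞ η)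
include hη

theorem contDiffOn_pullback (u : E2 × ℝ) :
    ContDiffOn ℝ ∞ (fun p => η (τ p) (tangent τ u p)) cylinder :=
  (hη.comp_contDiffOn hτ.smooth).clm_apply (contDiffOn_tangent hτ u)

theorem fderivWithin_pullback {p : E2 × ℝ} (hp : p ∈ cylinder) (u v : E2 × ℝ) :
    fderivWithin ℝ (fun p => η (τ p) (tangent τ u p)) cylinder p v
      = fderiv ℝ η (τ p) (tangent τ v p) (tangent τ u p)
        + η (τ p) (fderivWithin ℝ (tangent τ u) cylinder p v) := by
  have h1 := (hη.differentiable (by simp) (τ p)).hasFDerivAt.comp_hasFDerivWithinAt p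
    (hasFDerivWithinAt_embedding hτ hp)
  have h2 := ((contDiffOn_tangent hτ u).differentiableOn (by simp) p hp).hasFDerivWithinAt
  have h3 := (h1.clm_apply h2).fderivWithin (uniqueDiffOn_cylinder p hp)
  simp only [Function.comp_def] at h3
  rw [h3]
  simp [tangent, add_comm]

/-- The exterior derivative commutes with pull-back. -/
theorem extD_pullback {p : E2 × ℝ} (hp : p ∈ cylinder) (u v : E2 × ℝ) :
    fderivWithin ℝ (fun p => η (τ p) (tangent τ v p)) cylinder p u
      - fderivWithin ℝ (fun p => η (τ p) (tangent τ u p)) cylinder p v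
      = fderiv ℝ η (τ p) (tangent τ u p) (tangent τ v p)
        - fderiv ℝ η (τ p) (tangent τ v p) (tangent τ u p) := by
  rw [fderivWithin_pullback hτ hη hp, fderivWithin_pullback hτ hη hp]
  have := fderivWithin_fderivWithin_comm convex_cylinder nonempty_interior_cylinder hτ.smooth hp u v
  change fderivWithin ℝ (tangent τ u) cylinder p v = fderivWithin ℝ (tangent τ v) cylinder p u at this
  rw [this]
  ring

end PullBack

variable (hvol : IsVolumePreserving τ) {φ : ℝ → E2 → E2} (hφ : IsAreaPreservingIsotopy φ)
  {F : ℝ → E2 → ℝ} (hF : IsNormalizedHamiltonian F φ)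
include hvol

theorem integral_horizontalPrimitive (Z : E3 → E3) :
    ∫ q, horizontalPrimitive τ F q (Z q) = ∫ p in fundamentalDomain, F p.2 p.1 *
      volL (tangent τ (diskVector 0) p) (tangent τ (diskVector 1) p) (Z (τ p)) := by
  rw [integral_of_support hτ hvol fun q hq => by rw [horizontalPrimitive_of_notMem F hq]; simp]
  refine setIntegral_congr_fun measurableSet_fundamentalDomain fun p hp => ?_
  simp only [horizontalPrimitive_apply hτ F hp]
  simp

include hF

theorem integrable_horizontalPrimitive : Integrable (horizontalPrimitive τ F) := by
  refine (integrable_iff_of_support hτ hvol fun q hq => horizontalPrimitive_of_notMem F hq).2 ?_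
  refine IntegrableOn.congr_fun ?_ (fun p hp => (horizontalPrimitive_apply hτ F hp).symm)
    measurableSet_fundamentalDomain
  refine IntegrableOn.mono_set (ContinuousOn.integrableOn_compact isCompact_closedDomain ?_)
    fundamentalDomain_subset_closedDomain
  have hc := fun i => (contDiffOn_tangent hτ (diskVector i)).continuousOn.mono
    closedDomain_subset_cylinder
  exact (continuousOn_hamiltonian_swap hF).smul
    ((volL.continuous.comp_continuousOn (hc 0)).clm_apply (hc 1))

include hφ

/-- On the solid torus `F dt ∧ d(τ^* η)` sees only derivatives along the disks, so Green's formula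
applies slice by slice. Its boundary term vanishes with `F`, a jump between `t = 1` and `t = 0` is
harmless, and `η` need not have compact support. -/
theorem integral_horizontalPrimitive_curl {η : E3 → E3 →L[ℝ] ℝ} (hη : ContDiff ℝ ∞ η) :
    ∫ q, horizontalPrimitive τ F q (curlVec (fderiv ℝ η q))
      = ∫ q, η q (pushforward τ (horizontalField φ) q) := by
  rw [integral_horizontalPrimitive hτ hvol, integral_pushforward hτ hvol]
  obtain ⟨a, ha⟩ : ∃ a : Fin 2 → E2 × ℝ → ℝ,
    a = fun i p => η (τ p) (tangent τ (diskVector i) p) := ⟨_, rfl⟩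
  have hac : ∀ i, ContDiffOn ℝ ∞ (a i) cylinder := fun i => by
    rw [ha]; exact contDiffOn_pullback hτ hη _
  have hac' : ∀ i, ContinuousOn (a i) closedDomain := fun i =>
    (hac i).continuousOn.mono closedDomain_subset_cylinder
  have hda : ∀ i u, ContinuousOn (fun p => fderivWithin ℝ (a i) cylinder p u) closedDomain :=
    fun i u => (contDiffOn_fderivWithin_apply uniqueDiffOn_cylinder (hac i) u).continuousOn.mono
      closedDomain_subset_cylinder
  have hdF := fun w => (contDiffOn_dirDeriv_comp_swap hF w).continuousOn
  have h1 : ∫ p in fundamentalDomain, F p.2 p.1 *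
      volL (tangent τ (diskVector 0) p) (tangent τ (diskVector 1) p) (curlVec (fderiv ℝ η (τ p)))
      = ∫ p in fundamentalDomain, F p.2 p.1 * (fderivWithin ℝ (a 1) cylinder p (diskVector 0)
        - fderivWithin ℝ (a 0) cylinder p (diskVector 1)) := by
    refine setIntegral_congr_fun measurableSet_fundamentalDomain fun p hp => ?_
    simp only [volL_curlVec, ha]
    rw [extD_pullback hτ hη (fundamentalDomain_subset_cylinder hp)]
  have h2 : ∫ p in fundamentalDomain, η (τ p) (fderivWithin ℝ τ cylinder p (horizontalField φ p))
      = ∫ p in fundamentalDomain, (dirDeriv F (0, EuclideanSpace.single 1 1) (p.2, p.1) * a 0 p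
        - dirDeriv F (0, EuclideanSpace.single 0 1) (p.2, p.1) * a 1 p) := by
    refine setIntegral_congr_fun measurableSet_fundamentalDomain fun p hp => ?_
    simp only [horizontalField_eq hF hφ (fundamentalDomain_subset_closedDomain hp), ha,
      hamiltonianField, tangent, map_sub, map_smul, smul_eq_mul]
  refine h1.trans (Eq.trans ?_ h2.symm)
  refine (setIntegral_fundamentalDomain ((continuousOn_hamiltonian_swap hF).mul
    ((hda _ _).sub (hda _ _)))).trans (Eq.trans ?_ (setIntegral_fundamentalDomain
      (((hdF _).mul (hac' 0)).sub ((hdF _).mul (hac' 1)))).symm)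
  refine intervalIntegral.integral_congr fun t ht => ?_
  rw [uIcc_of_le zero_le_one] at ht
  obtain ⟨δ, hδ, h0⟩ := hF.near_boundary
  have hs : ∀ i, ContDiffOn ℝ ∞ (fun x => a i (x, t)) disk := fun i =>
    (hac i).comp (f := fun x => (x, t)) (by fun_prop) fun x hx => ⟨hx, mem_univ t⟩
  have hd : ∀ i j, ∀ x ∈ disk, fderivWithin ℝ (a i) cylinder (x, t) (diskVector j)
      = fderivWithin ℝ (fun x => a i (x, t)) disk x (EuclideanSpace.single j 1) := by
    intro i j x hx
    have h := hasFDerivWithinAt_slice_left (t := univ) ((hac i).differentiableOn (by simp) (x, t)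
      ⟨hx, mem_univ t⟩) (mem_univ t)
    rw [h.fderivWithin (uniqueDiffOn_disk x hx)]
    simp [diskVector, cylinder]
  have hg := setIntegral_disk_green (contDiffOn_space hF.smooth ht) (hs 0) (hs 1) hδ (h0 t ht)
    (EuclideanSpace.single 0 1) (EuclideanSpace.single 1 1)
  refine (setIntegral_congr_fun measurableSet_disk fun x hx => ?_).trans
    (hg.trans (setIntegral_congr_fun measurableSet_disk fun x hx => ?_))
  · rw [← hd _ _ x hx, ← hd _ _ x hx]; rfl
  · simp only [fderivWithin_space hF.smooth ht hx]; rfl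

/-- The weak equation for `F dt`, applied to `η = dh`, whose curl is zero. -/
theorem isAdmissible_horizontalField : IsAdmissible (pushforward τ (horizontalField φ)) := by
  refine ⟨isBoundedField_pushforward hτ hvol
    ((horizontalField_eq hF hφ).mono fundamentalDomain_subset_closedDomain)
    (continuousOn_hamiltonianField hF), fun h hh => ?_⟩
  rw [← integral_horizontalPrimitive_curl hτ hvol hφ hF (hh.fderiv_right (by simp))]
  have h0 : ∀ q, curlVec (fderiv ℝ (fderiv ℝ h) q) = 0 := fun q => by
    have hsym := (hh.contDiffAt (x := q)).isSymmSndFDerivAt (by simpa using ENat.LEInfty.out)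
    have : ∀ u v, fderiv ℝ (fderiv ℝ h) q u v = fderiv ℝ (fderiv ℝ h) q v u := fun u v =>
      hsym.eq u v
    simp [curlVec, this (e 1) (e 2), this (e 2) (e 0), this (e 0) (e 1)]
  simp [h0]

theorem isPrimitive_horizontalPrimitive :
    IsPrimitive (horizontalPrimitive τ F) (pushforward τ (horizontalField φ)) := by
  refine ⟨(isAdmissible_horizontalField hτ hvol hφ hF).integrable.locallyIntegrable,
    (integrable_horizontalPrimitive hτ hvol hF).locallyIntegrable, fun η hη _ => ?_⟩
  simp only [wedge_extD, wedge_contraction]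
  exact integral_horizontalPrimitive_curl hτ hvol hφ hF hη

/-- `X` is tangent to the disks `t = const`, so the primitive `F dt` vanishes on it. -/
theorem relHelicity_horizontalField_self :
    relHelicity (pushforward τ (horizontalField φ)) (pushforward τ (horizontalField φ)) = 0 := by
  have hX := isAdmissible_horizontalField hτ hvol hφ hF
  rw [← hX.relHelicity_eq hX (isPrimitive_horizontalPrimitive hτ hvol hφ hF),
    integral_horizontalPrimitive hτ hvol]
  refine (setIntegral_congr_fun (g := fun _ => (0 : ℝ)) measurableSet_fundamentalDomain
    fun p hp => ?_).trans (by simp)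
  simp only [pushforward_apply hτ _ hp, volL_apply, tangent,
    horizontalField_eq hF hφ (fundamentalDomain_subset_closedDomain hp),
    hvol p (fundamentalDomain_subset_cylinder hp)]
  simp [torusVolumeForm, hamiltonianField_snd, diskVector]

/-- `F dt` evaluated on `∂/∂t` is `F`, and `τ` preserves volume. -/
theorem relHelicity_horizontalField_verticalField :
    relHelicity (pushforward τ (horizontalField φ)) (pushforward τ verticalField)
      = ∫ t in (0 : ℝ)..1, ∫ x in disk, F t x := by
  have hX := isAdmissible_horizontalField hτ hvol hφ hF
  have hT := isAdmissible_verticalField hτ hvol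
  rw [← hT.relHelicity_eq hX (isPrimitive_horizontalPrimitive hτ hvol hφ hF),
    integral_horizontalPrimitive hτ hvol,
    ← setIntegral_fundamentalDomain (f := fun p => F p.2 p.1) (continuousOn_hamiltonian_swap hF)]
  refine setIntegral_congr_fun measurableSet_fundamentalDomain fun p hp => ?_
  simp only [pushforward_apply hτ _ hp, volL_apply, tangent,
    hvol p (fundamentalDomain_subset_cylinder hp)]
  simp [torusVolumeForm, verticalField, diskVector, areaForm]

omit hτ hvol hφ hF in
theorem pushforward_suspensionField (τ : E2 × ℝ → E3) (φ : ℝ → E2 → E2) :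
    pushforward τ (suspensionField φ)
      = fun q => pushforward τ (horizontalField φ) q + pushforward τ verticalField q := by
  funext q
  by_cases hq : q ∈ τ '' fundamentalDomain
  · simp only [pushforward, if_pos hq, suspensionField, map_add]
  · simp only [pushforward, if_neg hq, add_zero]

end Primitive

/-! ### The solid angle form and the linking of orbits. -/

section Kernel

theorem contDiffAt_newtonKernel {z : E3} (hz : z ≠ 0) : ContDiffAt ℝ ∞ newtonKernel z := by
  have hn : 4 * Real.pi * ‖z‖ ^ 3 ≠ 0 := by
    have := norm_pos_iff.2 hz
    have := Real.pi_pos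
    positivity
  exact ((contDiffAt_const.mul ((contDiffAt_norm ℝ hz).pow 3)).inv hn).smul contDiffAt_id

/-- The kernel is divergence-free away from the origin. -/
theorem volL_fderiv_newtonKernel {z : E3} (hz : z ≠ 0) (a b c : E3) :
    volL (fderiv ℝ newtonKernel z a) b c + volL a (fderiv ℝ newtonKernel z b) c
      + volL a b (fderiv ℝ newtonKernel z c) = 0 := by
  have hp := Real.pi_pos
  have hz' := norm_pos_iff.2 hz
  have hnn : ‖z‖ ^ 2 ≠ 0 := by positivity
  have hn : 4 * Real.pi * ‖z‖ ^ 3 ≠ 0 := by positivity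
  have h1 : HasFDerivAt (fun z : E3 => ‖z‖) ((‖z‖)⁻¹ • innerSL ℝ z) z := by
    have h := ((hasStrictFDerivAt_norm_sq z).hasFDerivAt).sqrt hnn
    simp only [Real.sqrt_sq (norm_nonneg _)] at h
    refine h.congr_fderiv ?_
    ext v
    simp
    field_simp
  have h2 := ((hasDerivAt_inv hn).comp_hasFDerivAt z
    ((h1.pow 3).const_mul (4 * Real.pi))).smul (hasFDerivAt_id z)
  have h3 : ∀ v, fderiv ℝ newtonKernel z v = (4 * Real.pi * ‖z‖ ^ 3)⁻¹ • v
      + (-3 * (4 * Real.pi * ‖z‖ ^ 5)⁻¹ * (z 0 * v 0 + z 1 * v 1 + z 2 * v 2)) • z := by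
    intro v
    have h4 : fderiv ℝ newtonKernel z = _ := h2.fderiv
    rw [h4]
    simp [PiLp.inner_apply, Fin.sum_univ_three]
    congr 1
    field_simp
  have hs : ‖z‖ ^ 2 = z 0 * z 0 + z 1 * z 1 + z 2 * z 2 := by
    rw [EuclideanSpace.norm_sq_eq, Fin.sum_univ_three]; simp [sq]
  -- With the common factor `‖z‖ ^ (-5)` the claim, that the differential of the kernel has trace
  -- zero, becomes a polynomial identity.
  have h5 : (4 * Real.pi * ‖z‖ ^ 3)⁻¹
      = (4 * Real.pi * ‖z‖ ^ 5)⁻¹ * (z 0 * z 0 + z 1 * z 1 + z 2 * z 2) := by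
    rw [← hs]; field_simp
  simp only [h3, h5, volL_apply, volumeForm_eq, PiLp.add_apply, PiLp.smul_apply, smul_eq_mul]
  ring

end Kernel

theorem fderivWithin_volL {A : Type} [NormedAddCommGroup A] [NormedSpace ℝ A] {s : Set A}
    {k a b : A → E3} {k' a' b' : A →L[ℝ] E3} {x : A} (hk : HasFDerivWithinAt k k' s x)
    (ha : HasFDerivWithinAt a a' s x) (hb : HasFDerivWithinAt b b' s x)
    (hs : UniqueDiffWithinAt ℝ s x) (v : A) :
    fderivWithin ℝ (fun p => volL (k p) (a p) (b p)) s x v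
      = volL (k' v) (a x) (b x) + volL (k x) (a' v) (b x) + volL (k x) (a x) (b' v) := by
  have h := ((volL.hasFDerivAt.comp_hasFDerivWithinAt x hk).clm_apply ha).clm_apply hb
  simp only [Function.comp_def] at h
  rw [h.fderivWithin hs]
  simp
  ring

/-- The parameter domain of a homotopy of doubly periodic maps. -/
abbrev slab : Set (ℝ × ℝ × ℝ) := Icc (0 : ℝ) 1 ×ˢ univ

/-- The measure of a period. -/
abbrev periodMeasure : Measure ℝ := volume.restrict (Ico 0 1)

theorem convex_slab : Convex ℝ slab := (convex_Icc 0 1).prod convex_univ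

theorem nonempty_interior_slab : (interior slab).Nonempty := by
  rw [interior_prod_eq, interior_univ, interior_Icc]
  exact (nonempty_Ioo.2 zero_lt_one).prod univ_nonempty

theorem uniqueDiffOn_slab : UniqueDiffOn ℝ slab :=
  uniqueDiffOn_convex convex_slab nonempty_interior_slab

theorem integral_periodMeasure_eq_sub {f f' : ℝ → ℝ}
    (h : ∀ t ∈ Icc (0 : ℝ) 1, HasDerivWithinAt f (f' t) (Icc 0 1) t)
    (hc : ContinuousOn f' (Icc 0 1)) : ∫ t, f' t ∂periodMeasure = f 1 - f 0 := by
  rw [setIntegral_congr_set Ico_ae_eq_Ioc, ← intervalIntegral.integral_of_le zero_le_one,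
    integral_unitInterval_eq_sub h hc]

theorem integrable_prod_periodMeasure {f : ℝ × ℝ → ℝ}
    (hf : ContinuousOn f (Icc (0 : ℝ) 1 ×ˢ Icc (0 : ℝ) 1)) :
    Integrable f (periodMeasure.prod periodMeasure) := by
  rw [Measure.prod_restrict]
  exact (hf.integrableOn_compact (isCompact_Icc.prod isCompact_Icc)).mono_set
    (prod_mono Ico_subset_Icc_self Ico_subset_Icc_self)

theorem integrable_prod_prod_periodMeasure {f : ℝ × ℝ × ℝ → ℝ} (hf : ContinuousOn f slab) :
    Integrable f (periodMeasure.prod (periodMeasure.prod periodMeasure)) := by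
  rw [Measure.prod_restrict, Measure.prod_restrict]
  refine ((hf.mono (prod_mono_right (subset_univ _))).integrableOn_compact (isCompact_Icc.prod
    (isCompact_Icc.prod isCompact_Icc))).mono_set
    (prod_mono Ico_subset_Icc_self (prod_mono Ico_subset_Icc_self Ico_subset_Icc_self))

section Integrals

variable {f : ℝ × ℝ × ℝ → ℝ} (hf : ContDiffOn ℝ ∞ f slab)
include hf

theorem continuousOn_fderivWithin_slab (w : ℝ × ℝ × ℝ) :
    ContinuousOn (fun p => fderivWithin ℝ f slab p w) slab :=
  (contDiffOn_fderivWithin_apply uniqueDiffOn_slab hf w).continuousOn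

theorem hasDerivWithinAt_slab {c : ℝ → ℝ × ℝ × ℝ} {w : ℝ × ℝ × ℝ} {S : Set ℝ} {t : ℝ}
    (hc : HasDerivWithinAt c w S t) (hm : MapsTo c S slab) (ht : t ∈ S) :
    HasDerivWithinAt (fun t => f (c t)) (fderivWithin ℝ f slab (c t) w) S t :=
  ((hf.differentiableOn (by simp) (c t) (hm ht)).hasFDerivWithinAt).comp_hasDerivWithinAt t hc hm

theorem integral_fderivWithin_slab_fst :
    ∫ p, fderivWithin ℝ f slab p (1, 0, 0) ∂(periodMeasure.prod (periodMeasure.prod periodMeasure))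
      = ∫ q, (f (1, q) - f (0, q)) ∂(periodMeasure.prod periodMeasure) := by
  have hc := continuousOn_fderivWithin_slab hf (1, 0, 0)
  rw [integral_prod_symm _ (integrable_prod_prod_periodMeasure hc)]
  refine integral_congr_ae (Eventually.of_forall fun q => ?_)
  refine integral_periodMeasure_eq_sub (f := fun s => f (s, q)) (fun s hs => ?_) ?_
  · exact hasDerivWithinAt_slab hf (c := fun s => (s, q))
      ((hasDerivWithinAt_id s _).prodMk (hasDerivWithinAt_const s _ q))
      (fun s hs => ⟨hs, mem_univ _⟩) hs
  · exact hc.comp (f := fun s => (s, q)) (by fun_prop) fun s hs => ⟨hs, mem_univ _⟩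

theorem integral_fderivWithin_slab_snd (hper : ∀ s ∈ Icc (0 : ℝ) 1, ∀ u, f (s, 1, u) = f (s, 0, u)) :
    ∫ p, fderivWithin ℝ f slab p (0, 1, 0) ∂(periodMeasure.prod (periodMeasure.prod periodMeasure))
      = 0 := by
  have hc := continuousOn_fderivWithin_slab hf (0, 1, 0)
  rw [integral_prod _ (integrable_prod_prod_periodMeasure hc)]
  refine (setIntegral_congr_fun (g := fun _ => (0 : ℝ)) measurableSet_Ico fun s hs => ?_).trans
    (by simp)
  have hs' := Ico_subset_Icc_self hs
  have hc' : ContinuousOn (fun q : ℝ × ℝ => fderivWithin ℝ f slab (s, q) (0, 1, 0)) univ :=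
    hc.comp (f := fun q => (s, q)) (by fun_prop) fun q _ => ⟨hs', mem_univ q⟩
  beta_reduce
  rw [integral_prod_symm _ (integrable_prod_periodMeasure (hc'.mono (subset_univ _)))]
  refine (integral_congr_ae (Eventually.of_forall fun u => ?_)).trans (integral_zero _ _)
  refine (integral_periodMeasure_eq_sub (f := fun t => f (s, t, u)) (fun t ht => ?_) ?_).trans
    (by rw [hper s hs', sub_self])
  · exact hasDerivWithinAt_slab hf (c := fun t => (s, t, u)) ((hasDerivWithinAt_const t _ s).prodMk
      ((hasDerivWithinAt_id t _).prodMk (hasDerivWithinAt_const t _ u)))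
      (fun t _ => ⟨hs', mem_univ _⟩) ht
  · exact hc.comp (f := fun t => (s, t, u)) (by fun_prop) fun t _ => ⟨hs', mem_univ _⟩

theorem integral_fderivWithin_slab_trd (hper : ∀ s ∈ Icc (0 : ℝ) 1, ∀ t, f (s, t, 1) = f (s, t, 0)) :
    ∫ p, fderivWithin ℝ f slab p (0, 0, 1) ∂(periodMeasure.prod (periodMeasure.prod periodMeasure))
      = 0 := by
  have hc := continuousOn_fderivWithin_slab hf (0, 0, 1)
  rw [integral_prod _ (integrable_prod_prod_periodMeasure hc)]
  refine (setIntegral_congr_fun (g := fun _ => (0 : ℝ)) measurableSet_Ico fun s hs => ?_).trans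
    (by simp)
  have hs' := Ico_subset_Icc_self hs
  have hc' : ContinuousOn (fun q : ℝ × ℝ => fderivWithin ℝ f slab (s, q) (0, 0, 1)) univ :=
    hc.comp (f := fun q => (s, q)) (by fun_prop) fun q _ => ⟨hs', mem_univ q⟩
  beta_reduce
  rw [integral_prod _ (integrable_prod_periodMeasure (hc'.mono (subset_univ _)))]
  refine (integral_congr_ae (Eventually.of_forall fun t => ?_)).trans (integral_zero _ _)
  refine (integral_periodMeasure_eq_sub (f := fun u => f (s, t, u)) (fun u hu => ?_) ?_).trans
    (by rw [hper s hs', sub_self])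
  · exact hasDerivWithinAt_slab hf (c := fun u => (s, t, u)) ((hasDerivWithinAt_const u _ s).prodMk
      ((hasDerivWithinAt_const u _ t).prodMk (hasDerivWithinAt_id u _)))
      (fun t _ => ⟨hs', mem_univ _⟩) hu
  · exact hc.comp (f := fun u => (s, t, u)) (by fun_prop) fun t _ => ⟨hs', mem_univ _⟩

end Integrals

/-- The pull-back of the solid angle form by `z`, evaluated on two vectors. -/
def solidAngle (z : ℝ × ℝ × ℝ → E3) (v w p : ℝ × ℝ × ℝ) : ℝ :=
  volL (newtonKernel (z p)) (fderivWithin ℝ z slab p v) (fderivWithin ℝ z slab p w)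

section SolidAngle

variable {z : ℝ × ℝ × ℝ → E3} (hz : ContDiffOn ℝ ∞ z slab) (h0 : ∀ p ∈ slab, z p ≠ 0)

open scoped Pointwise in
theorem fderivWithin_slab_add {a : ℝ × ℝ} (hper : ∀ p ∈ slab, z (p + (0, a)) = z p)
    {p : ℝ × ℝ × ℝ} (hp : p ∈ slab) :
    fderivWithin ℝ z slab (p + (0, a)) = fderivWithin ℝ z slab p := by
  have hset : ((0, a) : ℝ × ℝ × ℝ) +ᵥ slab = slab := by
    ext ⟨s, q⟩
    simp [mem_vadd_set_iff_neg_vadd_mem]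
  have h := fderivWithin_comp_add_right (𝕜 := ℝ) (f := z) (s := slab) (x := p) (0, a)
  rw [hset] at h
  rw [← h]
  exact fderivWithin_congr hper (hper p hp)

theorem solidAngle_add {a : ℝ × ℝ} (hper : ∀ p ∈ slab, z (p + (0, a)) = z p)
    {p : ℝ × ℝ × ℝ} (hp : p ∈ slab) (v w : ℝ × ℝ × ℝ) :
    solidAngle z v w (p + (0, a)) = solidAngle z v w p := by
  rw [solidAngle, fderivWithin_slab_add hper hp, hper p hp, solidAngle]

include hz h0

theorem contDiffOn_solidAngle (v w : ℝ × ℝ × ℝ) : ContDiffOn ℝ ∞ (solidAngle z v w) slab := by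
  have hk : ContDiffOn ℝ ∞ (fun p => newtonKernel (z p)) slab := fun p hp =>
    (contDiffAt_newtonKernel (h0 p hp)).comp_contDiffWithinAt p (hz p hp)
  exact ((volL.contDiff.comp_contDiffOn hk).clm_apply
    (contDiffOn_fderivWithin_apply uniqueDiffOn_slab hz v)).clm_apply
    (contDiffOn_fderivWithin_apply uniqueDiffOn_slab hz w)

/-- The pull-back of the solid angle form is closed. -/
theorem solidAngle_closed {p : ℝ × ℝ × ℝ} (hp : p ∈ slab) (u v w : ℝ × ℝ × ℝ) :
    fderivWithin ℝ (solidAngle z v w) slab p u - fderivWithin ℝ (solidAngle z u w) slab p v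
      + fderivWithin ℝ (solidAngle z u v) slab p w = 0 := by
  have hk := ((contDiffAt_newtonKernel (h0 p hp)).differentiableAt
    (by simp)).hasFDerivAt.comp_hasFDerivWithinAt p
    (hz.differentiableOn (by simp) p hp).hasFDerivWithinAt
  have hd := fun u => ((contDiffOn_fderivWithin_apply uniqueDiffOn_slab hz u).differentiableOn
    (by simp) p hp).hasFDerivWithinAt
  have hud := uniqueDiffOn_slab p hp
  have key := fun v w u => fderivWithin_volL hk (hd v) (hd w) hud u
  have hcomm := fun u v => fderivWithin_fderivWithin_comm convex_slab nonempty_interior_slab hz hp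
    u v
  have e1 := key v w u
  have e2 := key u w v
  have e3 := key u v w
  rw [hcomm u v, hcomm u w] at *
  -- The second derivatives of `z` cancel by symmetry; what is left is the divergence of the kernel,
  -- which is zero as `z p ≠ 0`.
  have htr := volL_fderiv_newtonKernel (h0 p hp) (fderivWithin ℝ z slab p u)
    (fderivWithin ℝ z slab p v) (fderivWithin ℝ z slab p w)
  change fderivWithin ℝ (solidAngle z v w) slab p u = _ at e1
  change fderivWithin ℝ (solidAngle z u w) slab p v = _ at e2
  change fderivWithin ℝ (solidAngle z u v) slab p w = _ at e3
  rw [e1, e2, e3, hcomm v w, ← htr]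
  simp only [ContinuousLinearMap.comp_apply, volL_apply, volumeForm_eq, Function.comp_apply]
  ring

/-- The Gauss integral of a nowhere vanishing doubly periodic map is homotopy invariant. -/
theorem integral_solidAngle_eq (hper₁ : ∀ p ∈ slab, z (p + (0, 1, 0)) = z p)
    (hper₂ : ∀ p ∈ slab, z (p + (0, 0, 1)) = z p) :
    ∫ q, solidAngle z (0, 1, 0) (0, 0, 1) (1, q) ∂(periodMeasure.prod periodMeasure)
      = ∫ q, solidAngle z (0, 1, 0) (0, 0, 1) (0, q) ∂(periodMeasure.prod periodMeasure) := by
  have hs := contDiffOn_solidAngle hz h0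
  have i1 := integrable_prod_prod_periodMeasure
    (continuousOn_fderivWithin_slab (hs (0, 1, 0) (0, 0, 1)) (1, 0, 0))
  have i2 := integrable_prod_prod_periodMeasure
    (continuousOn_fderivWithin_slab (hs (1, 0, 0) (0, 0, 1)) (0, 1, 0))
  have i3 := integrable_prod_prod_periodMeasure
    (continuousOn_fderivWithin_slab (hs (1, 0, 0) (0, 1, 0)) (0, 0, 1))
  have e1 := integral_fderivWithin_slab_fst (hs (0, 1, 0) (0, 0, 1))
  have e2 := integral_fderivWithin_slab_snd (hs (1, 0, 0) (0, 0, 1)) fun s hs u => by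
    simpa using solidAngle_add hper₁ (p := (s, 0, u)) ⟨hs, mem_univ _⟩ _ _
  have e3 := integral_fderivWithin_slab_trd (hs (1, 0, 0) (0, 1, 0)) fun s hs t => by
    simpa using solidAngle_add hper₂ (p := (s, t, 0)) ⟨hs, mem_univ _⟩ _ _
  have hc : ∀ s ∈ Icc (0 : ℝ) 1, Integrable (fun q => solidAngle z (0, 1, 0) (0, 0, 1) (s, q))
      (periodMeasure.prod periodMeasure) := fun s hs' => integrable_prod_periodMeasure
    ((hs (0, 1, 0) (0, 0, 1)).continuousOn.comp (f := fun q => (s, q)) (by fun_prop)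
      fun q _ => ⟨hs', mem_univ q⟩)
  rw [integral_sub (hc 1 (by simp)) (hc 0 (by simp))] at e1
  have hae : ∀ᵐ p ∂(periodMeasure.prod (periodMeasure.prod periodMeasure)), p ∈ slab := by
    rw [Measure.prod_restrict, Measure.prod_restrict]
    filter_upwards [ae_restrict_mem (measurableSet_Ico.prod
      (measurableSet_Ico.prod measurableSet_Ico))] with p hp
    exact ⟨Ico_subset_Icc_self hp.1, mem_univ _⟩
  -- Stokes on the unit cube: opposite faces in the two periodic directions cancel, leaving the
  -- faces `s = 0` and `s = 1`.
  have hsum := integral_congr_ae (hae.mono fun p hp =>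
    solidAngle_closed hz h0 hp (1, 0, 0) (0, 1, 0) (0, 0, 1))
  have e4 := integral_add (i1.sub i2) i3
  simp only [Pi.sub_apply] at e4
  rw [e4, integral_sub i1 i2, e1, e2, e3, integral_zero] at hsum
  linarith

end SolidAngle

section StandardTorus

theorem hasDerivAt_standardTorus (A B : ℝ) (x : E2) (t : ℝ) :
    HasDerivAt (fun t => standardTorus A B (x, t))
      ((2 * Real.pi * (A + B * x 0)) • (Real.cos (2 * Real.pi * t) • e 2
        - Real.sin (2 * Real.pi * t) • e 0)) t := by
  have h0 : HasDerivAt (fun t : ℝ => 2 * Real.pi * t) (2 * Real.pi) t := by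
    simpa using (hasDerivAt_id t).const_mul (2 * Real.pi)
  have h1 := ((h0.cos.const_mul (A + B * x 0)).smul_const (e 0)).add
    (((hasDerivAt_const t (B * x 1)).smul_const (e 1)).add
      ((h0.sin.const_mul (A + B * x 0)).smul_const (e 2)))
  refine (h1.congr_of_eventuallyEq (Eventually.of_forall fun t => ?_)).congr_deriv ?_
  · ext i; fin_cases i <;> simp [standardTorus, e]
  · ext i; fin_cases i <;> simp [e] <;> ring

end StandardTorus

/-- The partial derivatives of a difference of two curves. -/
theorem fderivWithin_slab_of_slice {z : ℝ × ℝ × ℝ → E3} {α β : ℝ → E3} {s t u : ℝ} {α' β' : E3}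
    (hz : ContDiffOn ℝ ∞ z slab) (hs : s ∈ Icc (0 : ℝ) 1) (h : ∀ t u, z (s, t, u) = α t - β u)
    (hα : HasDerivAt α α' t) (hβ : HasDerivAt β β' u) :
    fderivWithin ℝ z slab (s, t, u) (0, 1, 0) = α' ∧
      fderivWithin ℝ z slab (s, t, u) (0, 0, 1) = -β' := by
  have hd := hz.differentiableOn (by simp) (s, t, u) ⟨hs, mem_univ _⟩
  have he : (fun q : ℝ × ℝ => z (s, q)) = fun q => α q.1 - β q.2 := funext fun q => h q.1 q.2
  have h1 := (HasFDerivAt.comp (g := α) (f := Prod.fst) (t, u) hα.hasFDerivAt hasFDerivAt_fst).fun_sub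
    (HasFDerivAt.comp (g := β) (f := Prod.snd) (t, u) hβ.hasFDerivAt hasFDerivAt_snd)
  have h2 : ∀ v : ℝ × ℝ, fderivWithin ℝ z slab (s, t, u) (0, v) = v.1 • α' - v.2 • β' := fun v => by
    rw [← fderivWithin_slice_right hd hs uniqueDiffWithinAt_univ v, he, fderivWithin_univ]
    exact (congrArg (fun L : ℝ × ℝ →L[ℝ] E3 => L v) h1.fderiv).trans (by simp)
  exact ⟨by rw [h2]; simp, by rw [h2]; simp⟩

theorem IsTorusEmbedding.map_fract {τ : E2 × ℝ → E3} (hτ : IsTorusEmbedding τ) {x : E2}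
    (hx : x ∈ disk) (t : ℝ) : τ (x, Int.fract t) = τ (x, t) := by
  have h : Function.Periodic (fun t => τ (x, t)) 1 := hτ.periodic x hx
  have h2 := h.sub_int_mul_eq ⌊t⌋ (x := t)
  rw [mul_one] at h2
  exact h2

/-- Reducing both times modulo one brings the points into the fundamental domain, where the
embedding is injective. This keeps the difference of two orbits away from the singularity of the
kernel. -/
theorem IsTorusEmbedding.sub_ne_zero {τ : E2 × ℝ → E3} (hτ : IsTorusEmbedding τ) {x y : E2}
    (hx : x ∈ disk) (hy : y ∈ disk) (hxy : x ≠ y) (t u : ℝ) : τ (x, t) - τ (y, u) ≠ 0 := by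
  intro h
  have h1 : τ (x, Int.fract t) = τ (y, Int.fract u) := by
    rw [hτ.map_fract hx, hτ.map_fract hy, sub_eq_zero.1 h]
  have hxt : (x, Int.fract t) ∈ fundamentalDomain := ⟨hx, Int.fract_nonneg t, Int.fract_lt_one t⟩
  have hyu : (y, Int.fract u) ∈ fundamentalDomain := ⟨hy, Int.fract_nonneg u, Int.fract_lt_one u⟩
  exact hxy (congrArg Prod.fst (hτ.injOn hxt hyu h1))

theorem hasDerivAt_embedding {τ : E2 × ℝ → E3} (hτ : IsTorusEmbedding τ) {x : E2}
    (hx : x ∈ disk) (t : ℝ) : HasDerivAt (fun t => τ (x, t)) (tangent τ (0, 1) (x, t)) t := by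
  have hp : (x, t) ∈ cylinder := ⟨hx, mem_univ t⟩
  have h2 : HasDerivWithinAt (fun t : ℝ => (x, t)) ((0 : E2), (1 : ℝ)) univ t :=
    (hasDerivWithinAt_const t _ x).prodMk (hasDerivWithinAt_id t _)
  exact hasDerivWithinAt_univ.1 ((hasFDerivWithinAt_embedding hτ hp).comp_hasDerivWithinAt t h2
    fun s _ => ⟨hx, mem_univ s⟩)

/-- The integrand of the Gauss linking integral of two orbits of `∂/∂t`. -/
def gaussIntegrand (τ : E2 × ℝ → E3) (p p' : E2 × ℝ) : ℝ :=
  volL (tangent τ (0, 1) p') (newtonKernel (τ p - τ p')) (tangent τ (0, 1) p)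

section Linking

variable {A B : ℝ} {x y : E2} {z : ℝ × ℝ × ℝ → E3} (hz : ContDiffOn ℝ ∞ z slab)
include hz

/-- Two parallels of the standard torus are unlinked. -/
theorem integral_solidAngle_standardTorus
    (h : ∀ t u, z (0, t, u) = standardTorus A B (x, t) - standardTorus A B (y, u)) :
    ∫ q, solidAngle z (0, 1, 0) (0, 0, 1) (0, q) ∂(periodMeasure.prod periodMeasure) = 0 := by
  -- The reflection in a plane through the axis that interchanges the angles of the two points
  -- preserves both circles. It reverses orientation in space and the direction of both tangents, so
  -- the integrand changes sign.
  have hswap : ∀ q : ℝ × ℝ, solidAngle z (0, 1, 0) (0, 0, 1) (0, q.swap)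
      = -solidAngle z (0, 1, 0) (0, 0, 1) (0, q) := by
    rintro ⟨t, u⟩
    have hd := fun t u => fderivWithin_slab_of_slice hz (by simp : (0 : ℝ) ∈ Icc (0 : ℝ) 1) h
      (hasDerivAt_standardTorus A B x t) (hasDerivAt_standardTorus A B y u)
    have ht := Real.sin_sq_add_cos_sq (2 * Real.pi * t)
    have hu := Real.sin_sq_add_cos_sq (2 * Real.pi * u)
    have hn : ‖z (0, u, t)‖ = ‖z (0, t, u)‖ := by
      rw [← sq_eq_sq₀ (norm_nonneg _) (norm_nonneg _), h, h, EuclideanSpace.norm_sq_eq,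
        EuclideanSpace.norm_sq_eq, Fin.sum_univ_three, Fin.sum_univ_three]
      simp [standardTorus]
      linear_combination ((A + B * x 0) ^ 2 - (A + B * y 0) ^ 2) * (hu - ht)
    simp only [solidAngle, Prod.swap_prod_mk, (hd _ _).1, (hd _ _).2, newtonKernel, hn]
    generalize (4 * Real.pi * ‖z (0, t, u)‖ ^ 3)⁻¹ = c
    simp [h, volumeForm_eq, standardTorus, e]
    ring
  have h1 := integral_prod_swap (μ := periodMeasure) (ν := periodMeasure)
    (fun q => solidAngle z (0, 1, 0) (0, 0, 1) (0, q))
  simp only [hswap, integral_neg] at h1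
  linarith

/-- The sign comes from the second curve entering `z` with a minus; the permutation of the arguments
of `dV` is cyclic. -/
theorem integral_gaussIntegrand_eq {τ : E2 × ℝ → E3} (hτ : IsTorusEmbedding τ) (hx : x ∈ disk)
    (hy : y ∈ disk) (h : ∀ t u, z (1, t, u) = τ (x, t) - τ (y, u)) :
    ∫ q : ℝ × ℝ, gaussIntegrand τ (x, q.1) (y, q.2) ∂(periodMeasure.prod periodMeasure)
      = -∫ q, solidAngle z (0, 1, 0) (0, 0, 1) (1, q) ∂(periodMeasure.prod periodMeasure) := by
  rw [← integral_neg]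
  refine integral_congr_ae (Eventually.of_forall fun ⟨t, u⟩ => ?_)
  have hd := fderivWithin_slab_of_slice hz (by simp : (1 : ℝ) ∈ Icc (0 : ℝ) 1) h
      (hasDerivAt_embedding hτ hx t) (hasDerivAt_embedding hτ hy u)
  simp only [gaussIntegrand, solidAngle, hd.1, hd.2, h, volL_apply, volumeForm_eq, PiLp.neg_apply]
  ring

end Linking

/-- Distinct orbits of `∂/∂t` are unlinked. -/
theorem integral_gaussIntegrand_eq_zero {τ : E2 × ℝ → E3} (hτ : IsTorusEmbedding τ)
    (hstd : IsDeformationOfStandard τ) {x y : E2} (hx : x ∈ disk) (hy : y ∈ disk) (hxy : x ≠ y) :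
    ∫ q : ℝ × ℝ, gaussIntegrand τ (x, q.1) (y, q.2) ∂(periodMeasure.prod periodMeasure) = 0 := by
  obtain ⟨A, B, -, -, σ, hσ, hemb, hσ0, hσ1⟩ := hstd
  -- The difference of the two orbits under `σ s`, a homotopy from parallels of the standard torus
  -- at `s = 0` to orbits of `τ` at `s = 1`.
  obtain ⟨z, hzdef⟩ : ∃ z : ℝ × ℝ × ℝ → E3,
    z = fun p => σ p.1 (x, p.2.1) - σ p.1 (y, p.2.2) := ⟨_, rfl⟩
  have hz : ContDiffOn ℝ ∞ z slab := by
    rw [hzdef]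
    exact (hσ.comp (f := fun p : ℝ × ℝ × ℝ => (p.1, x, p.2.1)) (by fun_prop)
      fun p hp => ⟨hp.1, hx, mem_univ _⟩).sub
      (hσ.comp (f := fun p : ℝ × ℝ × ℝ => (p.1, y, p.2.2)) (by fun_prop)
      fun p hp => ⟨hp.1, hy, mem_univ _⟩)
  have hzv : ∀ s t u, z (s, t, u) = σ s (x, t) - σ s (y, u) := fun s t u => by rw [hzdef]
  clear hzdef
  have hm : ∀ {w : E2}, w ∈ disk → ∀ t : ℝ, (w, t) ∈ cylinder := fun hw t => ⟨hw, mem_univ t⟩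
  have h0 : ∀ p ∈ slab, z p ≠ 0 := by
    rintro ⟨s, t, u⟩ ⟨hs, -⟩
    rw [hzv]
    exact (hemb s hs).sub_ne_zero hx hy hxy t u
  have hper₁ : ∀ p ∈ slab, z (p + (0, 1, 0)) = z p := by
    rintro ⟨s, t, u⟩ ⟨hs, -⟩
    simp only [Prod.mk_add_mk, add_zero, hzv]
    rw [(hemb s hs).periodic x hx]
  have hper₂ : ∀ p ∈ slab, z (p + (0, 0, 1)) = z p := by
    rintro ⟨s, t, u⟩ ⟨hs, -⟩
    simp only [Prod.mk_add_mk, add_zero, hzv]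
    rw [(hemb s hs).periodic y hy]
  have hz1 : ∀ t u, z (1, t, u) = τ (x, t) - τ (y, u) := fun t u => by
    rw [hzv, hσ1 (hm hx t), hσ1 (hm hy u)]
  have hz0 : ∀ t u, z (0, t, u) = standardTorus A B (x, t) - standardTorus A B (y, u) :=
    fun t u => by rw [hzv, hσ0 (hm hx t), hσ0 (hm hy u)]
  rw [integral_gaussIntegrand_eq hz hτ hx hy hz1, integral_solidAngle_eq hz h0 hper₁ hper₂,
    integral_solidAngle_standardTorus hz hz0, neg_zero]

/-! ### The helicity of `∂/∂t` as an integral of Gauss integrals. -/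

section Measure

variable {τ : E2 × ℝ → E3} (hτ : IsTorusEmbedding τ) (hvol : IsVolumePreserving τ)
include hτ hvol

theorem volume_image {S : Set (E2 × ℝ)} (hS : MeasurableSet S) (hSD : S ⊆ fundamentalDomain) :
    volume (τ '' S) = volume S := by
  obtain ⟨-, h2, h3, -, h5⟩ := changeOfVariables_aux hτ hvol
  have hsub : prodEquiv ⁻¹' S ⊆ prodEquiv ⁻¹' fundamentalDomain := preimage_mono hSD
  have hm : MeasurableSet (prodEquiv ⁻¹' S) := prodEquiv.continuous.measurable hS
  have h := lintegral_abs_det_fderiv_eq_addHaar_image volume hm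
    (fun x hx => (h2 x (hsub hx)).mono hsub) (h3.mono hsub)
  rw [image_comp, image_preimage_eq _ prodEquiv.surjective] at h
  rw [← h, ← measurePreserving_prodEquiv.measure_preimage hS.nullMeasurableSet]
  refine (setLIntegral_congr_fun (g := fun _ => 1) hm fun x hx => ?_).trans (by simp)
  simp only [h5 x (hsub hx), ENNReal.ofReal_one]

/-- Nothing is known about `τ` off the cylinder, so it is replaced by a globally measurable map;
products of this map transport integrability to pairs of points. -/
theorem exists_measurePreserving : ∃ T : E2 × ℝ → E3, EqOn T τ fundamentalDomain ∧
    MeasurePreserving T (volume.restrict fundamentalDomain)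
      (volume.restrict (τ '' fundamentalDomain)) := by
  classical
  have hT : Measurable (fundamentalDomain.piecewise τ fun _ => (0 : E3)) :=
    (hτ.smooth.continuousOn.mono fundamentalDomain_subset_cylinder).measurable_piecewise
      continuousOn_const measurableSet_fundamentalDomain
  have hE : EqOn (fundamentalDomain.piecewise τ fun _ => (0 : E3)) τ fundamentalDomain :=
    piecewise_eqOn _ _ _
  refine ⟨_, hE, hT, Measure.ext fun S hS => ?_⟩
  rw [Measure.map_apply hT hS, Measure.restrict_apply (hT hS), Measure.restrict_apply hS,
    ← volume_image hτ hvol ((hT hS).inter measurableSet_fundamentalDomain) inter_subset_right]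
  congr 1
  ext q
  constructor
  · rintro ⟨p, ⟨hp, hpD⟩, rfl⟩
    rw [mem_preimage, hE hpD] at hp
    exact ⟨hp, p, hpD, rfl⟩
  · rintro ⟨hq, p, hpD, rfl⟩
    exact ⟨p, ⟨by rwa [mem_preimage, hE hpD], hpD⟩, rfl⟩

/-- The integrand is singular on the diagonal; integrability is pulled back from the Biot-Savart
double integral in space. -/
theorem integrable_gaussIntegrand :
    Integrable (fun q : (E2 × ℝ) × (E2 × ℝ) => gaussIntegrand τ q.1 q.2)
      ((volume.restrict fundamentalDomain).prod (volume.restrict fundamentalDomain)) := by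
  have hT := (isAdmissible_verticalField hτ hvol).toIsBoundedField
  obtain ⟨T, hTE, hTm⟩ := exists_measurePreserving hτ hvol
  have hi := (hT.integrable_kernel hT).integrableOn
    (s := (τ '' fundamentalDomain) ×ˢ (τ '' fundamentalDomain))
  rw [IntegrableOn, ← Measure.prod_restrict] at hi
  refine ((hTm.prod hTm).integrable_comp_of_integrable hi).congr ?_
  rw [Measure.prod_restrict]
  filter_upwards [ae_restrict_mem (measurableSet_fundamentalDomain.prod
    measurableSet_fundamentalDomain)] with q hq
  simp only [Function.comp_apply, Prod.map_fst, Prod.map_snd, hTE hq.1, hTE hq.2,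
    pushforward_apply hτ _ hq.1, pushforward_apply hτ _ hq.2]
  rfl

theorem relHelicity_verticalField_eq :
    relHelicity (pushforward τ verticalField) (pushforward τ verticalField)
      = ∫ q, gaussIntegrand τ q.1 q.2
        ∂((volume.restrict fundamentalDomain).prod (volume.restrict fundamentalDomain)) := by
  have hT := (isAdmissible_verticalField hτ hvol).toIsBoundedField
  rw [integral_prod _ (integrable_gaussIntegrand hτ hvol), relHelicity,
    integral_pushforward hτ hvol]
  refine setIntegral_congr_fun measurableSet_fundamentalDomain fun p hp => ?_
  beta_reduce
  rw [hT.biotSavart_apply, integral_of_support hτ hvol fun q hq => by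
    rw [pushforward_of_notMem _ hq]; simp]
  refine setIntegral_congr_fun measurableSet_fundamentalDomain fun p' hp' => ?_
  beta_reduce
  rw [pushforward_apply hτ _ hp']
  rfl

end Measure

/-- Regroups a pair of points `((x, t), (y, u))` as a pair of orbits with a pair of times. -/
theorem measurePreserving_prodProdProdComm {α β γ δ : Type} [MeasurableSpace α]
    [MeasurableSpace β] [MeasurableSpace γ] [MeasurableSpace δ] (μ : Measure α) (ν : Measure β)
    (ρ : Measure γ) (κ : Measure δ) [SFinite μ] [SFinite ν] [SFinite ρ] [SFinite κ] :
    MeasurePreserving (fun p : (α × β) × (γ × δ) => ((p.1.1, p.2.1), (p.1.2, p.2.2)))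
      ((μ.prod ν).prod (ρ.prod κ)) ((μ.prod ρ).prod (ν.prod κ)) := by
  have h1 := measurePreserving_prodAssoc μ ν (ρ.prod κ)
  have h2 := (MeasurePreserving.id μ).prod
    (MeasurePreserving.symm MeasurableEquiv.prodAssoc (measurePreserving_prodAssoc ν ρ κ))
  have h3 := (MeasurePreserving.id μ).prod
    ((Measure.measurePreserving_swap (μ := ν) (ν := ρ)).prod (MeasurePreserving.id κ))
  have h4 := (MeasurePreserving.id μ).prod (measurePreserving_prodAssoc ρ ν κ)
  have h5 := MeasurePreserving.symm MeasurableEquiv.prodAssoc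
    (measurePreserving_prodAssoc μ ρ (ν.prod κ))
  exact h5.comp (h4.comp (h3.comp (h2.comp h1)))

theorem integral_prod_prod_eq_zero {α β : Type} [MeasurableSpace α] [MeasurableSpace β]
    {μ : Measure α} {ν : Measure β} [SFinite μ] [SFinite ν] {f : (α × β) × (α × β) → ℝ}
    (hf : Integrable f ((μ.prod ν).prod (μ.prod ν)))
    (h : ∀ᵐ q ∂(μ.prod μ), ∫ r, f ((q.1, r.1), (q.2, r.2)) ∂(ν.prod ν) = 0) :
    ∫ p, f p ∂((μ.prod ν).prod (μ.prod ν)) = 0 := by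
  have hmp := measurePreserving_prodProdProdComm μ μ ν ν
  rw [← hmp.map_eq, integral_map hmp.aemeasurable (hmp.map_eq ▸ hf.aestronglyMeasurable)]
  refine (integral_prod _ (hmp.integrable_comp_of_integrable hf)).trans ?_
  exact (integral_congr_ae h).trans (integral_zero _ _)

/-- Discards the pairs for which both points lie on the same orbit, where the linking argument does
not apply. -/
theorem ae_fst_ne_snd : ∀ᵐ q ∂((volume.restrict disk).prod (volume.restrict disk)),
    q.1 ≠ q.2 := by
  have hm : MeasurableSet {q : E2 × E2 | q.1 = q.2} := measurableSet_eq_fun measurable_fst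
    measurable_snd
  rw [ae_iff]
  simp only [not_not]
  rw [Measure.measure_prod_null hm]
  refine Eventually.of_forall fun x => ?_
  have : Prod.mk x ⁻¹' {q : E2 × E2 | q.1 = q.2} = {x} := by ext y; simp [eq_comm]
  beta_reduce
  rw [this]
  simp

theorem restrict_fundamentalDomain : (volume : Measure (E2 × ℝ)).restrict fundamentalDomain
    = (volume.restrict disk).prod periodMeasure := by
  rw [Measure.prod_restrict, fundamentalDomain, Measure.volume_eq_prod]

theorem relHelicity_verticalField_self {τ : E2 × ℝ → E3} (hτ : IsTorusEmbedding τ)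
    (hvol : IsVolumePreserving τ) (hstd : IsDeformationOfStandard τ) :
    relHelicity (pushforward τ verticalField) (pushforward τ verticalField) = 0 := by
  have hi := integrable_gaussIntegrand hτ hvol
  rw [relHelicity_verticalField_eq hτ hvol]
  rw [restrict_fundamentalDomain] at hi ⊢
  refine integral_prod_prod_eq_zero hi ?_
  have hmem : ∀ᵐ q ∂((volume.restrict disk).prod (volume.restrict disk)),
      q ∈ disk ×ˢ disk := by
    rw [Measure.prod_restrict]
    exact ae_restrict_mem (measurableSet_disk.prod measurableSet_disk)
  filter_upwards [ae_fst_ne_snd, hmem] with q hq hqd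
  exact integral_gaussIntegrand_eq_zero hτ hstd hqd.1 hqd.2 hq

end DiskSuspension

end

theorem theorem1p2
    (φ : ℝ → DiskSuspension.E2 → DiskSuspension.E2)
    (hφ : DiskSuspension.IsAreaPreservingIsotopy φ)
    (τ : DiskSuspension.E2 × ℝ → DiskSuspension.E3)
    (hτ : DiskSuspension.IsTorusEmbedding τ)
    (hvol : DiskSuspension.IsVolumePreserving τ)
    (hstd : DiskSuspension.IsDeformationOfStandard τ) :
    ∃ Cal hSum hX hT r : ℝ,
      DiskSuspension.IsCalabiInvariant (φ 1) Cal ∧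
      DiskSuspension.IsHelicity
        (DiskSuspension.pushforward τ (DiskSuspension.suspensionField φ)) hSum ∧
      DiskSuspension.IsHelicity
        (DiskSuspension.pushforward τ (DiskSuspension.horizontalField φ)) hX ∧
      DiskSuspension.IsHelicity
        (DiskSuspension.pushforward τ DiskSuspension.verticalField) hT ∧
      DiskSuspension.IsRelativeHelicity
        (DiskSuspension.pushforward τ (DiskSuspension.horizontalField φ))
        (DiskSuspension.pushforward τ DiskSuspension.verticalField) r ∧
      hSum = 2 * Cal ∧
      hSum = hX + 2 * r + hT ∧
      hX = 0 ∧ hT = 0 ∧ r = Cal := by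
  obtain ⟨F, hF⟩ := hφ.exists_hamiltonian
  have hX := DiskSuspension.isAdmissible_horizontalField hτ hvol hφ hF
  have hT := DiskSuspension.isAdmissible_verticalField hτ hvol
  have hXX := DiskSuspension.relHelicity_horizontalField_self hτ hvol hφ hF
  have hTT := DiskSuspension.relHelicity_verticalField_self hτ hvol hstd
  have hXT := DiskSuspension.relHelicity_horizontalField_verticalField hτ hvol hφ hF
  have hS := hX.relHelicity_add_self hT
  refine ⟨∫ t in (0 : ℝ)..1, ∫ x in DiskSuspension.disk, F t x, _, _, _, _,
    DiskSuspension.isCalabiInvariant_of_hamiltonian hφ hF, ?_, hX.isRelativeHelicity hX,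
    hT.isRelativeHelicity hT, hX.isRelativeHelicity hT, ?_, hS, hXX, hTT, hXT⟩
  · rw [DiskSuspension.pushforward_suspensionField]
    exact (hX.add hT).isRelativeHelicity (hX.add hT)
  · rw [hS, hXX, hTT, hXT]
    ring
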